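/- Let $k$ be an algebraically closed field, $X$ a smooth projective connected curve of genus $g$ over $k$, and $x_1,\dots,x_r\in X$ ($r\ge 0$) pairwise distinct closed points with $2g-2+r>0$. Let $\Omega^{\log}=\Omega_{X/k}(\sum_i x_i)$ and let $\tau^{\log}$ be its dual, the sheaf of vector fields with at least simple zeros at the $x_i$. A flat vector bundle on $X$ is a vector bundle $\mathcal E$ with a connection $\nabla:\mathcal E\to\mathcal E\otimes\Omega^{\log}$. Two flat vector bundles $\mathcal E,\mathcal E'$ are equivalent, $\mathcal E\sim\mathcal E'$, if there are a flat line bundle $\mathcal L$ and a horizontal isomorphism $\mathcal E'\cong\mathcal E\otimes\mathcal L$. Let $(\mathcal E,\nabla)$ be a flat vector bundle of rank two. Its monodromy operator $\mu_i$ at $x_i$ is the $k$-linear endomorphism of the fibre $\mathcal E|_{x_i}$ induced by $\nabla(t\,\partial/\partial t)$, where $t$ is a local parameter at $x_i$ (it does not depend on $t$); the two eigenvalues $\alpha_i,\beta_i$ of $\mu_i$, counted with multiplicity, are the local exponents at $x_i$, and the monodromy at $x_i$ is toric if $\mu_i$ is semisimple. A filtration on $(\mathcal E,\nabla)$ is a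 line subbundle $F^1\subset\mathcal E$ such that $\mathrm{Gr}^1=\mathcal E/F^1$ is a line bundle; its Kodaira–Spencer map is the $\mathcal O_X$-linear map $\kappa:\tau^{\log}\to \mathcal Hom(F^1,\mathrm{Gr}^1)$, $D\mapsto(e\mapsto\nabla(D)e \bmod F^1)$. A filtration is a Hodge filtration if $\kappa$ is an isomorphism. The bundle $(\mathcal E,\nabla)$ is indigenous if it has a Hodge filtration and $\mu_i\ne0$ for all $i=1,\dots,r$. Proposition. Let $(\mathcal E,\nabla)$ be an indigenous bundle on $X$. Then: (i) the Hodge filtration of $(\mathcal E,\nabla)$ is unique; (ii) for every $i\in\{1,\dots,r\}$ such that the monodromy at $x_i$ is toric, with exponents $\alpha_i,\beta_i$, one has $\alpha_i\neq\beta_i$; (iii) every flat vector bundle $\mathcal E'\sim\mathcal E$ is indigenous as well. -/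

import Mathlib

open CategoryTheory AlgebraicGeometry Opposite TensorProduct
open scoped KaehlerDifferential

universe u

/-- A smooth projective connected curve `X` over the field `k` with `r` pairwise distinct closed
marked points. (For a smooth curve over a field, proper and projective are the same.) -/
structure MarkedCurve (k : Type u) [Field k] (r : ℕ) where
  X : Scheme.{u}
  str : X ⟶ Spec (CommRingCat.of k)
  smooth : SmoothOfRelativeDimension 1 str
  proper : IsProper str
  connected : ConnectedSpace X
  pt : Fin r → X
  isClosed_pt : ∀ i, IsClosed {pt i}
  pt_injective : Function.Injective pt

namespace MarkedCurve

variable {k : Type u} [Field k] {r : ℕ}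

/-- The structure of `k`-algebra on the ring of functions on an open subset of the curve. -/
noncomputable instance algebraSections (C : MarkedCurve k r) (U : C.X.Opens) :
    Algebra k Γ(C.X, U) :=
  ((C.str.appLE ⊤ U le_top).hom.comp (Scheme.ΓSpecIso (CommRingCat.of k)).inv.hom).toAlgebra

/-- Restriction of functions. -/
def res (C : MarkedCurve k r) {U V : C.X.Opens} (h : V ≤ U) : Γ(C.X, U) →+* Γ(C.X, V) :=
  (C.X.presheaf.map (homOfLE h).op).hom

theorem res_algebraMap (C : MarkedCurve k r) {U V : C.X.Opens} (h : V ≤ U) (c : k) :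
    C.res h (algebraMap k Γ(C.X, U) c) = algebraMap k Γ(C.X, V) c := by
  have := Scheme.Hom.appLE_map C.str (U := ⊤) (V := U) le_top (homOfLE h).op
  exact congr($(this).hom ((Scheme.ΓSpecIso (CommRingCat.of k)).inv.hom c))

/-- Restriction of differential forms between open subsets. -/
noncomputable def resForm (C : MarkedCurve k r) {U V : C.X.Opens} (h : V ≤ U) :
    Ω[Γ(C.X, U)⁄k] →ₗ[k] Ω[Γ(C.X, V)⁄k] :=
  letI : Algebra Γ(C.X, U) Γ(C.X, V) := (C.res h).toAlgebra
  haveI : IsScalarTower k Γ(C.X, U) Γ(C.X, V) :=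
    IsScalarTower.of_algebraMap_eq fun c => (C.res_algebraMap h c).symm
  (KaehlerDifferential.map k k Γ(C.X, U) Γ(C.X, V)).restrictScalars k

/-- The space `H⁰(X, Ω_{X/k})` of global differential forms: compatible families of differential
forms on the affine open subsets. -/
noncomputable def globalForms (C : MarkedCurve k r) :
    Submodule k (∀ U : C.X.affineOpens, Ω[Γ(C.X, U.1)⁄k]) where
  carrier := {ω | ∀ (U V : C.X.affineOpens) (h : V.1 ≤ U.1), C.resForm h (ω U) = ω V}
  add_mem' ha hb U V h := by simp [ha U V h, hb U V h]
  zero_mem' U V h := by simp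
  smul_mem' c a ha U V h := by simp [ha U V h]

/-- The genus `dim_k H⁰(X, Ω_{X/k})`. -/
noncomputable def genus (C : MarkedCurve k r) : ℕ :=
  Module.finrank k C.globalForms

/-- The sections over `U` (affine) of the sheaf `τ^log` of vector fields with at least simple zeros
in the marked points: the `k`-derivations `D` of `Γ(X, U)` such that `D f` vanishes at every marked
point in `U`, for all functions `f`. -/
noncomputable def logVF (C : MarkedCurve k r) (U : C.X.Opens) :
    Submodule Γ(C.X, U) (Derivation k Γ(C.X, U) Γ(C.X, U)) where
  carrier := {D | ∀ (i : Fin r) (h : C.pt i ∈ U) (f : Γ(C.X, U)),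
    (C.X.evaluation U (C.pt i) h).hom (D f) = 0}
  add_mem' ha hb i h f := by
    rw [Derivation.add_apply, map_add, ha i h f, hb i h f, add_zero]
  zero_mem' i h f := by rw [Derivation.zero_apply, map_zero]
  smul_mem' c a ha i h f := by
    rw [Derivation.smul_apply, smul_eq_mul, map_mul, ha i h f, mul_zero]

/-- The ideal of functions on `U` vanishing at the point `x`. -/
noncomputable def idealAt (C : MarkedCurve k r) (U : C.X.Opens) (x : C.X) (hx : x ∈ U) :
    Ideal Γ(C.X, U) :=
  RingHom.ker (C.X.evaluation U x hx).hom

/-- A local parameter `t` at the `i`-th marked point, given on an affine neighbourhood `U` on which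
the logarithmic vector field `t ∂/∂t` (the one with `D t = t`) is defined. -/
structure LogCoordinate (C : MarkedCurve k r) (i : Fin r) where
  U : C.X.affineOpens
  mem : C.pt i ∈ U.1
  t : Γ(C.X, U.1)
  isParameter : Ideal.span {(C.X.presheaf.germ U.1 (C.pt i) mem).hom t} =
    IsLocalRing.maximalIdeal (C.X.presheaf.stalk (C.pt i))
  D : C.logVF U.1
  D_t : D.1 t = t

end MarkedCurve

open MarkedCurve

section Bundles

variable {k : Type u} [Field k] {r : ℕ}

noncomputable instance moduleSections (C : MarkedCurve k r) (M : C.X.Modules) (U : C.X.Opens) :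
    Module k Γ(M, U) :=
  Module.compHom _ (algebraMap k Γ(C.X, U))

instance isScalarTowerSections (C : MarkedCurve k r) (M : C.X.Modules) (U : C.X.Opens) :
    IsScalarTower k Γ(C.X, U) Γ(M, U) :=
  IsScalarTower.of_algebraMap_smul fun _ _ => rfl

/-- Restriction of sections of a sheaf of modules. -/
noncomputable def resSection {X : Scheme.{u}} (M : X.Modules) {U V : X.Opens} (h : V ≤ U)
    (s : Γ(M, U)) : Γ(M, V) :=
  M.presheaf.map (homOfLE h).op s

/-- The sections `b₁, …, bₙ` over `U` are a frame of `M` on `U`, i.e. they define an isomorphism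
`𝒪ⁿ ≅ M` on `U`. -/
def IsFrame {X : Scheme.{u}} (M : X.Modules) {n : ℕ} (U : X.Opens) (b : Fin n → Γ(M, U)) : Prop :=
  ∀ (V : X.Opens) (h : V ≤ U),
    LinearIndependent Γ(X, V) (fun j => resSection M h (b j)) ∧
    Submodule.span Γ(X, V) (Set.range fun j => resSection M h (b j)) = ⊤

/-- `M` is a vector bundle of rank `n`. -/
def IsVectorBundle {X : Scheme.{u}} (M : X.Modules) (n : ℕ) : Prop :=
  ∀ x : X, ∃ (U : X.Opens) (_ : x ∈ U) (b : Fin n → Γ(M, U)), IsFrame M U b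

/-- A flat vector bundle of rank `n`: a vector bundle `E` with a connection
`∇ : E → E ⊗ Ω^log = ℋom(τ^log, E)`. It is given by the covariant derivatives `∇(D)` along
sections `D` of `τ^log` over affine open subsets, compatible with restriction. -/
structure FlatBundle (C : MarkedCurve k r) (n : ℕ) where
  E : C.X.Modules
  isVectorBundle : IsVectorBundle E n
  nabla (U : C.X.affineOpens) : C.logVF U.1 → Γ(E, U.1) → Γ(E, U.1)
  add_left : ∀ U D D' e, nabla U (D + D') e = nabla U D e + nabla U D' e
  smul_left : ∀ U (f : Γ(C.X, U.1)) D e, nabla U (f • D) e = f • nabla U D e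
  add_right : ∀ U D e e', nabla U D (e + e') = nabla U D e + nabla U D e'
  leibniz : ∀ U D (f : Γ(C.X, U.1)) e, nabla U D (f • e) = f • nabla U D e + D.1 f • e
  restrict : ∀ (U V : C.X.affineOpens) (h : V.1 ≤ U.1) (D : C.logVF U.1) (D' : C.logVF V.1),
    (∀ f, D'.1 (C.res h f) = C.res h (D.1 f)) →
    ∀ e, nabla V D' (resSection E h e) = resSection E h (nabla U D e)

/-- A filtration on a rank two bundle `M`: a subsheaf `F¹ ⊂ M` of modules such that locally there
is a frame `(b₀, b₁)` of `M` with `F¹` generated by `b₀`; that is, `F¹` and `M / F¹` are line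
bundles. -/
structure Filtration {X : Scheme.{u}} (M : X.Modules) where
  F (U : X.Opens) : Submodule Γ(X, U) Γ(M, U)
  restrict : ∀ (U V : X.Opens) (h : V ≤ U), ∀ s ∈ F U, resSection M h s ∈ F V
  isLocal : ∀ (U : X.Opens) (s : Γ(M, U)),
    (∀ x ∈ U, ∃ (V : X.Opens) (h : V ≤ U), x ∈ V ∧ resSection M h s ∈ F V) → s ∈ F U
  isSubbundle : ∀ x : X, ∃ (U : X.Opens) (_ : x ∈ U) (b : Fin 2 → Γ(M, U)), IsFrame M U b ∧
    ∀ (V : X.Opens) (h : V ≤ U), F V = Submodule.span Γ(X, V) {resSection M h (b 0)}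

namespace FlatBundle

variable {C : MarkedCurve k r} {n : ℕ}

/-- The Kodaira--Spencer map `κ : τ^log → ℋom(F¹, Gr¹)` over an affine open subset `U`: it sends
`D` to the linear map `e ↦ ∇(D) e mod F¹`. -/
noncomputable def kodairaSpencer (E : FlatBundle C 2) (F : Filtration E.E) (U : C.X.affineOpens) :
    C.logVF U.1 →ₗ[Γ(C.X, U.1)] (F.F U.1 →ₗ[Γ(C.X, U.1)] (Γ(E.E, U.1) ⧸ F.F U.1)) where
  toFun D :=
    { toFun := fun e => (F.F U.1).mkQ (E.nabla U D e.1)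
      map_add' := fun a b => by
        rw [Submodule.coe_add, E.add_right, map_add]
      map_smul' := fun f a => by
        have h : (F.F U.1).mkQ (D.1 f • a.1) = 0 := by
          rw [Submodule.mkQ_apply, Submodule.Quotient.mk_eq_zero]
          exact (F.F U.1).smul_mem _ a.2
        rw [Submodule.coe_smul, E.leibniz, map_add, h, add_zero, map_smul, RingHom.id_apply] }
  map_add' D D' := by
    ext e
    simp only [LinearMap.coe_mk, AddHom.coe_mk, LinearMap.add_apply, E.add_left, map_add]
  map_smul' f D := by
    ext e
    simp only [LinearMap.coe_mk, AddHom.coe_mk, LinearMap.smul_apply, E.smul_left, map_smul,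
      RingHom.id_apply]

/-- `F` is a Hodge filtration: the Kodaira--Spencer map is an isomorphism of sheaves. (Both sides
are quasi-coherent, with sections over an affine open subset as above, so this is tested on affine
open subsets.) -/
def IsHodge (E : FlatBundle C 2) (F : Filtration E.E) : Prop :=
  ∀ U : C.X.affineOpens, Function.Bijective (E.kodairaSpencer F U)

/-- The submodule `𝔪ₓ E` of sections over the affine open subset `U ∋ x`, as a `k`-subspace. -/
noncomputable def fiberKer (E : FlatBundle C n) (U : C.X.affineOpens) (x : C.X) (hx : x ∈ U.1) :
    Submodule k Γ(E.E, U.1) :=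
  (C.idealAt U.1 x hx • (⊤ : Submodule Γ(C.X, U.1) Γ(E.E, U.1))).restrictScalars k

/-- The fibre `E / 𝔪ₓ E` of the bundle at a point `x` of the affine open subset `U`. -/
abbrev Fiber (E : FlatBundle C n) (U : C.X.affineOpens) (x : C.X) (hx : x ∈ U.1) : Type u :=
  Γ(E.E, U.1) ⧸ E.fiberKer U x hx

theorem nabla_smul (E : FlatBundle C n) (U : C.X.affineOpens) (D : C.logVF U.1) (c : k)
    (e : Γ(E.E, U.1)) : E.nabla U D (c • e) = c • E.nabla U D e := by
  rw [← algebraMap_smul Γ(C.X, U.1) c e, E.leibniz, Derivation.map_algebraMap, zero_smul, add_zero,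
    algebraMap_smul]

/-- The covariant derivative as a `k`-linear endomorphism. -/
noncomputable def nablaEnd (E : FlatBundle C n) (U : C.X.affineOpens) (D : C.logVF U.1) :
    Module.End k Γ(E.E, U.1) where
  toFun := E.nabla U D
  map_add' := E.add_right U D
  map_smul' := E.nabla_smul U D

theorem nablaEnd_mem (E : FlatBundle C n) {i : Fin r} (z : C.LogCoordinate i) :
    E.fiberKer z.U (C.pt i) z.mem ≤
      (E.fiberKer z.U (C.pt i) z.mem).comap (E.nablaEnd z.U z.D) := by
  intro e he
  rw [fiberKer, Submodule.restrictScalars_mem] at he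
  change E.nabla z.U z.D e ∈ (C.idealAt z.U.1 (C.pt i) z.mem •
    (⊤ : Submodule Γ(C.X, z.U.1) Γ(E.E, z.U.1)))
  refine Submodule.smul_induction_on he ?_ ?_
  · intro f hf s _
    rw [E.leibniz]
    exact Submodule.add_mem _ (Submodule.smul_mem_smul hf trivial)
      (Submodule.smul_mem_smul (z.D.2 i z.mem f) trivial)
  · intro a b ha hb
    rw [E.add_right]
    exact Submodule.add_mem _ ha hb

/-- The monodromy operator `μᵢ`: the `k`-linear endomorphism of the fibre at the `i`-th marked
point induced by `∇(t ∂/∂t)`. -/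
noncomputable def monodromy (E : FlatBundle C n) {i : Fin r} (z : C.LogCoordinate i) :
    Module.End k (E.Fiber z.U (C.pt i) z.mem) :=
  (E.fiberKer z.U (C.pt i) z.mem).mapQ _ (E.nablaEnd z.U z.D) (E.nablaEnd_mem z)

/-- `∇` has toric monodromy at the `i`-th marked point. -/
def IsToric (E : FlatBundle C 2) {i : Fin r} (z : C.LogCoordinate i) : Prop :=
  (E.monodromy z).IsSemisimple

/-- `α, β` are the two local exponents of `∇` at the `i`-th marked point, i.e. the eigenvalues of
the monodromy operator, counted with multiplicity. -/
def HasExponents (E : FlatBundle C 2) {i : Fin r} (z : C.LogCoordinate i) (α β : k) : Prop :=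
  ∃ b : Module.Basis (Fin 2) k (E.Fiber z.U (C.pt i) z.mem),
    (LinearMap.toMatrix b b (E.monodromy z)).charpoly =
      (Polynomial.X - Polynomial.C α) * (Polynomial.X - Polynomial.C β)

/-- A flat bundle of rank two is indigenous if it has a Hodge filtration and nonzero monodromy at
every marked point. -/
structure IsIndigenous (E : FlatBundle C 2) : Prop where
  exists_hodge : ∃ F : Filtration E.E, E.IsHodge F
  monodromy_ne_zero : ∀ (i : Fin r) (z : C.LogCoordinate i), E.monodromy z ≠ 0

/-- A horizontal isomorphism `E ⊗ L ≅ E'` with `L` a flat line bundle, where `E ⊗ L` carries the tensor product connection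
`∇(D)(e ⊗ l) = ∇(D) e ⊗ l + e ⊗ ∇(D) l`. Over an affine open subset `U`, the sections of `E ⊗ L`
are `Γ(E, U) ⊗ Γ(L, U)`. -/
structure HorizontalTensorIso (E : FlatBundle C n) (L : FlatBundle C 1)
    (E' : FlatBundle C n) where
  iso (U : C.X.affineOpens) :
    (Γ(E.E, U.1) ⊗[Γ(C.X, U.1)] Γ(L.E, U.1)) ≃ₗ[Γ(C.X, U.1)] Γ(E'.E, U.1)
  restrict : ∀ (U V : C.X.affineOpens) (h : V.1 ≤ U.1) (e : Γ(E.E, U.1)) (l : Γ(L.E, U.1)),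
    iso V (resSection E.E h e ⊗ₜ resSection L.E h l) = resSection E'.E h (iso U (e ⊗ₜ l))
  horizontal : ∀ (U : C.X.affineOpens) (D : C.logVF U.1) (e : Γ(E.E, U.1)) (l : Γ(L.E, U.1)),
    E'.nabla U D (iso U (e ⊗ₜ l)) =
      iso U (E.nabla U D e ⊗ₜ l) + iso U (e ⊗ₜ L.nabla U D l)

/-- `E ∼ E'`: there are a flat line bundle `L` and a horizontal isomorphism `E' ≅ E ⊗ L`. -/
def Equivalent (E E' : FlatBundle C n) : Prop :=
  ∃ L : FlatBundle C 1, Nonempty (HorizontalTensorIso E L E')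

end FlatBundle

end Bundles

/-! Everything is computed in the generic fibre. The curve is integral with function field K, so a
rank two bundle becomes the plane K² with a lattice at each closed point, a filtration becomes a
line K·v, and the connection along a fixed generator `vf` of Der_k(K) becomes one Leibniz operator
N. Its second fundamental form κ(v) = v ∧ N v satisfies κ(fv) = f²κ(v). If b₀, b₁ is a frame near P
with b₀ on the line, then the Kodaira–Spencer map is multiplication by κ(b₀)/(b₀ ∧ b₁). So being
Hodge is a condition at closed points: this factor must carry the logarithmic vector fields at P
exactly onto the regular functions (`IsHodge.isHodgeAt`, `IsHodge.of_forall_isHodgeAt`).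

Uniqueness. A Hodge filtration gives τ^log ≅ (F¹)^(-2) ⊗ det E. Hence for two Hodge lines v, w the
function h = (v ∧ w)²/(κ(v)κ(w)), which depends only on the lines, is a global section of the square
of τ^log. That sheaf has negative degree, so h = 0 and the lines coincide
(`wedge_eq_zero_of_isHodgeAt`).

The vanishing of h is proved by genus. If g ≥ 2, then h times the square of any global form is
constant, so two independent forms would have a constant ratio. If g = 1, then hω² is a constant
that vanishes at a marked point. If g = 0, there are three marked points, and h ≠ 0 would mean deg Ω
≤ -3. This is refuted on X × X: filter the sections of 𝒪(A) ⊠ 𝒪(A) by their order along the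
diagonal. The i-th graded piece embeds in the sections of 𝒪(2A) ⊗ Ω^i, of degree at most 2N - 3i
with N = deg A, so the total dimension is at most about 2N²/3, while the sections number about N²
(`CompleteCurve.Parameters.eq_zero_of_ord_ge`). The only degree theory needed is that a rational
function has as many zeros as poles.

Exponents. At a marked point the isomorphism κ says that the monodromy operator does not preserve
the line F¹ in the fibre, so it is not a scalar (`IsHodge.monodromy_ne`). A semisimple operator with
equal eigenvalues is a scalar, whence (ii).

Twisting. Tensoring with a flat line bundle multiplies κ(b₀) and b₀ ∧ b₁ by the same factor, so the
image of a Hodge line is a Hodge line; its monodromy is then nonzero because it is not a scalar. -/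

/-! ### Discrete valuations of a function field -/

/-- A discrete valuation of the field `K`, trivial on `k` and with residue field `k`, given by the
order function on nonzero elements. -/
structure RationalPlace (k K : Type*) [Field k] [Field K] [Algebra k K] where
  ord : K → ℤ
  ord_mul : ∀ {f g : K}, f ≠ 0 → g ≠ 0 → ord (f * g) = ord f + ord g
  ord_add : ∀ {f g : K}, f ≠ 0 → g ≠ 0 → f + g ≠ 0 → min (ord f) (ord g) ≤ ord (f + g)
  exists_ord_eq_one : ∃ t : K, t ≠ 0 ∧ ord t = 1
  ord_algebraMap : ∀ c : k, c ≠ 0 → ord (algebraMap k K c) = 0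
  exists_residue : ∀ f : K, f ≠ 0 → ord f = 0 →
    ∃ c : k, f - algebraMap k K c ≠ 0 → 0 < ord (f - algebraMap k K c)

namespace RationalPlace

variable {k K : Type*} [Field k] [Field K] [Algebra k K] (P : RationalPlace k K)

theorem ord_one : P.ord 1 = 0 := by
  simpa using P.ord_algebraMap 1 one_ne_zero

theorem ord_inv {f : K} (hf : f ≠ 0) : P.ord f⁻¹ = -P.ord f := by
  have := P.ord_mul hf (inv_ne_zero hf)
  rw [mul_inv_cancel₀ hf, ord_one] at this
  omega

theorem ord_pow {f : K} (hf : f ≠ 0) (n : ℕ) : P.ord (f ^ n) = n * P.ord f := by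
  induction n with
  | zero => simp [ord_one]
  | succ n ih => rw [pow_succ, P.ord_mul (pow_ne_zero _ hf) hf, ih]; push_cast; ring

theorem ord_zpow {f : K} (hf : f ≠ 0) (n : ℤ) : P.ord (f ^ n) = n * P.ord f := by
  obtain ⟨m, rfl | rfl⟩ := n.eq_nat_or_neg
  · simp [ord_pow P hf]
  · rw [zpow_neg, ord_inv _ (zpow_ne_zero _ hf), zpow_natCast, ord_pow P hf]; ring

theorem ord_neg (f : K) : P.ord (-f) = P.ord f := by
  by_cases hf : f = 0
  · simp [hf]
  have h1 : P.ord (-1 : K) = 0 := by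
    simpa using P.ord_algebraMap (-1) (by simp)
  rw [← neg_one_mul, P.ord_mul (by simp) hf, h1, zero_add]

/-- The functions vanishing to order at least `n`. -/
def ge (n : ℤ) : Submodule k K where
  carrier := {f | f ≠ 0 → n ≤ P.ord f}
  add_mem' {f g} hf hg hfg := by
    by_cases hf0 : f = 0
    · subst hf0; simp only [zero_add] at hfg ⊢; exact hg hfg
    by_cases hg0 : g = 0
    · subst hg0; simp only [add_zero] at hfg ⊢; exact hf hfg
    exact (le_min (hf hf0) (hg hg0)).trans (P.ord_add hf0 hg0 hfg)
  zero_mem' h := (h rfl).elim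
  smul_mem' c f hf hcf := by
    have hc : c ≠ 0 := by rintro rfl; simp at hcf
    have hf0 : f ≠ 0 := by rintro rfl; simp at hcf
    rw [Algebra.smul_def, P.ord_mul (by simpa using hc) hf0, P.ord_algebraMap c hc, zero_add]
    exact hf hf0

variable {P}

theorem mem_ge_of_ne {n : ℤ} {f : K} (hf : f ≠ 0) : f ∈ P.ge n ↔ n ≤ P.ord f :=
  ⟨fun h => h hf, fun h _ => h⟩

theorem ge_anti {m n : ℤ} (h : m ≤ n) : P.ge n ≤ P.ge m := fun _ hf h0 => h.trans (hf h0)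

theorem mul_mem_ge {m n : ℤ} {f g : K} (hf : f ∈ P.ge m) (hg : g ∈ P.ge n) :
    f * g ∈ P.ge (m + n) := by
  intro h
  have hf0 := left_ne_zero_of_mul h
  have hg0 := right_ne_zero_of_mul h
  rw [P.ord_mul hf0 hg0]
  exact add_le_add (hf hf0) (hg hg0)

theorem algebraMap_mem_ge (c : k) : algebraMap k K c ∈ P.ge 0 := by
  intro h
  rw [P.ord_algebraMap c (by rintro rfl; simp at h)]

variable (P) in
/-- The valuation ring of the place. -/
def ring : Subalgebra k K where
  carrier := P.ge 0
  mul_mem' hf hg := by simpa using mul_mem_ge hf hg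
  add_mem' := (P.ge 0).add_mem
  algebraMap_mem' := algebraMap_mem_ge

theorem mem_ring {f : K} : f ∈ P.ring ↔ f ∈ P.ge 0 := Iff.rfl

theorem add_ne_zero_of_ord_lt {f g : K} (hf : f ≠ 0) (hg : g ∈ P.ge (P.ord f + 1)) :
    f + g ≠ 0 := by
  intro h
  obtain rfl : g = -f := by rw [← neg_eq_of_add_eq_zero_right h]
  have := hg (neg_ne_zero.2 hf)
  rw [ord_neg] at this
  omega

theorem ord_add_eq {f g : K} (hf : f ≠ 0) (hg : g ∈ P.ge (P.ord f + 1)) :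
    P.ord (f + g) = P.ord f := by
  have hfg := add_ne_zero_of_ord_lt hf hg
  have h1 : f + g ∈ P.ge (P.ord f) :=
    (P.ge _).add_mem (fun _ => le_rfl) (ge_anti (by omega) hg)
  refine le_antisymm ?_ (h1 hfg)
  by_contra! h2
  have h3 : f ∈ P.ge (P.ord f + 1) := by
    have := (P.ge (P.ord f + 1)).sub_mem (x := f + g) (fun _ => by omega) hg
    simpa using this
  have := h3 hf
  omega

theorem exists_smul_sub_mem {n : ℤ} {w v : K} (hw : w ≠ 0) (hwn : P.ord w = n)
    (hv : v ∈ P.ge n) : ∃ c : k, v - c • w ∈ P.ge (n + 1) := by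
  by_cases hvn : v ∈ P.ge (n + 1)
  · exact ⟨0, by simpa using hvn⟩
  have hv0 : v ≠ 0 := by rintro rfl; exact hvn (Submodule.zero_mem _)
  have hvo : P.ord v = n := by
    have := hv hv0
    rw [mem_ge_of_ne hv0] at hvn
    omega
  obtain ⟨c, hc⟩ := P.exists_residue (v * w⁻¹) (mul_ne_zero hv0 (inv_ne_zero hw)) (by
    rw [P.ord_mul hv0 (inv_ne_zero hw), ord_inv _ hw]; omega)
  refine ⟨c, ?_⟩
  have : v - c • w = w * (v * w⁻¹ - algebraMap k K c) := by
    rw [Algebra.smul_def]; field_simp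
  rw [this]
  exact mul_mem_ge (m := n) (n := 1) (fun _ => hwn.ge) (fun h => hc h)

/-- Vanishing to one order more is at most one linear condition. -/
theorem finrank_le_add_one {n : ℤ} {W : Submodule k K} (hW : W ≤ P.ge n)
    [Module.Finite k ↥(W ⊓ P.ge (n + 1))] :
    Module.Finite k W ∧ Module.finrank k W ≤ Module.finrank k ↥(W ⊓ P.ge (n + 1)) + 1 := by
  by_cases h : W ≤ P.ge (n + 1)
  · rw [inf_eq_left.2 h] at *
    exact ⟨inferInstance, by omega⟩
  obtain ⟨w, hw, hwn⟩ := Set.not_subset.1 h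
  have hw0 : w ≠ 0 := by rintro rfl; exact hwn (Submodule.zero_mem _)
  have hwo : P.ord w = n := by
    have := hW hw hw0
    simp only [SetLike.mem_coe, mem_ge_of_ne hw0] at hwn
    omega
  have hle : W ≤ (W ⊓ P.ge (n + 1)) ⊔ Submodule.span k {w} := by
    intro v hv
    obtain ⟨c, hc⟩ := exists_smul_sub_mem hw0 hwo (hW hv)
    rw [← sub_add_cancel v (c • w)]
    exact Submodule.add_mem_sup ⟨W.sub_mem hv (W.smul_mem c hw), hc⟩
      (Submodule.smul_mem _ c (Submodule.mem_span_singleton_self w))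
  refine ⟨Submodule.finiteDimensional_of_le hle, (Submodule.finrank_mono hle).trans ?_⟩
  refine (Submodule.finrank_add_le_finrank_add_finrank _ _).trans ?_
  have := finrank_span_singleton (K := k) hw0
  omega

theorem finrank_le_add {n : ℤ} {W : Submodule k K} (hW : W ≤ P.ge n) (m : ℕ)
    (hf : Module.Finite k ↥(W ⊓ P.ge (n + m))) :
    Module.Finite k W ∧ Module.finrank k W ≤ Module.finrank k ↥(W ⊓ P.ge (n + m)) + m := by
  induction m with
  | zero =>
    have : W ⊓ P.ge (n + (0 : ℕ)) = W := inf_eq_left.2 (by simpa using hW)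
    rw [this] at hf ⊢
    exact ⟨hf, le_rfl⟩
  | succ m ih =>
    have h1 : (W ⊓ P.ge (n + m)) ⊓ P.ge (n + m + 1) = W ⊓ P.ge (n + (m + 1 : ℕ)) := by
      rw [inf_assoc, inf_eq_right.2 (ge_anti (by omega) : P.ge (n + m + 1) ≤ P.ge (n + m))]
      push_cast; rw [add_assoc]
    have : Module.Finite k ↥((W ⊓ P.ge (n + m)) ⊓ P.ge (n + m + 1)) := by rw [h1]; exact hf
    have h2 := finrank_le_add_one (P := P) (n := n + m) (W := W ⊓ P.ge (n + m)) inf_le_right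
    rw [h1] at h2
    have := h2.1
    have h3 := ih h2.1
    exact ⟨h3.1, by omega⟩

end RationalPlace

/-! ### Abstract complete curves and weak approximation -/

/-- A family of rational places of a function field `K` of one variable over `k`, playing the role
of the closed points of a complete curve. -/
structure CompleteCurve (k K S : Type*) [Field k] [Field K] [Algebra k K] where
  place : S → RationalPlace k K
  separates : ∀ s s' : S, s ≠ s' → ∃ f : K, f ≠ 0 ∧ 0 ≤ (place s).ord f ∧ (place s').ord f < 0
  exists_const : ∀ f : K, f ≠ 0 → (∀ s, 0 ≤ (place s).ord f) → ∃ c : k, algebraMap k K c = f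
  finite : ∀ f : K, (∀ c : k, algebraMap k K c ≠ f) →
    FiniteDimensional (IntermediateField.adjoin k {f}) K

namespace CompleteCurve

open RationalPlace

variable {k K S : Type*} [Field k] [Field K] [Algebra k K] (X : CompleteCurve k K S)

/-- The order of vanishing at a point. -/
def ord (s : S) (f : K) : ℤ := (X.place s).ord f

/-- Each further order of vanishing at a point of `T` costs at most one dimension; the points are
treated one at a time. -/
theorem finrank_le_add_sum (T : Finset S) (n : S → ℤ) (m : S → ℕ) {W : Submodule k K}
    (hW : ∀ s ∈ T, W ≤ (X.place s).ge (n s))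
    (hf : Module.Finite k ↥(W ⊓ ⨅ s ∈ T, (X.place s).ge (n s + m s))) :
    Module.Finite k W ∧ Module.finrank k W ≤
      Module.finrank k ↥(W ⊓ ⨅ s ∈ T, (X.place s).ge (n s + m s)) + ∑ s ∈ T, m s := by
  classical
  induction T using Finset.induction_on generalizing W with
  | empty =>
    have : W ⊓ ⨅ s ∈ (∅ : Finset S), (X.place s).ge (n s + m s) = W := by simp
    rw [this] at hf ⊢
    exact ⟨hf, by simp⟩
  | insert a T ha ih =>
    have h1 : (W ⊓ (X.place a).ge (n a + m a)) ⊓ ⨅ s ∈ T, (X.place s).ge (n s + m s) =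
        W ⊓ ⨅ s ∈ insert a T, (X.place s).ge (n s + m s) := by
      rw [Finset.iInf_insert, inf_assoc]
    have : Module.Finite k ↥((W ⊓ (X.place a).ge (n a + m a)) ⊓
      ⨅ s ∈ T, (X.place s).ge (n s + m s)) := by rw [h1]; exact hf
    have h2 := ih (W := W ⊓ (X.place a).ge (n a + m a))
      (fun s hs => inf_le_left.trans (hW s (Finset.mem_insert_of_mem hs))) this
    have := h2.1
    have h3 := finrank_le_add (P := X.place a) (hW a (Finset.mem_insert_self _ _)) (m a) h2.1
    refine ⟨h3.1, ?_⟩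
    rw [h1] at h2
    rw [Finset.sum_insert ha]
    omega

theorem exists_ord_pos_neg {s s' : S} (h : s ≠ s') :
    ∃ f : K, f ≠ 0 ∧ 0 < X.ord s f ∧ X.ord s' f < 0 := by
  obtain ⟨a, ha, ha1, ha2⟩ := X.separates s s' h
  obtain ⟨b, hb, hb1, hb2⟩ := X.separates s' s h.symm
  refine ⟨a * b⁻¹, mul_ne_zero ha (inv_ne_zero hb), ?_, ?_⟩
  all_goals
    rw [ord, (X.place _).ord_mul ha (inv_ne_zero hb), ord_inv _ hb]
    omega

/-- To add a point `a` where `f` has no pole, take `g` with a zero at `s` and a pole at `a` and pass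
to `g ^ m + f`. The exponent `m` exceeds all pole orders of `f` on `T`, so no cancellation occurs:
wherever `g` has a pole `g ^ m` dominates, and elsewhere on `T` the pole of `f` does. -/
theorem exists_ord_pos_forall_neg (s : S) (T : Finset S) (hs : s ∉ T) :
    ∃ f : K, f ≠ 0 ∧ 0 < X.ord s f ∧ ∀ s' ∈ T, X.ord s' f < 0 := by
  classical
  induction T using Finset.induction_on with
  | empty =>
    obtain ⟨t, ht, ht1⟩ := (X.place s).exists_ord_eq_one
    exact ⟨t, ht, by rw [ord]; omega, by simp⟩
  | insert a T ha ih =>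
    obtain ⟨hsa, hsT⟩ : s ≠ a ∧ s ∉ T := by simpa using hs
    obtain ⟨f, hf, hf1, hf2⟩ := ih hsT
    by_cases hfa : X.ord a f < 0
    · refine ⟨f, hf, hf1, ?_⟩
      simpa [hfa] using hf2
    push Not at hfa
    obtain ⟨g, hg, hg1, hg2⟩ := X.exists_ord_pos_neg hsa
    set m : ℕ := 1 + ∑ s' ∈ T, (X.ord s' f).natAbs with hm
    have hgm : g ^ m ≠ 0 := pow_ne_zero _ hg
    have hom : ∀ s', (X.place s').ord (g ^ m) = m * X.ord s' g := fun s' => ord_pow _ hg m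
    have hneg : ∀ s', X.ord s' g < 0 → m * X.ord s' g ≤ -m := fun s' h => by nlinarith
    have hane : g ^ m + f ≠ 0 := by
      refine add_ne_zero_of_ord_lt (P := X.place a) hgm (fun _ => ?_)
      rw [hom]
      have := hneg a hg2
      have h2 : (X.place a).ord f = X.ord a f := rfl
      omega
    refine ⟨g ^ m + f, hane, ?_, ?_⟩
    · refine lt_of_lt_of_le ?_ ((X.place s).ord_add hgm hf hane)
      rw [lt_min_iff, hom]
      exact ⟨mul_pos (by positivity) hg1, hf1⟩
    · intro s' hs'
      obtain rfl | hs' := Finset.mem_insert.1 hs'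
      · rw [ord, ord_add_eq hgm (fun _ => ?_), hom]
        · have := hneg s' hg2
          omega
        · rw [hom]
          have := hneg s' hg2
          have h2 : (X.place s').ord f = X.ord s' f := rfl
          omega
      · have hlt := hf2 s' hs'
        have hmle : (X.ord s' f).natAbs < m := by
          rw [hm]
          have := Finset.single_le_sum (f := fun s' => (X.ord s' f).natAbs)
            (fun _ _ => Nat.zero_le _) hs'
          omega
        have h2 : (X.place s').ord f = X.ord s' f := rfl
        by_cases hgs : X.ord s' g < 0
        · have := hneg s' hgs
          rw [ord, ord_add_eq hgm (fun _ => ?_), hom]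
          · omega
          · rw [hom]; omega
        · have : 0 ≤ m * X.ord s' g := mul_nonneg (by positivity) (by omega)
          rw [ord, add_comm, ord_add_eq hf (fun _ => ?_)]
          · omega
          · rw [hom]; omega

/-- Weak approximation. -/
theorem exists_ord_eq_forall_le (s : S) (T : Finset S) (hs : s ∉ T) (n : ℤ) (M : ℕ) :
    ∃ u : K, u ≠ 0 ∧ X.ord s u = n ∧ ∀ s' ∈ T, M ≤ X.ord s' u := by
  classical
  obtain ⟨t, ht, ht1⟩ := (X.place s).exists_ord_eq_one
  obtain ⟨f, hf, hf1, hf2⟩ := X.exists_ord_pos_forall_neg s T hs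
  have h1 : (1 : K) + f ≠ 0 := add_ne_zero_of_ord_lt (P := X.place s) one_ne_zero
    (fun _ => by rw [ord_one]; exact hf1)
  have h2 : X.ord s (1 + f) = 0 := by
    rw [ord, ord_add_eq one_ne_zero (fun _ => by rw [ord_one]; exact hf1), ord_one]
  have h3 : ∀ s' ∈ T, X.ord s' (1 + f) < 0 := fun s' hs' => by
    rw [ord, add_comm, ord_add_eq hf (fun _ => ?_)]
    · exact hf2 s' hs'
    · rw [ord_one]; exact hf2 s' hs'
  -- `1 + f` is a unit at `s` and has a pole at each point of `T`. A high power of its inverse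
  -- therefore leaves the order at `s` unchanged and outweighs any pole of `t ^ n` on `T`.
  set N : ℕ := M + ∑ s' ∈ T, (n * X.ord s' t).natAbs with hN
  have ho : ∀ s', X.ord s' (t ^ n * ((1 + f)⁻¹) ^ N) = n * X.ord s' t + N * -X.ord s' (1 + f) := by
    intro s'
    rw [ord, (X.place _).ord_mul (zpow_ne_zero _ ht) (pow_ne_zero _ (inv_ne_zero h1)),
      ord_zpow _ ht, ord_pow _ (inv_ne_zero h1), ord_inv _ h1]
    rfl
  refine ⟨t ^ n * ((1 + f)⁻¹) ^ N, mul_ne_zero (zpow_ne_zero _ ht)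
    (pow_ne_zero _ (inv_ne_zero h1)), ?_, fun s' hs' => ?_⟩
  · rw [ho, h2]
    change n * (X.place s).ord t + _ = n
    rw [ht1]; simp
  · rw [ho]
    have h4 := h3 s' hs'
    have h5 : (N : ℤ) ≤ N * -X.ord s' (1 + f) := by nlinarith
    have h6 : (n * X.ord s' t).natAbs + M ≤ N := by
      have := Finset.single_le_sum (f := fun s' => (n * X.ord s' t).natAbs)
            (fun _ _ => Nat.zero_le _) hs'
      omega
    omega

end CompleteCurve

/-! ### Principal divisors have degree zero -/

namespace CompleteCurve

open RationalPlace IntermediateField Polynomial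

variable {k K S : Type*} [Field k] [Field K] [Algebra k K] (X : CompleteCurve k K S)

theorem _root_.RationalPlace.aeval_mem_ge (P : RationalPlace k K) {f : K} (hf : f ∈ P.ge 0)
    (p : k[X]) : aeval f p ∈ P.ge 0 := by
  have : aeval f p ∈ P.ring := by
    have h := (aeval (⟨f, hf⟩ : P.ring) p).2
    rwa [← Subalgebra.coe_val, ← Polynomial.aeval_algHom_apply] at h
  exact this

/-- A nonzero polynomial expression in `f` has order proportional to that of `f` at the zeros
of `f`. -/
theorem exists_ord_aeval_eq {f : K} (p : k[X]) (hp : p ≠ 0) :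
    ∃ n : ℕ, ∀ P : RationalPlace k K, f ≠ 0 → 0 < P.ord f →
      aeval f p ≠ 0 ∧ P.ord (aeval f p) = n * P.ord f := by
  obtain ⟨q, hq, hdvd⟩ := Polynomial.exists_eq_pow_rootMultiplicity_mul_and_not_dvd p hp 0
  set n := p.rootMultiplicity 0
  refine ⟨n, fun P hf hPf => ?_⟩
  have hq0 : q.coeff 0 ≠ 0 := by
    rw [dvd_iff_isRoot, IsRoot.def] at hdvd
    rwa [coeff_zero_eq_eval_zero]
  have hq0' : algebraMap k K (q.coeff 0) ≠ 0 := by simpa using hq0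
  have hqe : aeval f q = algebraMap k K (q.coeff 0) + f * aeval f (divX q) := by
    have h := congrArg (aeval f) (divX_mul_X_add q)
    rw [map_add, map_mul, aeval_X, aeval_C] at h
    linear_combination -h
  have hmem : f * aeval f (divX q) ∈ P.ge (P.ord (algebraMap k K (q.coeff 0)) + 1) := by
    rw [P.ord_algebraMap _ hq0]
    have h1 : f ∈ P.ge (0 + 1) := fun _ => hPf
    have h2 := mul_mem_ge h1 (P.aeval_mem_ge (ge_anti (by omega) h1) (divX q))
    simpa using h2
  have hqn : aeval f q ≠ 0 := hqe ▸ add_ne_zero_of_ord_lt hq0' hmem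
  have hqo : P.ord (aeval f q) = 0 := by
    rw [hqe, ord_add_eq hq0' hmem, P.ord_algebraMap _ hq0]
  have hpe : aeval f p = f ^ n * aeval f q := by
    rw [hq]; simp
  refine ⟨hpe ▸ mul_ne_zero (pow_ne_zero _ hf) hqn, ?_⟩
  rw [hpe, P.ord_mul (pow_ne_zero _ hf) hqn, hqo, P.ord_pow hf, add_zero]

/-- All places over the point `f = 0` of the projective line restrict to the same valuation of
`k(f)`, up to the ramification index `P.ord f`. So the multiplier can be chosen before `P`, which
the independence argument for several zeros requires. -/
theorem exists_ord_adjoin_eq {f : K} (c : k⟮f⟯) (hc : c ≠ 0) :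
    ∃ n : ℤ, ∀ P : RationalPlace k K, f ≠ 0 → 0 < P.ord f → P.ord (c : K) = n * P.ord f := by
  obtain ⟨p, q, hpq⟩ := (mem_adjoin_simple_iff k _).1 c.2
  have hc' : (c : K) ≠ 0 := by simpa using hc
  rw [hpq] at hc'
  have hp : p ≠ 0 := by rintro rfl; simp at hc'
  have hq : q ≠ 0 := by rintro rfl; simp at hc'
  obtain ⟨n, hn⟩ := exists_ord_aeval_eq (f := f) p hp
  obtain ⟨m, hm⟩ := exists_ord_aeval_eq (f := f) q hq
  refine ⟨n - m, fun P hf hPf => ?_⟩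
  obtain ⟨hn0, hn1⟩ := hn P hf hPf
  obtain ⟨hm0, hm1⟩ := hm P hf hPf
  rw [hpq, div_eq_mul_inv, P.ord_mul hn0 (inv_ne_zero hm0), P.ord_inv hm0, hn1, hm1]
  ring

/-- The number of zeros of `f` is at most the degree of `K` over `k(f)`. -/
theorem sum_ord_le_finrank {f : K} (hf : f ≠ 0) [FiniteDimensional k⟮f⟯ K] (T : Finset S)
    (hT : ∀ s ∈ T, 0 < X.ord s f) :
    ∑ s ∈ T, X.ord s f ≤ Module.finrank k⟮f⟯ K := by
  classical
  -- For each zero `s` and each `i < ord_s f`, the function `u s i` has order `i` at `s` and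
  -- vanishes at the other zeros at least as much as `f`. There are `∑ ord_s f` of them, and they
  -- will be independent over `k(f)`.
  have hu : ∀ (s : T) (i : Fin (X.ord s f).toNat), ∃ u : K, u ≠ 0 ∧ X.ord s u = i ∧
      ∀ s' ∈ T.erase s, (X.ord s' f).toNat ≤ X.ord s' u := by
    intro s i
    obtain ⟨u, hu, hu1, hu2⟩ := X.exists_ord_eq_forall_le s (T.erase s) (by simp) i
      (∑ s' ∈ T, (X.ord s' f).toNat)
    refine ⟨u, hu, hu1, fun s' hs' => le_trans ?_ (hu2 s' hs')⟩
    exact_mod_cast Finset.single_le_sum (f := fun s' => (X.ord s' f).toNat)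
      (fun _ _ => Nat.zero_le _) (Finset.mem_of_mem_erase hs')
  choose u hu0 hu1 hu2 using hu
  have hli : LinearIndependent k⟮f⟯ (fun j : Σ s : T, Fin (X.ord s f).toNat => u j.1 j.2) := by
    rw [Fintype.linearIndependent_iff]
    intro c hsum
    by_contra! hne
    choose! n hn using fun (c : k⟮f⟯) (hc : c ≠ 0) => exists_ord_adjoin_eq c hc
    -- In a relation, pick a coefficient of least order along `f = 0`, and then, among the functions
    -- attached to the same zero with a coefficient of that order, the least `i`. The corresponding
    -- term has strictly smallest order at that zero, so the sum cannot vanish.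
    obtain ⟨j₁, hj₁, hmin₁⟩ := Finset.exists_min_image
      (Finset.univ.filter fun j => c j ≠ 0) (fun j => n (c j)) (by
        obtain ⟨j, hj⟩ := hne; exact ⟨j, by simpa using hj⟩)
    obtain ⟨j₂, hj₂, hmin₂⟩ := Finset.exists_min_image
      (Finset.univ.filter fun j => c j ≠ 0 ∧ j.1 = j₁.1 ∧ n (c j) = n (c j₁))
      (fun j => (j.2 : ℕ)) ⟨j₁, by simpa using hj₁⟩
    simp only [Finset.mem_filter, Finset.mem_univ, true_and] at hj₁ hmin₁ hj₂ hmin₂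
    obtain ⟨s, i⟩ := j₂
    obtain ⟨hc₂, hs₂, hn₂⟩ := hj₂
    dsimp only at hs₂ hmin₂
    have hs := hT s s.2
    have hterm : ∀ j, c j ≠ 0 → (X.place s).ord (c j • u j.1 j.2) =
        n (c j) * X.ord s f + X.ord s (u j.1 j.2) := by
      intro j hj
      have hj' : (c j : K) ≠ 0 := by simpa using hj
      rw [IntermediateField.smul_def, smul_eq_mul, (X.place s).ord_mul hj' (hu0 _ _),
        hn _ hj (X.place s) hf hs]
      rfl
    have hne0 : c ⟨s, i⟩ • u s i ≠ 0 := smul_ne_zero hc₂ (hu0 _ _)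
    replace hsum := (Finset.add_sum_erase Finset.univ (fun j => c j • u j.1 j.2)
      (Finset.mem_univ ⟨s, i⟩)).trans hsum
    refine add_ne_zero_of_ord_lt (P := X.place s) hne0 ?_ hsum
    refine Submodule.sum_mem _ fun j hj => ?_
    by_cases hcj : c j = 0
    · rw [hcj, zero_smul]; exact Submodule.zero_mem _
    intro _
    rw [hterm _ hcj, hterm _ hc₂, hu1]
    have hji : j ≠ ⟨s, i⟩ := Finset.ne_of_mem_erase hj
    have hnj := hmin₁ j hcj
    by_cases hjs : j.1 = s
    · obtain ⟨s', i'⟩ := j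
      dsimp only at hjs
      subst hjs
      rw [hu1]
      by_cases hnn : n (c ⟨s', i'⟩) = n (c j₁)
      · have h1 : (i : ℕ) ≤ i' := hmin₂ ⟨s', i'⟩ ⟨hcj, hs₂, hnn⟩
        have h2 : i ≠ i' := by rintro rfl; exact hji rfl
        have h3 : (i : ℕ) ≠ i' := fun h => h2 (Fin.ext h)
        rw [hnn, hn₂]
        change n (c j₁) * X.ord s' f + (i : ℕ) + 1 ≤ n (c j₁) * X.ord s' f + (i' : ℕ)
        omega
      · have h1 : n (c j₁) + 1 ≤ n (c ⟨s', i'⟩) := by omega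
        have h2 := mul_le_mul_of_nonneg_right h1 hs.le
        have h3 : ((i : ℕ) : ℤ) < X.ord s' f := by have := i.2; omega
        rw [hn₂]
        rw [add_mul] at h2
        dsimp only at h2 ⊢
        omega
    · have h1 : X.ord s f ≤ X.ord s (u j.1 j.2) := by
        have := hu2 j.1 j.2 s (by
          rw [Finset.mem_erase]; exact ⟨fun h => hjs (Subtype.ext h.symm), s.2⟩)
        omega
      have h2 := mul_le_mul_of_nonneg_right hnj hs.le
      have h3 : ((i : ℕ) : ℤ) < X.ord s f := by have := i.2; omega
      rw [hn₂]
      omega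
  have hcard := hli.fintype_card_le_finrank
  rw [Fintype.card_sigma] at hcard
  simp only [Fintype.card_fin] at hcard
  rw [← Finset.sum_coe_sort]
  calc ∑ s : T, X.ord s f = ((∑ s : T, (X.ord s f).toNat : ℕ) : ℤ) := by
        push_cast
        exact Finset.sum_congr rfl fun s _ => by have := hT s s.2; omega
    _ ≤ _ := by exact_mod_cast hcard

theorem finite_zeros {f : K} (hf : f ≠ 0) [FiniteDimensional k⟮f⟯ K] :
    {s | 0 < X.ord s f}.Finite := by
  by_contra h
  obtain ⟨T, hT, hcard⟩ := Set.Infinite.exists_subset_card_eq h (Module.finrank k⟮f⟯ K + 1)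
  have h1 := X.sum_ord_le_finrank hf T (fun s hs => hT hs)
  have h2 : (T.card : ℤ) ≤ ∑ s ∈ T, X.ord s f := by
    rw [Finset.card_eq_sum_ones]
    push_cast
    exact Finset.sum_le_sum fun s hs => hT hs
  omega

/-- The functions with poles bounded by `G`. -/
def sections (G : S → ℤ) : Submodule k K := ⨅ s, (X.place s).ge (-G s)

variable {X} in
theorem mem_sections {G : S → ℤ} {f : K} : f ∈ X.sections G ↔ ∀ s, f ∈ (X.place s).ge (-G s) := by
  simp [sections]

theorem sections_zero : X.sections 0 = Submodule.span k {1} := by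
  ext f
  rw [mem_sections, Submodule.mem_span_singleton]
  constructor
  · intro h
    by_cases hf : f = 0
    · exact ⟨0, by simp [hf]⟩
    obtain ⟨c, hc⟩ := X.exists_const f hf fun s => by simpa using h s hf
    exact ⟨c, by rw [← hc, Algebra.algebraMap_eq_smul_one]⟩
  · rintro ⟨c, rfl⟩ s
    rw [← Algebra.algebraMap_eq_smul_one]
    simpa using algebraMap_mem_ge c

/-- The space of functions with poles bounded by `m` has dimension at most `deg m + 1`. -/
theorem finrank_sections_le (T : Finset S) (m : S → ℕ) (hm : ∀ s ∉ T, m s = 0) :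
    Module.Finite k (X.sections fun s => m s) ∧
      Module.finrank k (X.sections fun s => m s) ≤ ∑ s ∈ T, m s + 1 := by
  have h0 : X.sections (fun s => (m s : ℤ)) ⊓
      ⨅ s ∈ T, (X.place s).ge (-(m s : ℤ) + m s) = X.sections 0 := by
    ext f
    simp only [Submodule.mem_inf, mem_sections, Submodule.mem_iInf, neg_add_cancel, Pi.zero_apply,
      neg_zero]
    constructor
    · rintro ⟨h1, h2⟩ s
      by_cases hs : s ∈ T
      · exact h2 s hs
      · simpa [hm s hs] using h1 s
    · exact fun h => ⟨fun s => ge_anti (by omega) (h s), fun s _ => h s⟩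
  have hfin : Module.Finite k (X.sections 0) := by rw [sections_zero]; infer_instance
  have := X.finrank_le_add_sum T (fun s => -(m s : ℤ)) m (W := X.sections fun s => (m s : ℤ))
    (fun s _ => iInf_le _ s) (by rw [h0]; exact hfin)
  refine ⟨this.1, this.2.trans ?_⟩
  rw [h0, sections_zero, finrank_span_singleton one_ne_zero, add_comm]

/-- `P.ring` is a valuation ring containing `k[x]`, and valuation rings are integrally closed. -/
theorem _root_.RationalPlace.mem_ge_of_isIntegral (P : RationalPlace k K) {x y : K}
    (hx : x ∈ P.ge 0)
    (hy : IsIntegral (Algebra.adjoin k {x}) y) : y ∈ P.ge 0 := by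
  let V : ValuationSubring K := ValuationSubring.mk P.ring.toSubring (fun f => by
    by_cases hf : f = 0
    · exact Or.inl (hf ▸ P.ring.zero_mem)
    by_cases h : 0 ≤ P.ord f
    · exact Or.inl (fun _ => h)
    · exact Or.inr (fun _ => by rw [P.ord_inv hf]; omega))
  have hle : Algebra.adjoin k {x} ≤ P.ring :=
    Algebra.adjoin_le (by simpa using! hx)
  have h2 : IsIntegral V y := by
    obtain ⟨p, hp, hp2⟩ := hy
    refine ⟨p.map (Subalgebra.inclusion hle).toRingHom, hp.map _, ?_⟩
    rw [eval₂_map]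
    exact hp2
  obtain ⟨z, hz⟩ := (IsIntegrallyClosed.isIntegral_iff (R := V) (K := K)).1 h2
  rw [← hz]
  exact z.2

theorem _root_.RationalPlace.transcendental (P : RationalPlace k K) {x : K} (hx : x ≠ 0)
    (hP : P.ord x ≠ 0) : Transcendental k x := by
  wlog h : 0 < P.ord x generalizing x
  · have := this (x := x⁻¹) (inv_ne_zero hx) (by rw [P.ord_inv hx]; omega)
      (by rw [P.ord_inv hx]; omega)
    exact fun hx => this hx.inv
  rintro ⟨p, hp, hp0⟩
  obtain ⟨n, hn⟩ := exists_ord_aeval_eq (f := x) p hp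
  exact (hn P hx h).1 hp0

end CompleteCurve

namespace CompleteCurve

open RationalPlace IntermediateField Polynomial

variable {k K S : Type*} [Field k] [Field K] [Algebra k K] (X : CompleteCurve k K S)

theorem _root_.linearIndependent_pow_of_transcendental {x : K} (hx : Transcendental k x) :
    LinearIndependent k (fun n : ℕ => x ^ n) := by
  have h := (Polynomial.basisMonomials k).linearIndependent.map' (aeval x).toLinearMap
    (LinearMap.ker_eq_bot.2 (transcendental_iff_injective.1 hx))
  have h2 : (fun n : ℕ => x ^ n) = (aeval x).toLinearMap ∘ Polynomial.basisMonomials k := by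
    funext n
    simp [Polynomial.aeval_monomial]
  exact h2 ▸ h

open scoped IntermediateField.algebraAdjoinAdjoin in
/-- Lower bound for the number of functions with poles bounded by a multiple of the divisor of
poles of `x`. -/
theorem exists_finrank_sections_ge {x : K} (hx : Transcendental k x)
    [FiniteDimensional k⟮x⟯ K] :
    ∃ m : ℕ, ∀ N : ℕ, ∃ V : Submodule k K,
      V ≤ X.sections (fun s => ((N + m) * (-X.ord s x).toNat : ℕ)) ∧
      Module.Finite k V ∧ Module.finrank k V = Module.finrank k⟮x⟯ K * (N + 1) := by
  classical
  have hx0 : x ≠ 0 := by rintro rfl; exact hx isAlgebraic_zero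
  set b₀ := Module.finBasis k⟮x⟯ K with hb₀
  have : Algebra.IsAlgebraic k⟮x⟯ K := inferInstance
  -- A common denominator makes the `k(x)`-basis integral over `k[x]`, so that its elements have
  -- poles only where `x` does.
  obtain ⟨y, hy, hint⟩ := exists_integral_multiples (Algebra.adjoin k {x}) k⟮x⟯
    (L := K) (Finset.univ.image b₀)
  have hy' : algebraMap (Algebra.adjoin k {x}) k⟮x⟯ y ≠ 0 := by
    rw [Ne, FaithfulSMul.algebraMap_eq_zero_iff]; exact hy
  set b : Fin (Module.finrank k⟮x⟯ K) → K := fun i => y • b₀ i with hb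
  have hbi : ∀ i, IsIntegral (Algebra.adjoin k {x}) (b i) := fun i =>
    hint _ (Finset.mem_image_of_mem _ (Finset.mem_univ i))
  have hbl : LinearIndependent k⟮x⟯ b := by
    have := b₀.linearIndependent.units_smul (fun _ => Units.mk0 _ hy')
    convert this using 2 with i
    simp [hb, Algebra.smul_def]
    rfl
  have hinv : FiniteDimensional k⟮x⁻¹⟯ K := by
    have : k⟮x⁻¹⟯ = k⟮x⟯ := by
      apply le_antisymm <;> rw [adjoin_simple_le_iff]
      · exact inv_mem (mem_adjoin_simple_self k x)
      · simpa using inv_mem (mem_adjoin_simple_self k x⁻¹)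
    rw [this]; assumption
  have hfin := X.finite_zeros (inv_ne_zero hx0)
  -- `m` bounds the poles of every `b i` at the poles of `x`. As `x` has a pole of order at least
  -- one there, `x ^ j * b i` with `j ≤ N` has poles at most `N + m` times those of `x`.
  set m : ℕ := ∑ s ∈ hfin.toFinset, ∑ i, (X.ord s (b i)).natAbs with hm
  refine ⟨m, fun N => ?_⟩
  have hli := (linearIndependent_pow_of_transcendental hx).comp
    (fun j : Fin (N + 1) => (j : ℕ)) Fin.val_injective
  have hli2 : LinearIndependent k (fun p : Fin (N + 1) × Fin (Module.finrank k⟮x⟯ K) =>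
      x ^ (p.1 : ℕ) * b p.2) := by
    have hxs : LinearIndependent k (fun j : Fin (N + 1) => (AdjoinSimple.gen k x) ^ (j : ℕ)) := by
      refine LinearIndependent.of_comp (IntermediateField.val k⟮x⟯).toLinearMap ?_
      exact hli
    have h := linearIndependent_smul hxs hbl
    have he : (fun p : Fin (N + 1) × Fin (Module.finrank k⟮x⟯ K) => x ^ (p.1 : ℕ) * b p.2) =
        fun p => AdjoinSimple.gen k x ^ (p.1 : ℕ) • b p.2 := by
      funext p
      rw [IntermediateField.smul_def, SubmonoidClass.coe_pow, AdjoinSimple.coe_gen, smul_eq_mul]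
    rw [he]
    exact h
  refine ⟨Submodule.span k (Set.range fun p : Fin (N + 1) × Fin (Module.finrank k⟮x⟯ K) =>
      x ^ (p.1 : ℕ) * b p.2), ?_, FiniteDimensional.span_of_finite k (Set.finite_range _), ?_⟩
  · rw [Submodule.span_le]
    rintro _ ⟨⟨j, i⟩, rfl⟩
    rw [SetLike.mem_coe, mem_sections]
    intro s
    by_cases hs : 0 ≤ X.ord s x
    · have hxs : x ∈ (X.place s).ge 0 := fun _ => hs
      have h1 : x ^ (j : ℕ) * b i ∈ (X.place s).ring :=
        Subalgebra.mul_mem _ (Subalgebra.pow_mem _ hxs _) (mem_ge_of_isIntegral _ hxs (hbi i))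
      have h2 : (-X.ord s x).toNat = 0 := by omega
      simpa [h2] using! h1
    · intro hne
      have hb0 := right_ne_zero_of_mul hne
      rw [(X.place s).ord_mul (pow_ne_zero _ hx0) hb0, ord_pow _ hx0]
      have hsT : s ∈ hfin.toFinset := by
        simp only [Set.Finite.mem_toFinset, Set.mem_ofPred_eq]
        rw [ord, ord_inv _ hx0]
        change 0 < -X.ord s x
        omega
      have h1 : (X.ord s (b i)).natAbs ≤ m :=
        (Finset.single_le_sum (f := fun i => (X.ord s (b i)).natAbs)
          (fun _ _ => Nat.zero_le _) (Finset.mem_univ i)).trans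
        (Finset.single_le_sum (f := fun s => ∑ i, (X.ord s (b i)).natAbs)
          (fun _ _ => Nat.zero_le _) hsT)
      have h2 : ((-X.ord s x).toNat : ℤ) = -X.ord s x := by omega
      push_cast
      rw [h2]
      change -((N + m) * -X.ord s x) ≤ j * X.ord s x + X.ord s (b i)
      have h3 : (j : ℕ) ≤ N := by have := j.2; omega
      have h4 : X.ord s x ≤ -1 := by omega
      have h5 : (m : ℤ) * X.ord s x ≤ -m := by nlinarith
      have h6 : (N : ℤ) * X.ord s x ≤ j * X.ord s x :=
        mul_le_mul_of_nonpos_right (by exact_mod_cast h3) (by omega)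
      have h7 : -((N + m) * -X.ord s x) = N * X.ord s x + m * X.ord s x := by ring
      rw [h7]
      omega
  · rw [finrank_span_eq_card hli2]
    simp [mul_comm]

/-- Let `d` be the field degree and `e` the number of poles. The functions with poles at most `N +
m` times those of `x` form a space of dimension between `d (N + 1)` and `(N + m) e + 1`; letting `N`
grow forces `d ≤ e`. -/
theorem finrank_adjoin_le {x : K} (hx : Transcendental k x) [FiniteDimensional k⟮x⟯ K]
    (T : Finset S) (hT : ∀ s, s ∉ T → 0 ≤ X.ord s x) :
    Module.finrank k⟮x⟯ K ≤ ∑ s ∈ T, (-X.ord s x).toNat := by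
  obtain ⟨m, hm⟩ := X.exists_finrank_sections_ge hx
  by_contra! h
  set d := Module.finrank k⟮x⟯ K
  set e := ∑ s ∈ T, (-X.ord s x).toNat
  -- If `d ≥ e + 1`, the two bounds give `N + e ≤ m e`, which this `N` violates.
  obtain ⟨V, hV, hVf, hVd⟩ := hm (m * e + 1)
  have h1 := X.finrank_sections_le T (fun s => (m * e + 1 + m) * (-X.ord s x).toNat) (fun s hs => by
    have := hT s hs
    have h2 : (-X.ord s x).toNat = 0 := by omega
    simp [h2])
  have := h1.1
  have h2 := (Submodule.finrank_mono hV)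
  rw [hVd] at h2
  replace h2 := h2.trans h1.2
  rw [← Finset.mul_sum] at h2
  have h3 : (e + 1) * (m * e + 1 + 1) ≤ d * (m * e + 1 + 1) := Nat.mul_le_mul_right _ h
  change _ ≤ (m * e + 1 + m) * e + 1 at h2
  nlinarith

/-- A nonzero function has as many zeros as poles. -/
theorem exists_sum_ord_eq_zero [IsAlgClosed k] {f : K} (hf : f ≠ 0) :
    ∃ T : Finset S, (∀ s ∉ T, X.ord s f = 0) ∧ ∑ s ∈ T, X.ord s f = 0 := by
  classical
  by_cases hc : ∃ c : k, algebraMap k K c = f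
  · obtain ⟨c, rfl⟩ := hc
    exact ⟨∅, fun s _ => (X.place s).ord_algebraMap c (by rintro rfl; simp at hf), by simp⟩
  push Not at hc
  have htr : ∀ g : K, (∀ c : k, algebraMap k K c ≠ g) → Transcendental k g := by
    intro g hg halg
    have : Algebra.IsAlgebraic k k⟮g⟯ := isAlgebraic_adjoin_simple halg.isIntegral
    have h := IntermediateField.eq_bot_of_isAlgClosed_of_isAlgebraic k⟮g⟯
    obtain ⟨c, hc⟩ := mem_bot.1 (h ▸ mem_adjoin_simple_self k g)
    exact hg c hc
  -- Both counts are compared with the degree of `K` over `k(g)`: the zeros of `g` are at most this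
  -- degree, which is at most the number of poles. Using this for `f` and for `f⁻¹` gives equality.
  have key : ∀ g : K, g ≠ 0 → (∀ c : k, algebraMap k K c ≠ g) → ∃ T : Finset S,
      (∀ s, s ∈ T ↔ 0 < X.ord s g) ∧
      ∀ T' : Finset S, (∀ s, s ∈ T' ↔ X.ord s g < 0) →
        ∑ s ∈ T, X.ord s g ≤ ∑ s ∈ T', -X.ord s g := by
    intro g hg hcg
    have := X.finite g hcg
    have hfin := X.finite_zeros hg
    refine ⟨hfin.toFinset, fun s => by simp, fun T' hT' => ?_⟩
    refine (X.sum_ord_le_finrank hg _ (fun s hs => by simpa using hs)).trans ?_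
    have h1 := X.finrank_adjoin_le (htr g hcg) T' (fun s hs => by rw [hT'] at hs; omega)
    calc ((Module.finrank k⟮g⟯ K : ℕ) : ℤ) ≤ ((∑ s ∈ T', (-X.ord s g).toNat : ℕ) : ℤ) := by
          exact_mod_cast h1
      _ = _ := by
          push_cast
          exact Finset.sum_congr rfl fun s hs => by rw [hT'] at hs; omega
  have hinv : ∀ s, X.ord s f⁻¹ = -X.ord s f := fun s => ord_inv _ hf
  obtain ⟨T, hT, hT2⟩ := key f hf hc
  obtain ⟨T', hT', hT2'⟩ := key f⁻¹ (inv_ne_zero hf) (fun c h => hc c⁻¹ (by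
    rw [map_inv₀, h, inv_inv]))
  simp only [hinv] at hT' hT2'
  have h1 := hT2 T' (fun s => by rw [hT']; omega)
  have h2 := hT2' T (fun s => by rw [hT]; omega)
  have hdis : Disjoint T T' := by
    rw [Finset.disjoint_left]
    intro s hs hs'
    rw [hT] at hs
    rw [hT'] at hs'
    omega
  refine ⟨T ∪ T', fun s hs => ?_, ?_⟩
  · rw [Finset.mem_union, hT, hT'] at hs
    omega
  · rw [Finset.sum_union hdis]
    simp only [neg_neg, Finset.sum_neg_distrib] at h1 h2
    omega

/-- A divisor with a nonzero section has nonnegative degree. -/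
theorem sum_nonneg_of_mem_sections [IsAlgClosed k] {f : K} (hf : f ≠ 0) {G : S → ℤ}
    (hG : f ∈ X.sections G) (T : Finset S) (hT : ∀ s ∉ T, G s = 0) :
    0 ≤ ∑ s ∈ T, G s := by
  classical
  obtain ⟨T', hT', h0⟩ := X.exists_sum_ord_eq_zero hf
  have h1 : ∑ s ∈ T, G s = ∑ s ∈ T ∪ T', G s :=
    Finset.sum_subset Finset.subset_union_left fun s _ hs => hT s hs
  have h2 : ∑ s ∈ T', X.ord s f = ∑ s ∈ T ∪ T', X.ord s f :=
    Finset.sum_subset Finset.subset_union_right fun s _ hs => hT' s hs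
  rw [h1]
  have h3 : ∑ s ∈ T ∪ T', -X.ord s f ≤ ∑ s ∈ T ∪ T', G s := Finset.sum_le_sum fun s _ => by
    have := mem_sections.1 hG s hf
    change -G s ≤ X.ord s f at this
    omega
  rw [Finset.sum_neg_distrib, ← h2, h0] at h3
  simpa using h3

end CompleteCurve

/-! ### The ideal of the diagonal and its powers -/

section Diagonal

/-- If an ideal is generated by `ξ` modulo its square, its powers are generated by the powers of `ξ`
modulo the next power. -/
theorem Ideal.pow_le_span_pow_sup {A : Type*} [CommRing A] {I : Ideal A} {ξ : A} (hξ : ξ ∈ I)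
    (h : I ≤ Ideal.span {ξ} ⊔ I ^ 2) (n : ℕ) : I ^ n ≤ Ideal.span {ξ ^ n} ⊔ I ^ (n + 1) := by
  induction n with
  | zero => simp
  | succ n ih =>
    rw [pow_succ, Ideal.mul_le]
    intro x hx y hy
    obtain ⟨x₁, hx₁, x₂, hx₂, rfl⟩ := Submodule.mem_sup.1 (ih hx)
    obtain ⟨y₁, hy₁, y₂, hy₂, rfl⟩ := Submodule.mem_sup.1 (h hy)
    obtain ⟨a, rfl⟩ := Ideal.mem_span_singleton'.1 hx₁
    obtain ⟨b, rfl⟩ := Ideal.mem_span_singleton'.1 hy₁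
    have e : (a * ξ ^ n + x₂) * (b * ξ + y₂) =
        a * b * ξ ^ (n + 1) + (a * (ξ ^ n * y₂) + x₂ * (b * ξ + y₂)) := by ring
    rw [e]
    refine Submodule.add_mem_sup (Ideal.mul_mem_left _ _ (Ideal.mem_span_singleton_self _)) ?_
    refine Ideal.add_mem _ (Ideal.mul_mem_left _ _ ?_) ?_
    · rw [show n + 1 + 1 = n + 2 by ring, pow_add]
      exact Ideal.mul_mem_mul (Ideal.pow_mem_pow hξ n) hy₂
    · rw [pow_succ]
      exact Ideal.mul_mem_mul hx₂ hy

variable {k : Type*} [Field k]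

namespace KaehlerDifferential

variable {O : Type*} [CommRing O] [Algebra k O]

/-- The module of differentials is `I / I ^ 2` for the ideal `I` of the diagonal, with `dt` the
class of `1 ⊗ t - t ⊗ 1`. -/
theorem ideal_le_of_span_D_eq_top {t : O} (ht : ∀ a : O, ∃ b : O, D k O a = b • D k O t) :
    ideal k O ≤ Ideal.span {(1 ⊗ₜ[k] t - t ⊗ₜ[k] 1 : O ⊗[k] O)} ⊔ ideal k O ^ 2 := by
  have hspan : ∀ ω : Ω[O⁄k], ∃ b : O, ω = b • D k O t := by
    intro ω
    have hω : ω ∈ Submodule.span O (Set.range (D k O)) := by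
      rw [span_range_derivation]; trivial
    induction hω using Submodule.span_induction with
    | mem x hx => obtain ⟨a, rfl⟩ := hx; exact ht a
    | zero => exact ⟨0, by simp⟩
    | add x y _ _ hx hy =>
      obtain ⟨a, rfl⟩ := hx
      obtain ⟨b, rfl⟩ := hy
      exact ⟨a + b, by rw [add_smul]⟩
    | smul a x _ hx =>
      obtain ⟨b, rfl⟩ := hx
      exact ⟨a * b, by rw [mul_smul]⟩
  intro j hj
  obtain ⟨b, hb⟩ := hspan ((ideal k O).toCotangent ⟨j, hj⟩)
  have h2 : b • D k O t = (ideal k O).toCotangent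
      ((b ⊗ₜ[k] (1 : O)) • ⟨1 ⊗ₜ t - t ⊗ₜ 1, one_smul_sub_smul_one_mem_ideal k t⟩) :=
    (algebraMap_smul (O ⊗[k] O) b (D k O t)).symm.trans
      (map_smul (ideal k O).toCotangent (b ⊗ₜ[k] (1 : O)) _).symm
  have h3 := (Ideal.toCotangent_eq _).1 (hb.trans h2)
  have h4 : j = (b ⊗ₜ[k] (1 : O)) * (1 ⊗ₜ t - t ⊗ₜ 1) +
      (j - (b ⊗ₜ[k] (1 : O)) * (1 ⊗ₜ t - t ⊗ₜ 1)) := by ring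
  rw [h4]
  exact Submodule.add_mem_sup (Ideal.mul_mem_left _ _ (Ideal.mem_span_singleton_self _)) h3

theorem sub_tmul_one_mem_ideal (g : O ⊗[k] O) :
    g - (Algebra.TensorProduct.lmul' k g) ⊗ₜ[k] 1 ∈ ideal k O := by
  rw [ideal, RingHom.mem_ker]
  change Algebra.TensorProduct.lmul' k (g - _) = 0
  rw [map_sub, Algebra.TensorProduct.lmul'_apply_tmul, mul_one, sub_self]

/-- A leading Taylor coefficient along the diagonal. Modulo the next power, only the restriction of
a coefficient to the diagonal matters, so it may be taken of the form `a ⊗ 1`. -/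
theorem exists_sub_mem_pow_succ {t : O}
    (ht : ideal k O ≤ Ideal.span {(1 ⊗ₜ[k] t - t ⊗ₜ[k] 1 : O ⊗[k] O)} ⊔ ideal k O ^ 2) {n : ℕ}
    {g : O ⊗[k] O} (hg : g ∈ ideal k O ^ n) :
    ∃ a : O, g - a ⊗ₜ[k] 1 * (1 ⊗ₜ[k] t - t ⊗ₜ[k] 1) ^ n ∈ ideal k O ^ (n + 1) := by
  have hτ := one_smul_sub_smul_one_mem_ideal k t
  obtain ⟨x, hx, y, hy, rfl⟩ := Submodule.mem_sup.1 (Ideal.pow_le_span_pow_sup hτ ht n hg)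
  obtain ⟨b, rfl⟩ := Ideal.mem_span_singleton'.1 hx
  refine ⟨Algebra.TensorProduct.lmul' k b, ?_⟩
  have e : b * (1 ⊗ₜ[k] t - t ⊗ₜ[k] 1) ^ n + y - (Algebra.TensorProduct.lmul' k b) ⊗ₜ[k] 1 *
      (1 ⊗ₜ[k] t - t ⊗ₜ[k] 1) ^ n = (b - (Algebra.TensorProduct.lmul' k b) ⊗ₜ[k] 1) *
      (1 ⊗ₜ[k] t - t ⊗ₜ[k] 1) ^ n + y := by ring
  rw [e]
  refine Ideal.add_mem _ ?_ hy
  rw [pow_succ']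
  exact Ideal.mul_mem_mul (sub_tmul_one_mem_ideal b) (Ideal.pow_mem_pow hτ n)

end KaehlerDifferential

namespace RationalPlace

variable {K : Type*} [Field K] [Algebra k K] (P : RationalPlace k K)

theorem exists_residue_mem (f : P.ring) : ∃ c : k, (f : K) - algebraMap k K c ∈ P.ge 1 := by
  obtain ⟨c, hc⟩ := exists_smul_sub_mem (P := P) one_ne_zero P.ord_one f.2
  exact ⟨c, by rw [Algebra.algebraMap_eq_smul_one]; simpa using hc⟩

theorem eq_of_sub_mem_ge {f : K} {c c' : k} (hc : f - algebraMap k K c ∈ P.ge 1)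
    (hc' : f - algebraMap k K c' ∈ P.ge 1) : c = c' := by
  have h := (P.ge 1).sub_mem hc' hc
  rw [sub_sub_sub_cancel_left, ← map_sub] at h
  by_contra hne
  have := h (by simpa [sub_eq_zero] using hne)
  rw [P.ord_algebraMap _ (sub_ne_zero.2 hne)] at this
  omega

/-- The value of a regular function at the place. -/
noncomputable def value : P.ring →ₐ[k] k :=
  AlgHom.ofLinearMap
    { toFun := fun f => (P.exists_residue_mem f).choose
      map_add' := fun f g => P.eq_of_sub_mem_ge (P.exists_residue_mem (f + g)).choose_spec (by
        have := (P.ge 1).add_mem (P.exists_residue_mem f).choose_spec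
          (P.exists_residue_mem g).choose_spec
        rwa [← add_sub_add_comm, ← map_add] at this)
      map_smul' := fun c f => P.eq_of_sub_mem_ge (P.exists_residue_mem (c • f)).choose_spec (by
        have := (P.ge 1).smul_mem c (P.exists_residue_mem f).choose_spec
        rwa [smul_sub, Algebra.smul_def c (algebraMap k K _), ← map_mul] at this) }
    (P.eq_of_sub_mem_ge (P.exists_residue_mem 1).choose_spec (by simp))
    (fun f g => P.eq_of_sub_mem_ge (P.exists_residue_mem (f * g)).choose_spec (by
      have h1 := mul_mem_ge (P.exists_residue_mem f).choose_spec g.2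
      have h2 := mul_mem_ge (algebraMap_mem_ge (P := P) (P.exists_residue_mem f).choose)
        (P.exists_residue_mem g).choose_spec
      have := (P.ge 1).add_mem h1 h2
      convert this using 1
      change (f * g : K) - algebraMap k K ((P.exists_residue_mem f).choose *
        (P.exists_residue_mem g).choose) = _
      rw [map_mul]; ring))

/-- As in Gauss's lemma: expand `F` in a `k`-basis of the right factor and divide by a coefficient
of least order. All coefficients become regular and one becomes 1, so the reduction at the place is
nonzero. -/
theorem exists_tmul_mul_eq {F : K ⊗[k] K} (hF : F ≠ 0) :
    ∃ (a : K) (F₀ : P.ring ⊗[k] K), Algebra.TensorProduct.map P.ring.val (AlgHom.id k K) F₀ =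
      a ⊗ₜ 1 * F ∧ Algebra.TensorProduct.map P.value (AlgHom.id k K) F₀ ≠ 0 := by
  classical
  let b := Module.Basis.ofVectorSpace k K
  let e := TensorProduct.equivFinsuppOfBasisRight (M := K) b
  set f := e F with hf
  have hf0 : f ≠ 0 := by simpa [hf] using hF
  have hFsum : F = f.sum fun i m => m ⊗ₜ b i := by
    rw [← TensorProduct.equivFinsuppOfBasisRight_symm_apply, hf, LinearEquiv.symm_apply_apply]
  obtain ⟨i₀, hi₀, hmin⟩ := Finset.exists_min_image f.support (fun i => P.ord (f i))
    (Finsupp.support_nonempty_iff.2 hf0)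
  have hi₀' : f i₀ ≠ 0 := by simpa using hi₀
  have hmem : ∀ i, (f i₀)⁻¹ * f i ∈ P.ring := by
    intro i hne
    have hi := right_ne_zero_of_mul hne
    rw [P.ord_mul (inv_ne_zero hi₀') hi, P.ord_inv hi₀']
    have := hmin i (by simpa using hi)
    omega
  refine ⟨(f i₀)⁻¹, ∑ i ∈ f.support, ⟨(f i₀)⁻¹ * f i, hmem i⟩ ⊗ₜ b i, ?_, ?_⟩
  · conv_rhs => rw [hFsum]
    rw [map_sum, Finsupp.sum, Finset.mul_sum]
    simp
  · rw [map_sum]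
    simp only [Algebra.TensorProduct.map_tmul, AlgHom.id_apply]
    intro h
    have h2 := congrArg (fun z => (TensorProduct.equivFinsuppOfBasisRight (M := k) b z) i₀) h
    simp only [map_sum, TensorProduct.equivFinsuppOfBasisRight_apply_tmul, Finsupp.finsetSum_apply,
      map_zero, Finsupp.zero_apply] at h2
    rw [Finset.sum_eq_single i₀] at h2
    · have h3 : (⟨(f i₀)⁻¹ * f i₀, hmem i₀⟩ : P.ring) = 1 :=
        Subtype.ext (inv_mul_cancel₀ hi₀')
      simp [h3] at h2
    · intro i _ hi
      simp [hi]
    · exact fun h => (h hi₀).elim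

/-- A field with a rational place is geometrically integral. -/
theorem isDomain_tensorProduct (P : RationalPlace k K) : IsDomain (K ⊗[k] K) := by
  have hlid : IsDomain (k ⊗[k] K) := (Algebra.TensorProduct.lid k K).toMulEquiv.isDomain K
  have : NoZeroDivisors (K ⊗[k] K) := by
    refine ⟨fun {F G} hFG => ?_⟩
    by_contra! hne
    obtain ⟨a, F₀, hF₀, hF₁⟩ := P.exists_tmul_mul_eq hne.1
    obtain ⟨b, G₀, hG₀, hG₁⟩ := P.exists_tmul_mul_eq hne.2
    have hinj : Function.Injective (Algebra.TensorProduct.map P.ring.val (AlgHom.id k K)) :=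
      Module.Flat.rTensor_preserves_injective_linearMap (M := K) P.ring.val.toLinearMap
        Subtype.val_injective
    have h0 : F₀ * G₀ = 0 := hinj (by
      rw [map_mul, hF₀, hG₀, map_zero, mul_mul_mul_comm, hFG, mul_zero])
    -- The reductions lie in `k ⊗ K ≅ K`, where nonzero elements have nonzero products.
    have h1 := congrArg (Algebra.TensorProduct.map P.value (AlgHom.id k K)) h0
    rw [map_mul, map_zero] at h1
    exact (mul_eq_zero.1 h1).elim hF₁ hG₁
  have : Nontrivial (K ⊗[k] K) := inferInstance
  exact NoZeroDivisors.to_isDomain _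

end RationalPlace

end Diagonal

section Diagonal

theorem Ideal.pow_sub_pow_mem {A : Type*} [CommRing A] {I : Ideal A} {x y : A} (hx : x ∈ I)
    (hy : y ∈ I) (h : x - y ∈ I ^ 2) (n : ℕ) : x ^ n - y ^ n ∈ I ^ (n + 1) := by
  induction n with
  | zero => simp
  | succ n ih =>
    have e : x ^ (n + 1) - y ^ (n + 1) = (x ^ n - y ^ n) * x + y ^ n * (x - y) := by ring
    rw [e]
    refine Ideal.add_mem _ ?_ ?_
    · rw [pow_succ _ (n + 1)]
      exact Ideal.mul_mem_mul ih hx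
    · rw [show n + 1 + 1 = n + 2 by ring, pow_add]
      exact Ideal.mul_mem_mul (Ideal.pow_mem_pow hy n) h

namespace KaehlerDifferential

variable {k : Type*} [Field k] {K : Type*} [Field K] [Algebra k K]

/-- Krull's intersection theorem; `K ⊗ K` is noetherian because `K` is essentially of finite type.
-/
theorem iInf_ideal_pow_eq_bot [Algebra.EssFiniteType k K] [IsDomain (K ⊗[k] K)] :
    ⨅ n : ℕ, ideal k K ^ n = ⊥ := by
  have : IsNoetherianRing (K ⊗[k] K) := Algebra.EssFiniteType.isNoetherianRing K _
  refine Ideal.iInf_pow_eq_bot_of_isDomain _ (RingHom.ker_ne_top _)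

/-- Otherwise `I ^ n = I ^ (n + 1)`, so all higher powers agree and are zero by Krull; in a domain
this makes `I` zero. This is what makes leading coefficients unique. -/
theorem pow_notMem_ideal_pow_succ [Algebra.EssFiniteType k K] [IsDomain (K ⊗[k] K)] {x : K}
    (hx : ideal k K ≤ Ideal.span {(1 ⊗ₜ[k] x - x ⊗ₜ[k] 1 : K ⊗[k] K)} ⊔ ideal k K ^ 2)
    (hne : ideal k K ≠ ⊥) (n : ℕ) :
    (1 ⊗ₜ[k] x - x ⊗ₜ[k] 1 : K ⊗[k] K) ^ n ∉ ideal k K ^ (n + 1) := by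
  intro hmem
  have hτ := one_smul_sub_smul_one_mem_ideal k x
  have h1 : ideal k K ^ n ≤ ideal k K ^ (n + 1) := by
    refine (Ideal.pow_le_span_pow_sup hτ hx n).trans (sup_le ?_ le_rfl)
    rwa [Ideal.span_singleton_le_iff_mem]
  have h2 : ∀ m, ideal k K ^ n ≤ ideal k K ^ (n + m) := by
    intro m
    induction m with
    | zero => exact le_rfl
    | succ m ih =>
      calc ideal k K ^ n ≤ ideal k K ^ (n + 1) := h1
        _ = ideal k K ^ n * ideal k K := pow_succ _ _
        _ ≤ ideal k K ^ (n + m) * ideal k K := Ideal.mul_mono_left ih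
        _ = ideal k K ^ (n + (m + 1)) := by rw [← pow_succ]; rfl
  have h3 : ideal k K ^ n ≤ ⊥ := by
    rw [← iInf_ideal_pow_eq_bot (k := k) (K := K)]
    exact le_iInf fun m => (h2 m).trans (Ideal.pow_le_pow_right (by omega))
  rw [le_bot_iff] at h3
  exact hne (eq_zero_of_pow_eq_zero h3)

theorem tmul_one_mul_pow_mem_iff {x w : K} {n : ℕ}
    (hn : (1 ⊗ₜ[k] x - x ⊗ₜ[k] 1 : K ⊗[k] K) ^ n ∉ ideal k K ^ (n + 1)) :
    w ⊗ₜ[k] 1 * (1 ⊗ₜ[k] x - x ⊗ₜ[k] 1 : K ⊗[k] K) ^ n ∈ ideal k K ^ (n + 1) ↔ w = 0 := by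
  refine ⟨fun h => ?_, fun h => by simp [h]⟩
  by_contra hw
  apply hn
  have := Ideal.mul_mem_left _ (w⁻¹ ⊗ₜ[k] 1) h
  rwa [← mul_assoc, Algebra.TensorProduct.tmul_mul_tmul, inv_mul_cancel₀ hw, mul_one,
    ← Algebra.TensorProduct.one_def, one_mul] at this

/-- Any `f` or its inverse lies in the local ring, and `df = -f² d(f⁻¹)`. -/
theorem D_eq_smul_of_D_eq {O : Subalgebra k K} (hO : ∀ f : K, f ∈ O ∨ f⁻¹ ∈ O) {t : O}
    (ht : ∀ a : O, ∃ b : O, D k O a = b • D k O t) (f : K) :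
    ∃ c : K, D k K f = c • D k K (t : K) := by
  have h1 : ∀ a : O, ∃ c : K, D k K (a : K) = c • D k K (t : K) := by
    intro a
    obtain ⟨b, hb⟩ := ht a
    have := congrArg (KaehlerDifferential.map k k O K) hb
    rw [map_smul, map_D, map_D] at this
    exact ⟨b, this⟩
  rcases hO f with hf | hf
  · exact h1 ⟨f, hf⟩
  · by_cases hf0 : f = 0
    · exact ⟨0, by simp [hf0]⟩
    obtain ⟨c, hc⟩ := h1 ⟨f⁻¹, hf⟩
    refine ⟨-(f ^ 2) * c, ?_⟩
    have h2 : D k K (f * f⁻¹) = 0 := by rw [mul_inv_cancel₀ hf0, Derivation.map_one_eq_zero]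
    rw [Derivation.leibniz] at h2
    change f • D k K ((⟨f⁻¹, hf⟩ : O) : K) + _ = 0 at h2
    rw [hc] at h2
    have h3 : D k K f = f • (f⁻¹ • D k K f) := by rw [smul_smul, mul_inv_cancel₀ hf0, one_smul]
    rw [h3, eq_neg_of_add_eq_zero_right h2, smul_neg, smul_smul, smul_smul, ← neg_smul]
    congr 1
    ring

theorem ideal_ne_bot_of_derivation {d : Derivation k K K} (hd : d ≠ 0) : ideal k K ≠ ⊥ := by
  intro h
  apply hd
  ext f
  have h1 : (1 ⊗ₜ[k] f - f ⊗ₜ[k] 1 : K ⊗[k] K) = 0 := by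
    rw [← Ideal.mem_bot, ← h]
    exact one_smul_sub_smul_one_mem_ideal k f
  have h2 : D k K f = 0 := by
    rw [D_apply]
    refine (congrArg (ideal k K).toCotangent (Subtype.ext h1)).trans (map_zero _)
  rw [← Derivation.liftKaehlerDifferential_comp_D, h2, map_zero, Derivation.zero_apply]

theorem sub_mem_ideal_sq {x f c : K} (h : D k K f = c • D k K x) :
    (1 ⊗ₜ[k] f - f ⊗ₜ[k] 1 : K ⊗[k] K) - c ⊗ₜ[k] 1 * (1 ⊗ₜ[k] x - x ⊗ₜ[k] 1) ∈
      ideal k K ^ 2 := by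
  have h2 : c • D k K x = (ideal k K).toCotangent
      ((c ⊗ₜ[k] (1 : K)) • ⟨1 ⊗ₜ x - x ⊗ₜ 1, one_smul_sub_smul_one_mem_ideal k x⟩) :=
    (algebraMap_smul (K ⊗[k] K) c (D k K x)).symm.trans
      (map_smul (ideal k K).toCotangent (c ⊗ₜ[k] (1 : K)) _).symm
  exact (Ideal.toCotangent_eq _).1 (h.trans h2)

/-- The leading coefficient of an element of the `n`-th power of the ideal of the diagonal. -/
theorem exists_leadingCoeff [Algebra.EssFiniteType k K] [IsDomain (K ⊗[k] K)] {x : K}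
    (hx : ideal k K ≤ Ideal.span {(1 ⊗ₜ[k] x - x ⊗ₜ[k] 1 : K ⊗[k] K)} ⊔ ideal k K ^ 2)
    (hne : ideal k K ≠ ⊥) (n : ℕ) :
    ∃ l : ↥((ideal k K ^ n).restrictScalars k) →ₗ[k] K,
      ∀ F : ↥((ideal k K ^ n).restrictScalars k),
        (F : K ⊗[k] K) - (l F) ⊗ₜ[k] 1 * (1 ⊗ₜ[k] x - x ⊗ₜ[k] 1) ^ n ∈ ideal k K ^ (n + 1) := by
  choose l hl using fun F : ↥((ideal k K ^ n).restrictScalars k) =>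
    exists_sub_mem_pow_succ hx F.2
  have huniq : ∀ (F : K ⊗[k] K) (a b : K),
      F - a ⊗ₜ[k] 1 * (1 ⊗ₜ[k] x - x ⊗ₜ[k] 1) ^ n ∈ ideal k K ^ (n + 1) →
      F - b ⊗ₜ[k] 1 * (1 ⊗ₜ[k] x - x ⊗ₜ[k] 1) ^ n ∈ ideal k K ^ (n + 1) → a = b := by
    intro F a b ha hb
    have := Ideal.sub_mem _ hb ha
    rw [sub_sub_sub_cancel_left, ← sub_mul, ← TensorProduct.sub_tmul,
      tmul_one_mul_pow_mem_iff (pow_notMem_ideal_pow_succ hx hne n), sub_eq_zero] at this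
    exact this
  refine ⟨{ toFun := l, map_add' := fun F G => ?_, map_smul' := fun c F => ?_ }, hl⟩
  · refine huniq _ _ _ (hl _) ?_
    have := Ideal.add_mem _ (hl F) (hl G)
    rw [TensorProduct.add_tmul, add_mul]
    rwa [← add_sub_add_comm] at this
  · refine huniq _ _ _ (hl _) ?_
    have := ((ideal k K ^ (n + 1)).restrictScalars k).smul_mem c (hl F)
    rw [RingHom.id_apply, ← TensorProduct.smul_tmul', smul_mul_assoc]
    rwa [smul_sub] at this

end KaehlerDifferential

end Diagonal

/-! ### Poles of leading coefficients along the diagonal -/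

/-- Local parameters `t s` at the points `s` of a curve, whose differentials generate the
differentials of the local rings. -/
structure CompleteCurve.Parameters {k K S : Type*} [Field k] [Field K] [Algebra k K]
    (X : CompleteCurve k K S) where
  t (s : S) : (X.place s).ring
  t_ne_zero : ∀ s, (t s : K) ≠ 0
  ord_t : ∀ s, X.ord s (t s : K) = 1
  exists_D_eq : ∀ (s : S) (a : (X.place s).ring), ∃ b : (X.place s).ring,
    KaehlerDifferential.D k _ a = b • KaehlerDifferential.D k _ (t s)

namespace CompleteCurve

open RationalPlace KaehlerDifferential

variable {k K S : Type*} [Field k] [Field K] [Algebra k K] {X : CompleteCurve k K S}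
  (τ : X.Parameters)

theorem _root_.RationalPlace.mem_ring_or_inv_mem_ring (P : RationalPlace k K) (f : K) :
    f ∈ P.ring ∨ f⁻¹ ∈ P.ring := by
  by_cases hf : f = 0
  · exact Or.inl (hf ▸ P.ring.zero_mem)
  by_cases h : 0 ≤ P.ord f
  · exact Or.inl (fun _ => h)
  · exact Or.inr (fun _ => by rw [P.ord_inv hf]; omega)

namespace Parameters

theorem exists_D_eq_smul (s : S) (f : K) :
    ∃ c : K, D k K f = c • D k K (τ.t s : K) :=
  D_eq_smul_of_D_eq (mem_ring_or_inv_mem_ring _) (τ.exists_D_eq s) f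

theorem derivation_t_ne_zero {d : Derivation k K K} (hd : d ≠ 0) (s : S) : d (τ.t s) ≠ 0 := by
  intro h
  apply hd
  ext f
  obtain ⟨c, hc⟩ := τ.exists_D_eq_smul s f
  rw [← Derivation.liftKaehlerDifferential_comp_D, hc, map_smul,
    Derivation.liftKaehlerDifferential_comp_D, h, smul_zero, Derivation.zero_apply]

/-- The coefficient of `F ∈ 𝓞(n) ⊠ 𝓞(n)` along the diagonal has poles bounded by `2n`, as a
section of `Ω^i`. -/
theorem leadingCoeff_mem_ge [Algebra.EssFiniteType k K] [IsDomain (K ⊗[k] K)]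
    (hne : ideal k K ≠ ⊥) (s : S) {n : ℕ} {V : Submodule k K} (hV : V ≤ (X.place s).ge (-n))
    {x c : K} (hx : ∀ f, ∃ b : K, D k K f = b • D k K x) (hc : D k K (τ.t s : K) = c • D k K x)
    (hc0 : c ≠ 0) {i : ℕ} {F : K ⊗[k] K} (hF : F ∈ ideal k K ^ i)
    (hFV : F ∈ LinearMap.range (TensorProduct.map V.subtype V.subtype)) {w : K}
    (hw : F - w ⊗ₜ[k] 1 * (1 ⊗ₜ[k] x - x ⊗ₜ[k] 1) ^ i ∈ ideal k K ^ (i + 1)) :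
    w ∈ (X.place s).ge (-(2 * n) + i * X.ord s c) := by
  set O := (X.place s).ring
  set t : O := τ.t s
  have ht0 : (t : K) ≠ 0 := τ.t_ne_zero s
  have hxI := ideal_le_of_span_D_eq_top hx
  set ι := Algebra.TensorProduct.map O.val O.val with hι
  have hιJ : ∀ i, ∀ g ∈ ideal k O ^ i, ι g ∈ ideal k K ^ i := by
    intro i
    have h1 : ideal k O ≤ (ideal k K).comap ι := by
      rw [← KaehlerDifferential.span_range_eq_ideal, Ideal.span_le]
      rintro _ ⟨f, rfl⟩
      rw [SetLike.mem_coe, Ideal.mem_comap, map_sub]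
      exact one_smul_sub_smul_one_mem_ideal k (f : K)
    intro g hg
    have h2 := (Ideal.pow_right_mono h1 i).trans (Ideal.le_comap_pow _ _) hg
    exact h2
  have hspan : ∀ f, ∃ b : K, D k K f = b • D k K (t : K) := τ.exists_D_eq_smul s
  have htI := ideal_le_of_span_D_eq_top hspan
  have hJ := ideal_le_of_span_D_eq_top (τ.exists_D_eq s)
  have hιt : ι (1 ⊗ₜ[k] t - t ⊗ₜ[k] 1) = 1 ⊗ₜ[k] (t : K) - (t : K) ⊗ₜ[k] 1 := by
    rw [map_sub]; rfl
  have hιa : ∀ a : O, ι (a ⊗ₜ 1) = (a : K) ⊗ₜ 1 := fun a => rfl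
  -- elements of the image lie in the corresponding power of the ideal of the local diagonal
  have hstep : ∀ i, ∀ g : O ⊗[k] O, ι g ∈ ideal k K ^ i → g ∈ ideal k O ^ i := by
    intro i
    induction i with
    | zero => simp
    | succ i ih =>
      intro g hg
      obtain ⟨a, ha⟩ := exists_sub_mem_pow_succ hJ (ih g (Ideal.pow_le_pow_right (by omega) hg))
      have h1 := Ideal.sub_mem _ hg (hιJ _ _ ha)
      rw [map_sub, sub_sub_cancel, map_mul, map_pow, hιt, hιa,
        tmul_one_mul_pow_mem_iff (pow_notMem_ideal_pow_succ htI hne i)] at h1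
      have h2 : a = 0 := Subtype.ext h1
      simpa [h2] using ha
  have hmem : ∀ v : V, (t : K) ^ n * v ∈ O := by
    intro v
    have h1 : (t : K) ^ n ∈ (X.place s).ge n := by
      intro _
      rw [ord_pow _ ht0]
      have : (X.place s).ord t = 1 := τ.ord_t s
      rw [this, mul_one]
    have := mul_mem_ge h1 (hV v.2)
    rw [add_neg_cancel] at this
    exact this
  have hgen : ∀ v : V ⊗[k] V, ∃ g : O ⊗[k] O, ι g = ((t : K) ^ n) ⊗ₜ ((t : K) ^ n) *
      TensorProduct.map V.subtype V.subtype v := by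
    intro v
    induction v using TensorProduct.induction_on with
    | zero => exact ⟨0, by simp⟩
    | tmul u v =>
      refine ⟨⟨_, hmem u⟩ ⊗ₜ ⟨_, hmem v⟩, ?_⟩
      rw [hι, Algebra.TensorProduct.map_tmul, TensorProduct.map_tmul,
        Algebra.TensorProduct.tmul_mul_tmul]
      rfl
    | add u v hu hv =>
      obtain ⟨a, ha⟩ := hu
      obtain ⟨b, hb⟩ := hv
      exact ⟨a + b, by rw [map_add, map_add, ha, hb, mul_add]⟩
  -- Multiplying by `t ^ n` in both variables clears the poles. The leading coefficient with respect
  -- to `t` can then be computed over the local ring, where it is a regular function `a`.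
  obtain ⟨g, hg⟩ : ∃ g : O ⊗[k] O, ι g = ((t : K) ^ n) ⊗ₜ ((t : K) ^ n) * F := by
    obtain ⟨v, rfl⟩ := hFV
    exact hgen v
  have hgi : ι g ∈ ideal k K ^ i := hg ▸ Ideal.mul_mem_left _ _ hF
  obtain ⟨a, ha⟩ := exists_sub_mem_pow_succ hJ (hstep i g hgi)
  have h1 := hιJ _ _ ha
  rw [map_sub, map_mul, map_pow, hιt, hιa, hg] at h1
  have hxm := one_smul_sub_smul_one_mem_ideal k x
  have htm := one_smul_sub_smul_one_mem_ideal k (t : K)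
  have h2 := Ideal.pow_sub_pow_mem htm (Ideal.mul_mem_left _ (c ⊗ₜ[k] 1) hxm)
    (sub_mem_ideal_sq hc) i
  -- The two copies of `t ^ n` agree on the diagonal, so both may be moved to the left factor modulo
  -- the next power.
  have h3 : (1 ⊗ₜ[k] ((t : K) ^ n) - ((t : K) ^ n) ⊗ₜ[k] 1) * F ∈ ideal k K ^ (i + 1) := by
    rw [pow_succ']
    exact Ideal.mul_mem_mul (one_smul_sub_smul_one_mem_ideal k _) hF
  -- Two computations of one leading coefficient: `t ^ (2 * n) * w` with respect to `x`, and `a`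
  -- with respect to `t`. Changing the parameter multiplies by `c ^ i`, because `1 ⊗ t - t ⊗ 1` is
  -- `c` times `1 ⊗ x - x ⊗ 1` modulo the square of the ideal.
  have h4 : ((t : K) ^ (2 * n) * w - a * c ^ i) ⊗ₜ[k] 1 * (1 ⊗ₜ[k] x - x ⊗ₜ[k] 1) ^ i ∈
      ideal k K ^ (i + 1) := by
    have e1 : ((t : K) ^ (2 * n) * w - a * c ^ i) ⊗ₜ[k] (1 : K) =
        ((t : K) ^ n) ⊗ₜ[k] 1 * ((t : K) ^ n) ⊗ₜ[k] 1 * w ⊗ₜ[k] 1 -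
          (a : K) ⊗ₜ[k] 1 * (c ⊗ₜ[k] 1) ^ i := by
      rw [TensorProduct.sub_tmul]
      simp only [Algebra.TensorProduct.tmul_mul_tmul, Algebra.TensorProduct.tmul_pow, mul_one,
        one_pow]
      rw [← pow_add, two_mul]
    have e2 : ((t : K) ^ n) ⊗ₜ[k] ((t : K) ^ n) = (((t : K) ^ n) ⊗ₜ[k] 1 : K ⊗[k] K) *
        1 ⊗ₜ[k] ((t : K) ^ n) := by
      rw [Algebra.TensorProduct.tmul_mul_tmul, one_mul, mul_one]
    rw [e2] at h1
    rw [e1]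
    have h5 := Ideal.sub_mem _ (Ideal.add_mem _ h1 (Ideal.mul_mem_left _ ((a : K) ⊗ₜ[k] 1) h2))
      (Ideal.add_mem _ (Ideal.mul_mem_left _ (((t : K) ^ n) ⊗ₜ[k] 1) h3)
        (Ideal.mul_mem_left _ (((t : K) ^ n) ⊗ₜ[k] 1 * ((t : K) ^ n) ⊗ₜ[k] 1) hw))
    convert h5 using 1
    rw [mul_pow]
    ring
  rw [tmul_one_mul_pow_mem_iff (pow_notMem_ideal_pow_succ hxI hne i), sub_eq_zero] at h4
  intro hw0
  have h6 := congrArg (X.place s).ord h4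
  have ha0 : (a : K) ≠ 0 := by
    intro h
    rw [h, zero_mul] at h4
    exact (mul_ne_zero (pow_ne_zero _ ht0) hw0) h4
  rw [(X.place s).ord_mul (pow_ne_zero _ ht0) hw0, (X.place s).ord_mul ha0 (pow_ne_zero _ hc0),
    ord_pow _ ht0, ord_pow _ hc0] at h6
  have h7 : (X.place s).ord t = 1 := τ.ord_t s
  have h8 : 0 ≤ (X.place s).ord a := a.2 ha0
  rw [h7] at h6
  push_cast at h6
  change _ + _ * (X.place s).ord c ≤ _
  omega

end Parameters

end CompleteCurve

theorem IntermediateField.adjoin_simple_inv {k K : Type*} [Field k] [Field K] [Algebra k K]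
    (x : K) : IntermediateField.adjoin k {x⁻¹} = IntermediateField.adjoin k {x} := by
  apply le_antisymm <;> rw [adjoin_simple_le_iff]
  · exact inv_mem (mem_adjoin_simple_self k x)
  · simpa using inv_mem (mem_adjoin_simple_self k x⁻¹)

/-! ### Three marked points: no squares of logarithmic vector fields -/

namespace CompleteCurve

open RationalPlace KaehlerDifferential

variable {k K S : Type*} [Field k] [Field K] [Algebra k K] (X : CompleteCurve k K S)

theorem exists_sum_poles_le {x : K} (hx : x ≠ 0)
    [FiniteDimensional (IntermediateField.adjoin k {x}) K] :
    ∃ T : Finset S, (∀ s ∉ T, (-X.ord s x).toNat = 0) ∧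
      ∑ s ∈ T, ((-X.ord s x).toNat : ℤ) ≤
        Module.finrank (IntermediateField.adjoin k {x}) K := by
  have hinv : FiniteDimensional (IntermediateField.adjoin k {x⁻¹}) K := by
    rw [IntermediateField.adjoin_simple_inv]; assumption
  have hfin := X.finite_zeros (inv_ne_zero hx)
  have hord : ∀ s, X.ord s x⁻¹ = -X.ord s x := fun s => ord_inv _ hx
  refine ⟨hfin.toFinset, fun s hs => ?_, ?_⟩
  · have : ¬ 0 < X.ord s x⁻¹ := by simpa using hs
    rw [hord] at this
    omega
  · have := X.sum_ord_le_finrank (inv_ne_zero hx) hfin.toFinset (fun s hs => by simpa using hs)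
    rw [IntermediateField.adjoin_simple_inv] at this
    refine le_trans (Finset.sum_le_sum fun s hs => ?_) this
    have hs' : 0 < X.ord s x⁻¹ := by simpa using hs
    rw [hord] at hs' ⊢
    omega

variable {X}

/-- In the application `h` is a section of the square of the tangent sheaf vanishing doubly on `B`,
and `W` consists of sections of 𝒪(2A) ⊗ Ω^i. If a nonzero `w ∈ W` vanished to `M` extra orders at
`s₀`, then `w ^ 2 * h ^ i` would be a section of a divisor of degree `4 deg A - 2 i |B| - 2 M < 0`.
So `M` linear conditions kill `W`. Squaring `w` avoids a square root of `h`. -/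
theorem finrank_le_of_quadratic [IsAlgClosed k] {h : K} (h0 : h ≠ 0) {A c : S → ℤ} {B T : Finset S}
    (hh : ∀ s, -2 * c s ≤ X.ord s h) (hhB : ∀ s ∈ B, -2 * c s + 2 ≤ X.ord s h)
    (hA : ∀ s ∉ T, A s = 0)
    {s₀ : S} {i M : ℕ} (hM : 2 * ∑ s ∈ T, A s < i * B.card + M) {W : Submodule k K}
    (hW : ∀ w ∈ W, ∀ s, w ∈ (X.place s).ge (-(2 * A s) + i * c s)) :
    Module.Finite k W ∧ Module.finrank k W ≤ M := by
  classical
  have hbot : W ⊓ (X.place s₀).ge (-(2 * A s₀) + i * c s₀ + M) = ⊥ := by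
    rw [eq_bot_iff]
    rintro w ⟨hw, hw₀⟩
    rw [Submodule.mem_bot]
    by_contra hw0
    have hmem : w ^ 2 * h ^ i ∈ X.sections (fun s => 4 * A s - (if s ∈ B then (2 * i : ℤ) else 0) -
        (if s = s₀ then (2 * M : ℤ) else 0)) := by
      rw [mem_sections]
      intro s _
      rw [(X.place s).ord_mul (pow_ne_zero _ hw0) (pow_ne_zero _ h0), ord_pow _ hw0, ord_pow _ h0]
      have h2 := hW w hw s hw0
      have h3 : (i : ℤ) * (-2 * c s) ≤ i * X.ord s h :=
        mul_le_mul_of_nonneg_left (hh s) (by positivity)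
      have h3B : s ∈ B → (i : ℤ) * (-2 * c s + 2) ≤ i * X.ord s h := fun hs =>
        mul_le_mul_of_nonneg_left (hhB s hs) (by positivity)
      change _ ≤ _ + _ * X.ord s h
      have h4 : s = s₀ → -(2 * A s) + i * c s + M ≤ (X.place s).ord w := by
        rintro rfl; exact hw₀ hw0
      push_cast
      split_ifs with hb hs hs
      · linarith [h4 hs, h3B hb]
      · linarith [h3B hb]
      · linarith [h4 hs]
      · linarith
    have := X.sum_nonneg_of_mem_sections (mul_ne_zero (pow_ne_zero _ hw0) (pow_ne_zero _ h0)) hmem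
      (T ∪ B ∪ {s₀}) (fun s hs => by
        simp only [Finset.mem_union, Finset.mem_singleton, not_or] at hs
        simp [hA s hs.1.1, hs.1.2, hs.2])
    rw [Finset.sum_sub_distrib, Finset.sum_sub_distrib, ← Finset.mul_sum, Finset.sum_ite_mem,
      Finset.sum_ite_eq', if_pos (by simp),
      Finset.inter_eq_right.2 (by intro s hs; simp [hs]), Finset.sum_const,
      ← Finset.sum_subset (s₁ := T) (by intro s hs; simp [hs]) (fun s _ hs => hA s hs),
      nsmul_eq_mul] at this
    nlinarith
  have hle : W ≤ (X.place s₀).ge (-(2 * A s₀) + i * c s₀) := fun w hw => hW w hw s₀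
  have := finrank_le_add hle M (by rw [hbot]; infer_instance)
  rwa [hbot, finrank_bot, zero_add] at this

end CompleteCurve

/-- Rank–nullity for `l` on `V ⊓ I`: the kernel embeds in `V ⊓ J`. It peels off one graded piece of
the filtration by powers of the diagonal ideal. -/
theorem Submodule.finrank_inf_le_of_map {k A K : Type*} [Field k] [AddCommGroup A] [Module k A]
    [AddCommGroup K] [Module k K] {V I J : Submodule k A} (l : I →ₗ[k] K)
    (hJ : ∀ F : I, l F = 0 → (F : A) ∈ J) [Module.Finite k V] {M : ℕ}
    (hM : ∀ W : Submodule k K, (∀ w ∈ W, ∃ F : I, (F : A) ∈ V ∧ l F = w) →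
      Module.finrank k W ≤ M) :
    Module.finrank k ↥(V ⊓ I) ≤ M + Module.finrank k ↥(V ⊓ J) := by
  set φ : ↥(V ⊓ I) →ₗ[k] K := l ∘ₗ Submodule.inclusion inf_le_right with hφ
  have hV : Module.Finite k ↥(V ⊓ I) := inferInstance
  have hVJ : Module.Finite k ↥(V ⊓ J) := inferInstance
  rw [← LinearMap.finrank_range_add_finrank_ker φ]
  refine add_le_add (hM _ ?_) ?_
  · rintro _ ⟨F, rfl⟩
    exact ⟨_, F.2.1, rfl⟩
  · let ψ : LinearMap.ker φ →ₗ[k] ↥(V ⊓ J) :=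
      LinearMap.codRestrict _ ((V ⊓ I).subtype ∘ₗ (LinearMap.ker φ).subtype)
        (fun F => ⟨F.1.2.1, hJ ⟨F.1.1, F.1.2.2⟩ F.2⟩)
    refine LinearMap.finrank_le_finrank_of_injective (f := ψ) fun F G h => ?_
    exact Subtype.ext (Subtype.ext (congrArg (fun F : ↥(V ⊓ J) => (F : A)) h))

/-- The sum is `(2e + 1)(3e + 1)`, about `6e²`, and the right side is `(3e - am + a)²`, about `9e²`.
The choice of `n'` gives `e ≥ 2am + 2`, which absorbs the lower order terms. -/
theorem sum_range_lt_mul_self {a m n' e : ℕ} (ha1 : 0 < a) (hn' : n' = 2 * a * m + 2 + m)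
    (he : e = n' * a) : ∑ i ∈ Finset.range (2 * e + 1), (6 * e + 1 - 3 * i) <
      (a * (3 * n' - m + 1)) * (a * (3 * n' - m + 1)) := by
  have hgauss : ∀ j, j ≤ 2 * e + 1 →
      2 * (∑ i ∈ Finset.range j, (6 * e + 1 - 3 * i)) + 3 * (j * j) = j * (12 * e + 5) := by
    intro j
    induction j with
    | zero => simp
    | succ j ih =>
      intro hj
      rw [Finset.sum_range_succ]
      have h1 := ih (by omega)
      have h2 : 6 * e + 1 - 3 * j + 3 * j = 6 * e + 1 := by omega
      nlinarith
  have hg := hgauss _ le_rfl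
  by_contra! hfinal
  zify at hfinal hg
  rw [Nat.cast_sub (by omega)] at hfinal
  push_cast at hfinal
  have he' : (e : ℤ) = n' * a := by rw [he]; push_cast; ring
  have hn'' : (n' : ℤ) = 2 * a * m + 2 + m := by rw [hn']; push_cast; ring
  have ha' : (1 : ℤ) ≤ a := by exact_mod_cast ha1
  have hm' : (0 : ℤ) ≤ m := by positivity
  have hle : (2 * (a * m) + 2 : ℤ) ≤ e := by
    rw [he']
    nlinarith [mul_nonneg hm' (by positivity : (0 : ℤ) ≤ a)]
  have h1 : ((a : ℤ) * (3 * n' - m + 1)) = 3 * e - a * m + a := by rw [he']; ring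
  rw [h1] at hfinal
  have h2 : (3 * e - a * m : ℤ) * (3 * e - a * m) ≤ (3 * e - a * m + a) * (3 * e - a * m + a) := by
    have : (0 : ℤ) ≤ a * m := by positivity
    apply mul_self_le_mul_self <;> linarith
  nlinarith [mul_nonneg (by positivity : (0 : ℤ) ≤ e) (sub_nonneg.2 hle), sq_nonneg ((a : ℤ) * m)]

namespace CompleteCurve.Parameters

open RationalPlace KaehlerDifferential

variable {k K S : Type*} [Field k] [Field K] [Algebra k K] {X : CompleteCurve k K S}
  (τ : X.Parameters)

/-- On a curve with three marked points, the square of the sheaf of logarithmic vector fields has no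
nonzero global section. -/
theorem eq_zero_of_ord_ge [IsAlgClosed k] [Algebra.EssFiniteType k K] {d : Derivation k K K}
    (hd : d ≠ 0) {h : K} {B : Finset S} (hB : B.card = 3)
    (hh : ∀ s, -2 * X.ord s (d (τ.t s)) ≤ X.ord s h)
    (hhB : ∀ s ∈ B, -2 * X.ord s (d (τ.t s)) + 2 ≤ X.ord s h) : h = 0 := by
  classical
  by_contra h0
  obtain ⟨s₀, hs₀⟩ : B.Nonempty := by rw [← Finset.card_pos]; omega
  set x : K := (τ.t s₀ : K) with hx
  have hx0 : x ≠ 0 := τ.t_ne_zero s₀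
  have hdx : d x ≠ 0 := τ.derivation_t_ne_zero hd s₀
  have hspan : ∀ f, ∃ b : K, D k K f = b • D k K x := τ.exists_D_eq_smul s₀
  choose c hc using fun s => hspan (τ.t s)
  have hdc : ∀ s, d (τ.t s) = c s * d x := by
    intro s
    rw [← Derivation.liftKaehlerDifferential_comp_D, hc, map_smul,
      Derivation.liftKaehlerDifferential_comp_D, smul_eq_mul]
  have hc0 : ∀ s, c s ≠ 0 := by
    intro s hs
    exact τ.derivation_t_ne_zero hd s (by rw [hdc, hs, zero_mul])
  -- The factor `d x ^ 2` replaces `d (τ.t s)` by `c s`, the coefficient of the differential of `τ.t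
  -- s` with respect to that of `x`; this is what governs the poles of leading coefficients.
  have h2 : ∀ s, X.ord s (h * d x ^ 2) = X.ord s h + 2 * X.ord s (d x) := by
    intro s
    refine ((X.place s).ord_mul h0 (pow_ne_zero _ hdx)).trans ?_
    rw [ord_pow _ hdx]; rfl
  have h3 : ∀ s, X.ord s (d (τ.t s)) = X.ord s (c s) + X.ord s (d x) := by
    intro s
    rw [hdc]; exact (X.place s).ord_mul (hc0 s) hdx
  have hh' : ∀ s, -2 * X.ord s (c s) ≤ X.ord s (h * d x ^ 2) := fun s => by
    linarith [hh s, h2 s, h3 s]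
  have hhB' : ∀ s ∈ B, -2 * X.ord s (c s) + 2 ≤ X.ord s (h * d x ^ 2) := fun s hs => by
    linarith [hhB s hs, h2 s, h3 s]
  have hh0 : h * d x ^ 2 ≠ 0 := mul_ne_zero h0 (pow_ne_zero _ hdx)
  have hdom : IsDomain (K ⊗[k] K) := isDomain_tensorProduct (X.place s₀)
  have hne : ideal k K ≠ ⊥ := ideal_ne_bot_of_derivation hd
  have hxt : Transcendental k x :=
    (X.place s₀).transcendental hx0 (by rw [show (X.place s₀).ord x = 1 from τ.ord_t s₀]; simp)
  have hfin : FiniteDimensional (IntermediateField.adjoin k {x}) K :=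
    X.finite _ fun e he => hxt (by rw [← he]; exact isAlgebraic_algebraMap e)
  obtain ⟨T, hT, hTa⟩ := X.exists_sum_poles_le hx0
  obtain ⟨m, hm⟩ := X.exists_finrank_sections_ge hxt
  set a := Module.finrank (IntermediateField.adjoin k {x}) K with ha
  have ha1 : 0 < a := Module.finrank_pos
  -- Chosen so that `n' * a` outweighs `a * m`, the loss in the dimension of `V` compared with the
  -- degree of its divisor.
  set n' : ℕ := 2 * a * m + 2 + m with hn'
  obtain ⟨V, hV, hVf, hVr⟩ := hm (3 * n' - m)
  have hnm : 3 * n' - m + m = 3 * n' := by omega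
  rw [hnm] at hV
  set 𝓥 := LinearMap.range (TensorProduct.map V.subtype V.subtype) with h𝓥
  have h𝓥f : Module.Finite k 𝓥 := inferInstance
  have h𝓥r : Module.finrank k 𝓥 = (a * (3 * n' - m + 1)) * (a * (3 * n' - m + 1)) := by
    have hinj : Function.Injective (TensorProduct.map V.subtype V.subtype) :=
      TensorProduct.map_injective_of_flat_flat _ _ V.injective_subtype V.injective_subtype
    rw [h𝓥, LinearMap.finrank_range_of_inj hinj, Module.finrank_tensorProduct, hVr]
  set I : ℕ → Submodule k (K ⊗[k] K) := fun i => (ideal k K ^ i).restrictScalars k with hI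
  have hxI := ideal_le_of_span_D_eq_top hspan
  -- The sections in `𝓥` have poles along a divisor `A` with `deg A ≤ 3 * n' * a` in each variable,
  -- and `B` has three points: this is the condition `2 deg A < i |B| + M`.
  have hstep : ∀ i : ℕ, ∀ M : ℕ, 6 * (n' * a) < 3 * i + M →
      Module.finrank k ↥(𝓥 ⊓ I i) ≤ M + Module.finrank k ↥(𝓥 ⊓ I (i + 1)) := by
    intro i M hM
    obtain ⟨l, hl⟩ := exists_leadingCoeff hxI hne i
    refine Submodule.finrank_inf_le_of_map l (fun F hF => ?_) (fun W hW => ?_)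
    · have := hl F
      rw [hF, TensorProduct.zero_tmul, zero_mul, sub_zero] at this
      exact this
    · refine (finrank_le_of_quadratic (X := X) (A := fun s => (3 * n' * (-X.ord s x).toNat : ℕ))
        (c := fun s => X.ord s (c s)) (T := T) (s₀ := s₀) (i := i)
        hh0 hh' hhB' (fun s hs => by simp [hT s hs]) ?_ ?_).2
      · rw [hB]
        push_cast
        rw [← Finset.mul_sum]
        have h1 : (3 * n' : ℤ) * ∑ s ∈ T, ((-X.ord s x).toNat : ℤ) ≤ 3 * n' * a :=
          mul_le_mul_of_nonneg_left hTa (by positivity)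
        have h2 : (6 * (n' * a) : ℤ) < 3 * i + M := by exact_mod_cast hM
        simp only [Int.ofNat_toNat] at h1 ⊢
        linarith
      · intro w hw s
        obtain ⟨F, hF, rfl⟩ := hW w hw
        exact τ.leadingCoeff_mem_ge hne s (fun v hv => mem_sections.1 (hV hv) s) hspan (hc s)
          (hc0 s) F.2 hF (hl F)
  set e := n' * a with he
  have hsum : ∀ j, j ≤ 2 * e + 1 → Module.finrank k 𝓥 ≤
      ∑ i ∈ Finset.range j, (6 * e + 1 - 3 * i) + Module.finrank k ↥(𝓥 ⊓ I j) := by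
    intro j
    induction j with
    | zero =>
      intro _
      have h1 : 𝓥 ⊓ I 0 = 𝓥 := by simp [hI]
      rw [h1]; simp
    | succ j ih =>
      intro hj
      refine (ih (by omega)).trans ?_
      rw [Finset.sum_range_succ, add_assoc]
      exact Nat.add_le_add_left (hstep j _ (by omega)) _
  -- Beyond `i = 2 * e` even `M = 0` is allowed, so the filtration is constant from there on. It
  -- therefore lies in every power of the diagonal ideal, and these intersect in zero.
  have hconst : ∀ j, 𝓥 ⊓ I (2 * e + 1) ≤ I (2 * e + 1 + j) := by
    intro j
    induction j with
    | zero => exact inf_le_right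
    | succ j ih =>
      have h1 := hstep (2 * e + 1 + j) 0 (by omega)
      rw [zero_add] at h1
      have h2 : 𝓥 ⊓ I (2 * e + 1 + j + 1) = 𝓥 ⊓ I (2 * e + 1 + j) :=
        Submodule.eq_of_le_of_finrank_le
          (inf_le_inf_left _ fun F hF => Ideal.pow_le_pow_right (Nat.le_succ _) hF) h1
      exact (le_inf inf_le_left ih).trans (h2.symm.le.trans inf_le_right)
  have hbot : 𝓥 ⊓ I (2 * e + 1) = ⊥ := by
    rw [eq_bot_iff]
    intro F hF
    rw [Submodule.mem_bot, ← Ideal.mem_bot, ← iInf_ideal_pow_eq_bot (k := k) (K := K),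
      Ideal.mem_iInf]
    exact fun j => Ideal.pow_le_pow_right (by omega) (hconst j hF)
  have hfinal := hsum _ le_rfl
  rw [hbot, finrank_bot, add_zero, h𝓥r] at hfinal
  exact absurd hfinal (not_le.2 (sum_range_lt_mul_self ha1 hn' he))

end CompleteCurve.Parameters

/-! ### Smooth local rings of dimension one -/

section LocalAlgebra

open IsLocalRing

variable {k O : Type*} [Field k] [CommRing O] [Algebra k O]

/-- The tangent vector `d` is an algebra map to `k[X]/(X²)`, which formal smoothness lifts to
`k[X]/(X^(m+1))`. The lift sends `t` to `X (d t + X q)`, whose `m`-th power is nonzero since `d t ≠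
0`. -/
theorem not_isNilpotent_of_derivation [Algebra.FormallySmooth k O] (π : O →ₐ[k] k) (d : O →ₗ[k] k)
    (hd : ∀ a b, d (a * b) = π a * d b + π b * d a) {t : O} (ht : π t = 0) (hdt : d t ≠ 0) :
    ¬ IsNilpotent t := by
  rintro ⟨m, hm⟩
  open Polynomial in
  let J : Ideal k[X] := Ideal.span {Polynomial.X ^ (m + 1)}
  let I : Ideal (k[X] ⧸ J) := Ideal.span {Ideal.Quotient.mk J (Polynomial.X ^ 2)}
  have hI : IsNilpotent I := by
    refine ⟨m + 1, ?_⟩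
    rw [Ideal.span_singleton_pow, Ideal.zero_eq_bot, Ideal.span_singleton_eq_bot, ← map_pow,
      Ideal.Quotient.eq_zero_iff_mem, ← pow_mul, two_mul, pow_add]
    exact Ideal.mul_mem_left _ _ (Ideal.mem_span_singleton_self _)
  let φ : O →ₗ[k] k[X] := (Algebra.linearMap k k[X]) ∘ₗ π.toLinearMap +
    (LinearMap.mulRight k Polynomial.X) ∘ₗ (Algebra.linearMap k k[X]) ∘ₗ d
  have hφ : ∀ a, φ a = C (π a) + C (d a) * Polynomial.X := fun a => rfl
  let ψ : (k[X]) →ₐ[k] ((k[X] ⧸ J) ⧸ I) :=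
    (Ideal.Quotient.mkₐ k I).comp (Ideal.Quotient.mkₐ k J)
  have hd1 : d 1 = 0 := by simpa using hd 1 1
  have hψ : ∀ q, ψ (Polynomial.X ^ 2 * q) = 0 := by
    intro q
    refine Ideal.Quotient.eq_zero_iff_mem.2 ?_
    change Ideal.Quotient.mk J _ ∈ I
    rw [map_mul]
    exact Ideal.mul_mem_right _ _ (Ideal.mem_span_singleton_self _)
  let g : O →ₐ[k] ((k[X] ⧸ J) ⧸ I) := AlgHom.ofLinearMap (ψ.toLinearMap ∘ₗ φ)
    (by
      change ψ (φ 1) = 1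
      rw [hφ, hd1]; simp)
    (fun a b => by
      change ψ (φ (a * b)) = ψ (φ a) * ψ (φ b)
      rw [← map_mul, ← sub_eq_zero, ← map_sub, hφ, hφ, hφ, hd]
      have : C (π (a * b)) + C (π a * d b + π b * d a) * Polynomial.X -
          (C (π a) + C (d a) * Polynomial.X) * (C (π b) + C (d b) * Polynomial.X) =
            Polynomial.X ^ 2 * -(C (d a) * C (d b)) := by
        simp only [map_mul, map_add]; ring
      rw [this, hψ])
  obtain ⟨f, hf⟩ := Algebra.FormallySmooth.exists_lift I hI g
  have h1 : Ideal.Quotient.mk I (f t) = Ideal.Quotient.mk I (Ideal.Quotient.mk J (φ t)) :=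
    DFunLike.congr_fun hf t
  rw [Ideal.Quotient.eq, Ideal.mem_span_singleton'] at h1
  obtain ⟨q, hq⟩ := h1
  obtain ⟨q, rfl⟩ := Ideal.Quotient.mk_surjective q
  have h2 : f t = Ideal.Quotient.mk J (Polynomial.X * (C (d t) + Polynomial.X * q)) := by
    rw [← sub_eq_zero, ← sub_eq_zero.2 hq.symm, hφ, ht]
    simp only [map_mul, map_add, map_pow, map_zero]
    ring
  have h3 : f t ^ m = 0 := by rw [← map_pow, hm, map_zero]
  rw [h2, ← map_pow, Ideal.Quotient.eq_zero_iff_mem, Ideal.mem_span_singleton, mul_pow,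
    pow_succ, mul_dvd_mul_iff_left (pow_ne_zero _ X_ne_zero), X_dvd_iff,
    coeff_zero_eq_eval_zero] at h3
  simp [hdt] at h3

variable [IsLocalRing O] [IsNoetherianRing O]

/-- By Krull's intersection theorem every nonzero element is a unit times a power of `t`, and no
power of `t` vanishes. -/
theorem IsLocalRing.isDomain_of_maximalIdeal_eq_span {t : O} (ht : maximalIdeal O = Ideal.span {t})
    (hnil : ¬ IsNilpotent t) : IsDomain O := by
  have hfac : ∀ a : O, a ≠ 0 → ∃ (n : ℕ) (u : O), IsUnit u ∧ a = u * t ^ n := by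
    intro a ha
    have h1 : ∃ n, a ∉ maximalIdeal O ^ n := by
      by_contra! h
      apply ha
      rw [← Ideal.mem_bot,
        ← Ideal.iInf_pow_eq_bot_of_isLocalRing _ (maximalIdeal.isMaximal O).ne_top]
      exact Ideal.mem_iInf.2 h
    classical
    have h2 := Nat.find_spec h1
    have h3 : Nat.find h1 ≠ 0 := by
      intro h
      rw [h] at h2
      simp at h2
    obtain ⟨n, hn⟩ := Nat.exists_eq_succ_of_ne_zero h3
    rw [hn, Nat.succ_eq_add_one] at h2
    have h4 := Nat.find_min h1 (m := n) (by omega)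
    rw [not_not, ht, Ideal.span_singleton_pow, Ideal.mem_span_singleton'] at h4
    obtain ⟨u, rfl⟩ := h4
    refine ⟨n, u, ?_, rfl⟩
    by_contra hu
    apply h2
    rw [pow_succ']
    exact Ideal.mul_mem_mul hu (Ideal.pow_mem_pow (ht ▸ Ideal.mem_span_singleton_self t) _)
  have : NoZeroDivisors O := by
    refine ⟨fun {a b} hab => ?_⟩
    by_contra! h
    obtain ⟨n, u, hu, rfl⟩ := hfac a h.1
    obtain ⟨m, v, hv, rfl⟩ := hfac b h.2
    apply hnil
    refine ⟨n + m, ?_⟩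
    have : u * v * t ^ (n + m) = 0 := by rw [← hab]; ring
    exact (hu.mul hv).mul_right_eq_zero.1 this
  exact NoZeroDivisors.to_isDomain O

/-- A one-dimensional smooth local ring with rational residue field is a discrete valuation ring
whose differentials are generated by the differential of a uniformizer. -/
theorem exists_parameter_of_formallySmooth [Algebra.FormallySmooth k O]
    (e : Ω[O⁄k] ≃ₗ[O] O) (π : O →ₐ[k] k) :
    IsDomain O ∧ ∃ t : O, ¬ IsNilpotent t ∧ maximalIdeal O = Ideal.span {t} ∧
      ∀ a : O, ∃ b : O, KaehlerDifferential.D k O a = b • KaehlerDifferential.D k O t := by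
  have hπ : maximalIdeal O = RingHom.ker π.toRingHom := by
    refine (IsLocalRing.eq_maximalIdeal ?_).symm
    refine RingHom.ker_isMaximal_of_surjective _ fun c => ⟨algebraMap k O c, π.commutes c⟩
  have hmem : ∀ a, a ∈ maximalIdeal O ↔ π a = 0 := fun a => by rw [hπ]; rfl
  have hsub : ∀ a, a - algebraMap k O (π a) ∈ maximalIdeal O := fun a => by
    rw [hmem, map_sub, π.commutes]; simp
  set D := KaehlerDifferential.D k O
  -- Subtracting its value from a function does not change its differential. If all differentials of
  -- elements of the maximal ideal had non-unit coefficients, no differential could generate,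
  -- contrary to `e`.
  obtain ⟨t, ht, htu⟩ : ∃ t, t ∈ maximalIdeal O ∧ IsUnit (e (D t)) := by
    by_contra! h
    have h1 : ∀ a, e (D a) ∈ maximalIdeal O := by
      intro a
      have := h _ (hsub a)
      rwa [map_sub, Derivation.map_algebraMap, sub_zero] at this
    have h2 : (⊤ : Submodule O Ω[O⁄k]) ≤
        Submodule.comap e.toLinearMap (maximalIdeal O) := by
      rw [← KaehlerDifferential.span_range_derivation, Submodule.span_le]
      rintro _ ⟨a, rfl⟩
      exact h1 a
    have := h2 (x := e.symm 1) trivial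
    simp at this
  have hD : ∀ w : Ω[O⁄k], ∃ b : O, w = b • D t := by
    intro w
    obtain ⟨v, hv⟩ := htu
    refine ⟨e w * ↑v⁻¹, e.injective ?_⟩
    rw [map_smul, smul_eq_mul, ← hv, mul_assoc, Units.inv_mul, mul_one]
  have hspan : maximalIdeal O = Ideal.span {t} := by
    -- The class of `a - π a` in 𝔪/𝔪² is a derivation in `a`, so it factors through the
    -- differentials. Hence `t` generates 𝔪 modulo 𝔪², and Nakayama's lemma applies.
    let δ : Derivation k O (maximalIdeal O).Cotangent :=
      { toFun := fun a => (maximalIdeal O).toCotangent ⟨_, hsub a⟩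
        map_add' := fun a b => by
          rw [← map_add]
          congr 1
          ext
          simp only [map_add, Submodule.coe_add]
          ring
        map_smul' := fun c a => by
          refine (congrArg (maximalIdeal O).toCotangent (Subtype.ext ?_)).trans
            ((map_smul (maximalIdeal O).toCotangent (algebraMap k O c) ⟨_, hsub a⟩).trans
              (algebraMap_smul O c _))
          simp only [Submodule.coe_smul, Algebra.smul_def, map_mul, π.commutes,
            Algebra.algebraMap_self, RingHom.id_apply]
          ring
        map_one_eq_zero' := by
          refine (congrArg (maximalIdeal O).toCotangent (Subtype.ext ?_)).trans
            (map_zero (maximalIdeal O).toCotangent)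
          simp
        leibniz' := fun a b => by
          change (maximalIdeal O).toCotangent ⟨_, _⟩ = a • (maximalIdeal O).toCotangent ⟨_, _⟩ +
            b • (maximalIdeal O).toCotangent ⟨_, _⟩
          rw [← map_smul, ← map_smul, ← map_add, Ideal.toCotangent_eq]
          simp only [Submodule.coe_add, Submodule.coe_smul, smul_eq_mul, map_mul]
          have := Ideal.mul_mem_mul (hsub a) (hsub b)
          rw [← pow_two] at this
          have h2 := Submodule.neg_mem _ this
          convert h2 using 1
          ring }
    have hle : maximalIdeal O ≤ Ideal.span {t} := by
      refine Submodule.le_of_le_smul_of_le_jacobson_bot (I := maximalIdeal O)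
        (IsNoetherian.noetherian _) (IsLocalRing.maximalIdeal_le_jacobson _) ?_
      intro a ha
      obtain ⟨b, hb⟩ := hD (D a)
      have h1 : δ a = b • δ t := by
        rw [← Derivation.liftKaehlerDifferential_comp_D δ a, hb, map_smul,
          Derivation.liftKaehlerDifferential_comp_D]
      change (maximalIdeal O).toCotangent ⟨_, _⟩ = b • (maximalIdeal O).toCotangent ⟨_, _⟩ at h1
      rw [← map_smul, Ideal.toCotangent_eq] at h1
      simp only [Submodule.coe_smul, (hmem a).1 ha, (hmem t).1 ht, map_zero, sub_zero] at h1
      rw [smul_eq_mul, ← pow_two]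
      have : a = b * t + (a - b • t) := by rw [smul_eq_mul]; ring
      rw [this]
      exact Submodule.add_mem_sup (Ideal.mul_mem_left _ _ (Ideal.mem_span_singleton_self _)) h1
    exact le_antisymm hle ((Ideal.span_singleton_le_iff_mem _).2 ht)
  have hnil : ¬ IsNilpotent t := by
    refine not_isNilpotent_of_derivation π
      (π.toLinearMap ∘ₗ (e.toLinearMap.restrictScalars k) ∘ₗ D.toLinearMap) (fun a b => ?_)
      ((hmem t).1 ht) ?_
    · change π (e (D (a * b))) = _ * π (e (D b)) + _ * π (e (D a))
      rw [Derivation.leibniz]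
      simp
    · intro h
      exact (hmem _).not.1 ((mem_maximalIdeal _).not.2 (not_not.2 htu)) h
  exact ⟨isDomain_of_maximalIdeal_eq_span hspan hnil, t, hnil, hspan, fun a => hD _⟩

end LocalAlgebra

/-! ### The place of a discrete valuation ring -/

section Place

open IsLocalRing IsDedekindDomain

section

variable {O K : Type*} [CommRing O] [IsDomain O] [IsDiscreteValuationRing O] [Field K] [Algebra O K]
  [IsFractionRing O K]

theorem IsDiscreteValuationRing.log_valuation_nonpos_iff {f : K} (hf : f ≠ 0) :
    ((IsDiscreteValuationRing.maximalIdeal O).valuation K f).log ≤ 0 ↔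
      ∃ a, algebraMap O K a = f := by
  rw [← WithZero.log_one (M := ℤ), WithZero.log_le_log (by simpa) (by simp)]
  refine ⟨IsDiscreteValuationRing.exists_lift_of_le_one, ?_⟩
  rintro ⟨a, rfl⟩
  exact HeightOneSpectrum.valuation_le_one _ a

theorem IsDiscreteValuationRing.log_valuation_neg {a : O} (ha : a ≠ 0)
    (ham : a ∈ IsLocalRing.maximalIdeal O) :
    ((IsDiscreteValuationRing.maximalIdeal O).valuation K (algebraMap O K a)).log < 0 := by
  have h0 : algebraMap O K a ≠ 0 := by simpa using ha
  rw [← WithZero.log_one (M := ℤ), WithZero.log_lt_log (by simpa) (by simp)]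
  exact (HeightOneSpectrum.valuation_lt_one_iff_mem _ a).2 ham

end

/-- The rational place of a discrete valuation ring. -/
noncomputable def RationalPlace.ofDVR (k O K : Type*) [Field k] [CommRing O] [IsDomain O]
    [IsDiscreteValuationRing O] [Field K] [Algebra O K] [IsFractionRing O K] [Algebra k O]
    [Algebra k K] [IsScalarTower k O K] (π : O →ₐ[k] k) : RationalPlace k K where
  ord f := -((IsDiscreteValuationRing.maximalIdeal O).valuation K f).log
  ord_mul {f g} hf hg := by
    rw [map_mul, WithZero.log_mul (by simpa) (by simpa)]; ring
  ord_add {f g} hf hg hfg := by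
    have h1 := ((IsDiscreteValuationRing.maximalIdeal O).valuation K).map_add f g
    rcases le_max_iff.1 h1 with h | h
    · have := (WithZero.log_le_log (by simpa) (by simpa)).2 h
      exact (min_le_left _ _).trans (neg_le_neg this)
    · have := (WithZero.log_le_log (by simpa) (by simpa)).2 h
      exact (min_le_right _ _).trans (neg_le_neg this)
  exists_ord_eq_one := by
    obtain ⟨t, ht⟩ := (IsDiscreteValuationRing.maximalIdeal O).valuation_exists_uniformizer K
    refine ⟨t, ?_, by rw [ht]; simp⟩
    rintro rfl
    rw [map_zero] at ht
    exact WithZero.exp_ne_zero ht.symm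
  ord_algebraMap c hc := by
    have h0 : ∀ c : k, c ≠ 0 →
        ((IsDiscreteValuationRing.maximalIdeal O).valuation K (algebraMap k K c)).log ≤ 0 :=
      fun c hc => (IsDiscreteValuationRing.log_valuation_nonpos_iff (by simpa)).2
        ⟨algebraMap k O c, (IsScalarTower.algebraMap_apply k O K c).symm⟩
    have h1 := h0 c⁻¹ (inv_ne_zero hc)
    rw [map_inv₀, map_inv₀, WithZero.log_inv] at h1
    have h2 := h0 c hc
    omega
  exists_residue f hf hf0 := by
    obtain ⟨a, rfl⟩ := (IsDiscreteValuationRing.log_valuation_nonpos_iff (O := O) hf).1 (by omega)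
    refine ⟨π a, fun h => ?_⟩
    rw [IsScalarTower.algebraMap_apply k O K, ← map_sub] at h ⊢
    have hker : IsLocalRing.maximalIdeal O = RingHom.ker π.toRingHom :=
      (IsLocalRing.eq_maximalIdeal (RingHom.ker_isMaximal_of_surjective _
        fun c => ⟨algebraMap k O c, π.commutes c⟩)).symm
    have := IsDiscreteValuationRing.log_valuation_neg (K := K) (a := a - algebraMap k O (π a))
      (by rintro h0; simp [h0] at h) (by rw [hker, RingHom.mem_ker]; simp)
    omega

end Place

/-! ### Local rings and integrality of the curve -/

namespace MarkedCurve

variable {k : Type u} [Field k] {r : ℕ} (C : MarkedCurve k r)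

instance : SmoothOfRelativeDimension 1 C.str := C.smooth
instance : Smooth C.str := SmoothOfRelativeDimension.smooth 1 _
instance : IsProper C.str := C.proper
instance : ConnectedSpace C.X := C.connected
instance : IsLocallyNoetherian C.X := LocallyOfFiniteType.isLocallyNoetherian C.str
instance : JacobsonSpace C.X := LocallyOfFiniteType.jacobsonSpace C.str
instance : CompactSpace C.X := compactSpace_of_universallyClosed C.str
instance : IsNoetherian C.X := {}

noncomputable instance algebraStalk (x : C.X) : Algebra k (C.X.presheaf.stalk x) :=
  ((C.X.presheaf.germ ⊤ x trivial).hom.comp (algebraMap k Γ(C.X, ⊤))).toAlgebra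

theorem germ_algebraMap {U : C.X.Opens} {x : C.X} (hx : x ∈ U) (c : k) :
    (C.X.presheaf.germ U x hx).hom (algebraMap k Γ(C.X, U) c) =
      algebraMap k (C.X.presheaf.stalk x) c := by
  rw [← C.res_algebraMap (le_top : U ≤ ⊤) c]
  exact C.X.presheaf.germ_res_apply (homOfLE le_top) x hx _

instance isScalarTower_stalk {U : C.X.Opens} (x : U) :
    IsScalarTower k Γ(C.X, U) (C.X.presheaf.stalk x.1) :=
  IsScalarTower.of_algebraMap_eq fun c => (C.germ_algebraMap x.2 c).symm

/-- `Spec k` has a single point, so the nonempty open subset `U` of the base is everything. -/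
theorem isStandardSmooth_of_appLE {U : (Spec (CommRingCat.of k)).Opens} {V : C.X.Opens}
    {x : C.X} (hxV : x ∈ V) (e : V ≤ C.str ⁻¹ᵁ U)
    (h : (C.str.appLE U V e).hom.IsStandardSmoothOfRelativeDimension 1) :
    Algebra.IsStandardSmoothOfRelativeDimension 1 k Γ(C.X, V) := by
  obtain rfl : U = ⊤ := by
    ext y
    simp only [SetLike.mem_coe, TopologicalSpace.Opens.mem_top, iff_true]
    have : Subsingleton (Spec (CommRingCat.of k)) :=
      inferInstanceAs (Subsingleton (PrimeSpectrum k))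
    have h2 := e hxV
    rwa [Subsingleton.elim y (C.str x)]
  rw [← RingHom.isStandardSmoothOfRelativeDimension_algebraMap]
  exact RingHom.isStandardSmoothOfRelativeDimension_respectsIso.2 _
    (Scheme.ΓSpecIso (CommRingCat.of k)).symm.commRingCatIsoToRingEquiv h

theorem exists_isStandardSmooth (x : C.X) : ∃ V : C.X.Opens, IsAffineOpen V ∧ x ∈ V ∧
    Algebra.IsStandardSmoothOfRelativeDimension 1 k Γ(C.X, V) := by
  obtain ⟨U, -, V, hV, hx, e, h⟩ :=
    SmoothOfRelativeDimension.exists_isStandardSmoothOfRelativeDimension (n := 1) (f := C.str) x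
  exact ⟨V, hV, hx, C.isStandardSmooth_of_appLE hx e h⟩

theorem residueFieldIsoBase_inv [IsAlgClosed k] {x : C.X} (hx : IsClosed {x}) (c : k) :
    (residueFieldIsoBase C.str x hx).inv.hom c =
      (C.X.residue x).hom (algebraMap k (C.X.presheaf.stalk x) c) := by
  have h : (residueFieldIsoBase C.str x hx).inv = (Scheme.ΓSpecIso (CommRingCat.of k)).inv ≫
      C.str.appTop ≫ C.X.presheaf.germ ⊤ x trivial ≫ C.X.residue x := by
    apply Spec.map_injective
    rw [SpecMap_residueFieldIsoBase_inv]
    simp only [Spec.map_comp, Category.assoc, ← Scheme.fromSpecStalk_toSpecΓ]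
    rw [← Scheme.toSpecΓ_naturality_assoc C.str, ← SpecMap_ΓSpecIso_hom, ← Spec.map_comp,
      Iso.inv_hom_id, Spec.map_id, Category.comp_id]
    rfl
  have h2 : C.str.appTop = C.str.appLE ⊤ ⊤ le_top := by
    rw [Scheme.Hom.appTop, Scheme.Hom.app_eq_appLE]
    rfl
  rw [h, h2]
  rfl

/-- The value of a germ at a closed point. -/
noncomputable def stalkValue [IsAlgClosed k] {x : C.X} (hx : IsClosed {x}) :
    C.X.presheaf.stalk x →ₐ[k] k :=
  AlgHom.mk ((residueFieldIsoBase C.str x hx).hom.hom.comp (C.X.residue x).hom) fun c => by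
    change (residueFieldIsoBase C.str x hx).hom.hom ((C.X.residue x).hom _) = c
    rw [← C.residueFieldIsoBase_inv hx]
    exact congr($((residueFieldIsoBase C.str x hx).inv_hom_id).hom c)

/-- The stalk is a localization of a standard smooth chart, whose differentials are free of rank
one. -/
theorem formallySmooth_stalk (x : C.X) : Algebra.FormallySmooth k (C.X.presheaf.stalk x) ∧
    Nonempty (Ω[C.X.presheaf.stalk x⁄k] ≃ₗ[C.X.presheaf.stalk x] C.X.presheaf.stalk x) := by
  obtain ⟨V, hV, hx, h⟩ := C.exists_isStandardSmooth x
  let x' : V := ⟨x, hx⟩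
  let : Algebra Γ(C.X, V) (C.X.presheaf.stalk x) := C.X.presheaf.algebra_section_stalk x'
  have hloc : IsLocalization.AtPrime (C.X.presheaf.stalk x) (hV.primeIdealOf x').asIdeal :=
    hV.isLocalization_stalk x'
  have : IsScalarTower k Γ(C.X, V) (C.X.presheaf.stalk x) := C.isScalarTower_stalk x'
  have h1 : Algebra.IsStandardSmooth k Γ(C.X, V) :=
    Algebra.IsStandardSmoothOfRelativeDimension.isStandardSmooth 1
  have h2 : Algebra.FormallySmooth Γ(C.X, V) (C.X.presheaf.stalk x) :=
    Algebra.FormallySmooth.of_isLocalization (hV.primeIdealOf x').asIdeal.primeCompl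
  refine ⟨Algebra.FormallySmooth.comp k Γ(C.X, V) _, ?_⟩
  have : Nontrivial Γ(C.X, V) :=
    RingHom.domain_nontrivial (algebraMap Γ(C.X, V) (C.X.presheaf.stalk x))
  have h3 : Module.rank Γ(C.X, V) Ω[Γ(C.X, V)⁄k] = 1 := by
    simpa using Algebra.IsStandardSmoothOfRelativeDimension.rank_kaehlerDifferential (R := k)
      (S := Γ(C.X, V)) 1
  let b := Module.basisUnique Unit (Module.finrank_eq_of_rank_eq h3)
  have := KaehlerDifferential.isLocalizedModule_map k Γ(C.X, V) (C.X.presheaf.stalk x)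
    (hV.primeIdealOf x').asIdeal.primeCompl
  let b' := b.ofIsLocalizedModule (C.X.presheaf.stalk x) (hV.primeIdealOf x').asIdeal.primeCompl
    (KaehlerDifferential.map k k Γ(C.X, V) (C.X.presheaf.stalk x))
  exact ⟨b'.repr ≪≫ₗ Finsupp.uniqueLinearEquiv _ _ ()⟩

theorem exists_parameter [IsAlgClosed k] {x : C.X} (hx : IsClosed {x}) :
    IsDomain (C.X.presheaf.stalk x) ∧ ∃ t : C.X.presheaf.stalk x, ¬ IsNilpotent t ∧
      IsLocalRing.maximalIdeal (C.X.presheaf.stalk x) = Ideal.span {t} ∧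
      ∀ a : C.X.presheaf.stalk x, ∃ b : C.X.presheaf.stalk x,
        KaehlerDifferential.D k _ a = b • KaehlerDifferential.D k _ t := by
  obtain ⟨h1, ⟨e⟩⟩ := C.formallySmooth_stalk x
  exact exists_parameter_of_formallySmooth e (C.stalkValue hx)

theorem exists_isClosed_mem {Z : Set C.X} (hZ : IsLocallyClosed Z) (hne : Z.Nonempty) :
    ∃ x ∈ Z, IsClosed {x} :=
  nonempty_inter_closedPoints hne hZ

/-- The locus where a section has nonzero germ is locally closed, so if nonempty it contains a
closed point. The local ring there is a domain, which excludes nilpotent sections. -/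
instance [IsAlgClosed k] : IsReduced C.X := by
  constructor
  intro U
  refine ⟨fun f hf => ?_⟩
  by_contra h0
  have hne : {x : C.X | ∃ hx : x ∈ U, (C.X.presheaf.germ U x hx).hom f ≠ 0}.Nonempty := by
    by_contra hempty
    apply h0
    refine TopCat.Presheaf.section_ext C.X.sheaf U _ _ fun x hx => ?_
    by_contra h
    refine hempty ⟨x, hx, fun h2 => h ?_⟩
    exact h2.trans (map_zero (C.X.presheaf.germ U x hx).hom).symm
  have hcl : IsLocallyClosed
      {x : C.X | ∃ hx : x ∈ U, (C.X.presheaf.germ U x hx).hom f ≠ 0} := by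
    have h1 : IsOpen {x : C.X | ∃ hx : x ∈ U, (C.X.presheaf.germ U x hx).hom f = 0} := by
      rw [isOpen_iff_forall_mem_open]
      rintro x ⟨hx, h⟩
      obtain ⟨W, hxW, i, i', e⟩ := C.X.presheaf.germ_eq x hx hx f 0
        (h.trans (map_zero (C.X.presheaf.germ U x hx).hom).symm)
      refine ⟨W, fun y hy => ⟨i.le hy, ?_⟩, W.2, hxW⟩
      have h2 := C.X.presheaf.germ_res_apply i y hy f
      rw [e, map_zero, map_zero] at h2
      exact h2.symm
    have h2 : {x : C.X | ∃ hx : x ∈ U, (C.X.presheaf.germ U x hx).hom f ≠ 0} = (U : Set C.X) ∩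
        {x : C.X | ∃ hx : x ∈ U, (C.X.presheaf.germ U x hx).hom f = 0}ᶜ := by
      ext x
      constructor
      · rintro ⟨hx, h⟩
        exact ⟨hx, fun ⟨_, h'⟩ => h h'⟩
      · rintro ⟨hx, h⟩
        exact ⟨hx, fun h' => h ⟨hx, h'⟩⟩
    rw [h2]
    exact U.2.isLocallyClosed.inter h1.isClosed_compl.isLocallyClosed
  obtain ⟨x, ⟨hxU, hx⟩, hcx⟩ := C.exists_isClosed_mem hcl hne
  have := (C.exists_parameter hcx).1
  exact hx ((hf.map (C.X.presheaf.germ U x hxU).hom).eq_zero)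

/-- The local ring at a closed point is a domain, so only one irreducible component passes through
it, namely the closure of its generizations. Two distinct components would share a closed point if
they met, so the finitely many components are disjoint; connectedness leaves only one. -/
instance [IsAlgClosed k] : IrreducibleSpace C.X := by
  have hspec : ∀ x : C.X, IsClosed {x} → IsPreirreducible {y | y ⤳ x} := by
    intro x hx
    have := (C.exists_parameter hx).1
    rw [← Scheme.range_fromSpecStalk, ← Set.image_univ]
    exact (PreirreducibleSpace.isPreirreducible_univ).image _
      (C.X.fromSpecStalk x).continuous.continuousOn
  have heq : ∀ Z ∈ irreducibleComponents C.X, ∀ x ∈ Z, IsClosed {x} → Z = closure {y | y ⤳ x} := by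
    intro Z hZ x hxZ hx
    have hcl : IsClosed Z := isClosed_of_mem_irreducibleComponents Z hZ
    obtain ⟨η, hη⟩ := QuasiSober.sober hZ.1 hcl
    have hηx : η ∈ {y | y ⤳ x} := by
      rw [Set.mem_ofPred_eq, specializes_iff_mem_closure, hη.def]
      exact hxZ
    have hle : Z ⊆ closure {y | y ⤳ x} := by
      rw [← hη.def]
      exact closure_mono (Set.singleton_subset_iff.2 hηx)
    exact hle.antisymm (hZ.2 ⟨⟨η, subset_closure hηx⟩, (hspec x hx).closure⟩ hle)
  have hN : TopologicalSpace.NoetherianSpace C.X := inferInstance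
  have hfin := TopologicalSpace.NoetherianSpace.finite_irreducibleComponents (α := C.X)
  obtain ⟨x₀⟩ : Nonempty C.X := inferInstance
  set Z := irreducibleComponent x₀ with hZ
  have hZm : Z ∈ irreducibleComponents C.X := irreducibleComponent_mem_irreducibleComponents x₀
  set Z' := ⋃ W ∈ irreducibleComponents C.X \ {Z}, W with hZ'
  have hZ'c : IsClosed Z' := (hfin.subset Set.sdiff_subset).isClosed_biUnion fun W hW =>
    isClosed_of_mem_irreducibleComponents W hW.1
  have hempty : Z' = ∅ := by
    by_contra hne
    obtain ⟨y, hy⟩ := Set.nonempty_iff_ne_empty.2 hne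
    have hpre := isPreconnected_closed_iff.1 (PreconnectedSpace.isPreconnected_univ (α := C.X))
      Z Z' isClosed_irreducibleComponent hZ'c (fun x _ => by
        by_cases hx : irreducibleComponent x = Z
        · exact Or.inl (hx ▸ mem_irreducibleComponent)
        · exact Or.inr (Set.mem_biUnion (⟨irreducibleComponent_mem_irreducibleComponents x, hx⟩)
            mem_irreducibleComponent))
      ⟨x₀, trivial, mem_irreducibleComponent⟩ ⟨y, trivial, hy⟩
    rw [Set.univ_inter] at hpre
    obtain ⟨x, ⟨hxZ, hxZ'⟩, hx⟩ := C.exists_isClosed_mem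
      (isClosed_irreducibleComponent.inter hZ'c).isLocallyClosed hpre
    obtain ⟨W, hW, hxW⟩ := Set.mem_iUnion₂.1 hxZ'
    exact hW.2 ((heq W hW.1 x hxW hx).trans (heq Z hZm x hxZ hx).symm)
  have huniv : Z = Set.univ := by
    refine Set.eq_univ_of_forall fun x => ?_
    by_contra hx
    have : x ∈ Z' := Set.mem_biUnion
      (⟨irreducibleComponent_mem_irreducibleComponents x,
        fun h => hx (h ▸ mem_irreducibleComponent)⟩)
      mem_irreducibleComponent
    rw [hempty] at this
    exact this
  exact { isPreirreducible_univ := huniv ▸ isIrreducible_irreducibleComponent.2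
          toNonempty := ⟨x₀⟩ }

instance [IsAlgClosed k] : IsIntegral C.X := isIntegral_of_irreducibleSpace_of_isReduced _

end MarkedCurve

/-! ### Finiteness over the field generated by a nonconstant function -/

section FieldTheory

open IntermediateField

variable {k K : Type*} [Field k] [Field K] [Algebra k K]

open scoped IntermediateField.algebraAdjoinAdjoin in
theorem isTranscendenceBasis_singleton_of_isAlgebraic {t : K} (ht : Transcendental k t)
    [Algebra.IsAlgebraic k⟮t⟯ K] : IsTranscendenceBasis k (fun _ : Unit => t) := by
  have hind : AlgebraicIndependent k (fun _ : Unit => t) :=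
    (algebraicIndependent_singleton_iff ()).2 ht
  rw [hind.isTranscendenceBasis_iff_isAlgebraic, Set.range_const]
  exact (IsFractionRing.comap_isAlgebraic_iff (K := k⟮t⟯)).2 inferInstance

open scoped IntermediateField.algebraAdjoinAdjoin in
/-- In a finitely generated extension whose differentials are spanned by one differential, every
nonconstant element is a transcendence basis. -/
theorem finiteDimensional_adjoin_of_D_span [IsAlgClosed k] [Algebra.EssFiniteType k K] {t : K}
    (ht : Transcendental k t)
    (hspan : ∀ f, ∃ b : K, KaehlerDifferential.D k K f = b • KaehlerDifferential.D k K t) {f : K}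
    (hf : ∀ c, algebraMap k K c ≠ f) : FiniteDimensional k⟮f⟯ K := by
  -- `dt` spans the differentials over `k` and becomes zero over `k(t)`, so `K` is unramified over
  -- `k(t)`. Being essentially of finite type as well, it is finite there, and the transcendence
  -- degree over `k` is one.
  have hunr : Algebra.FormallyUnramified k⟮t⟯ K := by
    constructor
    have h0 : ∀ x : K, KaehlerDifferential.D k⟮t⟯ K x = 0 := by
      intro x
      obtain ⟨b, hb⟩ := hspan x
      have h1 := congrArg (KaehlerDifferential.map k k⟮t⟯ K K) hb
      rw [map_smul, KaehlerDifferential.map_D, KaehlerDifferential.map_D] at h1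
      have h2 : KaehlerDifferential.D k⟮t⟯ K t = 0 :=
        Derivation.map_algebraMap (KaehlerDifferential.D k⟮t⟯ K) (AdjoinSimple.gen k t)
      simpa [h2] using h1
    have h1 : (⊤ : Submodule K Ω[K⁄k⟮t⟯]) = ⊥ := by
      rw [← KaehlerDifferential.span_range_derivation, Submodule.span_eq_bot]
      rintro _ ⟨x, rfl⟩
      exact h0 x
    exact (Submodule.subsingleton_iff K).1 (subsingleton_of_bot_eq_top h1.symm)
  have := Algebra.EssFiniteType.of_comp k k⟮t⟯ K
  have hfin : Module.Finite k⟮t⟯ K := Algebra.FormallyUnramified.finite_of_free k⟮t⟯ K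
  have hb := isTranscendenceBasis_singleton_of_isAlgebraic ht
  have htr : Algebra.trdeg k K = 1 := by
    have := hb.lift_cardinalMk_eq_trdeg
    simpa [eq_comm] using this
  have hft : Transcendental k f := by
    intro h
    obtain ⟨c, hc⟩ := (IsAlgClosed.algebraMap_bijective_of_isIntegral
      (k := k) (K := algebraicClosure k K)).2 ⟨f, mem_algebraicClosure_iff.2 h⟩
    exact hf c (congrArg Subtype.val hc)
  have hind : AlgebraicIndependent k (fun _ : PUnit => f) :=
    (algebraicIndependent_singleton_iff PUnit.unit).2 hft
  have hb' := hind.isTranscendenceBasis_of_trdeg_le (by simp [htr]) (by simp [htr])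
  have h1 := hb'.isAlgebraic
  rw [Set.range_const] at h1
  have h2 : Algebra.IsAlgebraic k⟮f⟯ K := (IsFractionRing.comap_isAlgebraic_iff (K := k⟮f⟯)).1 h1
  have := Algebra.EssFiniteType.of_comp k k⟮f⟯ K
  exact Algebra.finite_of_essFiniteType_of_isAlgebraic

end FieldTheory

/-! ### The function field, with closed points as places -/

namespace MarkedCurve

variable {k : Type u} [Field k] [IsAlgClosed k] {r : ℕ} (C : MarkedCurve k r)

/-- The function field of the curve. -/
abbrev K : Type u := C.X.functionField

/-- The closed points of the curve. -/
@[ext]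
structure Point : Type u where
  pt : C.X
  isClosed : IsClosed {pt}

variable {C}

theorem Point.exists_mem {U : C.X.Opens} (hU : (U : Set C.X).Nonempty) :
    ∃ P : C.Point, P.1 ∈ U := by
  obtain ⟨x, hx, h⟩ := C.exists_isClosed_mem U.2.isLocallyClosed hU
  exact ⟨⟨x, h⟩, hx⟩

variable (C) in
/-- The value of a function on a nonempty open subset in the function field. -/
noncomputable def toK (U : C.X.Opens) [Nonempty U] : Γ(C.X, U) →ₐ[k] C.K :=
  AlgHom.mk (C.X.germToFunctionField U).hom fun c => C.germ_algebraMap _ c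

theorem toK_injective (U : C.X.Opens) [Nonempty U] : Function.Injective (C.toK U) :=
  Scheme.germToFunctionField_injective _ _

theorem toK_res {U V : C.X.Opens} [Nonempty U] [Nonempty V] (h : V ≤ U) (f : Γ(C.X, U)) :
    C.toK V (C.res h f) = C.toK U f :=
  C.X.presheaf.germ_res_apply (homOfLE h) _ _ f

instance isScalarTower_stalk_K (x : C.X) : IsScalarTower k (C.X.presheaf.stalk x) C.K := by
  refine IsScalarTower.of_algebraMap_eq fun c => ?_
  have : Nonempty (⊤ : C.X.Opens) := ⟨⟨x, trivial⟩⟩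
  rw [← C.germ_algebraMap (U := ⊤) (x := x) trivial]
  exact ((C.toK ⊤).commutes c).symm.trans
    (Scheme.algebraMap_germ_eq_germToFunctionField C.X (U := ⊤) (x := x) trivial _).symm

theorem toK_eq_algebraMap_germ {U : C.X.Opens} [Nonempty U] {x : C.X} (hx : x ∈ U)
    (f : Γ(C.X, U)) :
    C.toK U f = algebraMap (C.X.presheaf.stalk x) C.K ((C.X.presheaf.germ U x hx).hom f) :=
  (Scheme.algebraMap_germ_eq_germToFunctionField C.X hx f).symm

/-- A rational function which is regular at every closed point of `U` is a function on `U`. -/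
theorem exists_toK_eq {U : C.X.Opens} [Nonempty U] {f : C.K}
    (hf : ∀ P : C.Point, P.1 ∈ U → ∃ a, algebraMap (C.X.presheaf.stalk P.1) C.K a = f) :
    ∃ s, C.toK U s = f := by
  let ι := {P : C.Point // P.1 ∈ U}
  have hloc : ∀ P : ι, ∃ (V : C.X.Opens) (hV : V ≤ U) (hP : P.1.1 ∈ V) (s : Γ(C.X, V)),
      haveI : Nonempty V := ⟨⟨_, hP⟩⟩
      C.toK V s = f := by
    rintro ⟨P, hP⟩
    obtain ⟨a, ha⟩ := hf P hP
    obtain ⟨V, hV, s, rfl⟩ := C.X.presheaf.exists_germ_eq a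
    refine ⟨V ⊓ U, inf_le_right, ⟨hV, hP⟩, C.res inf_le_left s, ?_⟩
    have : Nonempty V := ⟨⟨_, hV⟩⟩
    have : Nonempty (V ⊓ U : C.X.Opens) := ⟨⟨_, hV, hP⟩⟩
    rw [toK_res, ← ha, toK_eq_algebraMap_germ hV]
  choose V hVU hPV s hs using hloc
  -- Every nonempty locally closed subset contains a closed point, so neighbourhoods of the closed
  -- points of `U` cover `U`.
  have hcov : U ≤ iSup V := by
    intro x hx
    by_contra hxV
    obtain ⟨y, ⟨hyU, hyV⟩, hy⟩ := C.exists_isClosed_mem (Z := (U : Set C.X) ∩ (iSup V : C.X.Opens)ᶜ)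
      (U.2.isLocallyClosed.inter (iSup V).2.isClosed_compl.isLocallyClosed) ⟨x, hx, hxV⟩
    exact hyV (TopologicalSpace.Opens.mem_iSup.2 ⟨⟨⟨y, hy⟩, hyU⟩, hPV _⟩)
  obtain ⟨a, ha, -⟩ := C.X.sheaf.existsUnique_gluing' V U (fun i => homOfLE (hVU i)) hcov s (by
    intro i j
    have hi : genericPoint C.X ∈ V i :=
      ((genericPoint_spec C.X).mem_open_set_iff (V i).2).2 ⟨_, trivial, hPV i⟩
    have hj : genericPoint C.X ∈ V j :=
      ((genericPoint_spec C.X).mem_open_set_iff (V j).2).2 ⟨_, trivial, hPV j⟩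
    have h1 : Nonempty (V i) := ⟨⟨_, hi⟩⟩
    have h2 : Nonempty (V j) := ⟨⟨_, hj⟩⟩
    have h3 : Nonempty (V i ⊓ V j : C.X.Opens) := ⟨⟨_, hi, hj⟩⟩
    apply toK_injective (V i ⊓ V j)
    exact (toK_res (inf_le_left : V i ⊓ V j ≤ V i) (s i)).trans ((hs i).trans
      ((hs j).symm.trans (toK_res (inf_le_right : V i ⊓ V j ≤ V j) (s j)).symm)))
  obtain ⟨x, hx⟩ := ‹Nonempty U›
  obtain ⟨P, hP⟩ := Point.exists_mem (U := U) ⟨x, hx⟩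
  refine ⟨a, ?_⟩
  have : Nonempty (V ⟨P, hP⟩) := ⟨⟨_, hPV _⟩⟩
  exact (toK_res (hVU ⟨P, hP⟩) a).symm.trans ((congrArg _ (ha ⟨P, hP⟩)).trans (hs _))

instance (P : C.Point) : IsDiscreteValuationRing (C.X.presheaf.stalk P.1) := by
  obtain ⟨hdom, t, ht, hspan, -⟩ := C.exists_parameter P.2
  have hf : ¬ IsField (C.X.presheaf.stalk P.1) := by
    intro hf
    rw [IsLocalRing.isField_iff_maximalIdeal_eq, hspan, Ideal.span_singleton_eq_bot] at hf
    exact ht (hf ▸ IsNilpotent.zero)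
  have h : Submodule.IsPrincipal (IsLocalRing.maximalIdeal (C.X.presheaf.stalk P.1)) := ⟨t, hspan⟩
  exact ((IsDiscreteValuationRing.TFAE (C.X.presheaf.stalk P.1) hf).out 0 4).2 h

/-- The place of the function field given by a closed point. -/
noncomputable def Point.place (P : C.Point) : RationalPlace k C.K :=
  RationalPlace.ofDVR k (C.X.presheaf.stalk P.1) C.K (C.stalkValue P.2)

theorem Point.mem_place_ring_iff (P : C.Point) (f : C.K) :
    f ∈ P.place.ring ↔ ∃ a, algebraMap (C.X.presheaf.stalk P.1) C.K a = f := by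
  by_cases hf : f = 0
  · subst hf
    exact ⟨fun _ => ⟨0, map_zero _⟩, fun _ => zero_mem _⟩
  · rw [← IsDiscreteValuationRing.log_valuation_nonpos_iff hf]
    refine ⟨fun h => ?_, fun h _ => ?_⟩
    · have := h hf
      change 0 ≤ -_ at this
      omega
    · change 0 ≤ -_
      omega

/-- Such an `f` is a global function; by properness these are finite over `k`, which is
algebraically closed. -/
theorem exists_const_of_forall_mem_ring {f : C.K} (hf : ∀ P : C.Point, f ∈ P.place.ring) :
    ∃ c : k, algebraMap k C.K c = f := by
  have : Nonempty (⊤ : C.X.Opens) := ⟨⟨genericPoint C.X, trivial⟩⟩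
  obtain ⟨s, hs⟩ := exists_toK_eq (U := ⊤) (fun P _ => (P.mem_place_ring_iff f).1 (hf P))
  have h2 : C.str.appTop = C.str.appLE ⊤ ⊤ le_top := by
    rw [Scheme.Hom.appTop, Scheme.Hom.app_eq_appLE]
    rfl
  have hfin : (algebraMap k Γ(C.X, ⊤)).Finite :=
    RingHom.Finite.comp (h2 ▸ finite_appTop_of_universallyClosed k C.str)
      (RingHom.Finite.of_surjective _ (Scheme.ΓSpecIso
        (CommRingCat.of k)).symm.commRingCatIsoToRingEquiv.surjective)
  have : Module.Finite k Γ(C.X, ⊤) := hfin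
  obtain ⟨c, hc⟩ := (IsAlgClosed.algebraMap_bijective_of_isIntegral (k := k)).2 s
  exact ⟨c, by rw [← hs, ← hc, AlgHom.commutes]⟩

/-- Uniqueness in the valuative criterion. The inclusion of local rings gives a second map from Spec
𝒪_Q to the curve, through Spec 𝒪_P. It agrees with the canonical map at the generic point, hence
everywhere by separatedness. So `Q` specializes to `P`, and `Q` is closed. -/
theorem eq_of_ring_le {P Q : C.Point} (h : ∀ f, f ∈ P.place.ring → f ∈ Q.place.ring) : P = Q := by
  have hinj := IsFractionRing.injective (C.X.presheaf.stalk Q.1) C.K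
  let e := RingEquiv.ofBijective (algebraMap (C.X.presheaf.stalk Q.1) C.K).rangeRestrict
    ⟨fun a b hab => hinj (congrArg Subtype.val hab),
      RingHom.rangeRestrict_surjective _⟩
  let φ : C.X.presheaf.stalk P.1 →+* C.X.presheaf.stalk Q.1 :=
    e.symm.toRingHom.comp ((algebraMap (C.X.presheaf.stalk P.1) C.K).codRestrict _ fun a =>
      (Q.mem_place_ring_iff _).1 (h _ ((P.mem_place_ring_iff _).2 ⟨a, rfl⟩)))
  have hφ : ∀ a, algebraMap (C.X.presheaf.stalk Q.1) C.K (φ a) =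
      algebraMap (C.X.presheaf.stalk P.1) C.K a := fun a =>
    congrArg Subtype.val (e.apply_symm_apply _)
  have hη : ∀ x, genericPoint C.X ⤳ x := fun x => (genericPoint_spec C.X).specializes trivial
  have hdom : IsDominant (Spec.map (C.X.presheaf.stalkSpecializes (hη Q.1))) := by
    constructor
    refine (PrimeSpectrum.denseRange_comap_iff_ker_le_nilRadical _).2 ?_
    exact ((RingHom.injective_iff_ker_eq_bot _).1 hinj).le.trans bot_le
  have hsep : IsSeparated (Limits.terminal.from C.X) := by
    have : Limits.terminal.from C.X = C.str ≫ Limits.terminal.from _ :=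
      Limits.terminal.hom_ext _ _
    rw [this]
    infer_instance
  have heq : Spec.map (CommRingCat.ofHom φ) ≫ C.X.fromSpecStalk P.1 = C.X.fromSpecStalk Q.1 := by
    refine ext_of_isDominant_of_isSeparated (Limits.terminal.from C.X)
      (Limits.terminal.hom_ext _ _) (Spec.map (C.X.presheaf.stalkSpecializes (hη Q.1))) ?_
    rw [Scheme.SpecMap_stalkSpecializes_fromSpecStalk, ← Category.assoc, ← Spec.map_comp]
    have : CommRingCat.ofHom φ ≫ C.X.presheaf.stalkSpecializes (hη Q.1) =
        C.X.presheaf.stalkSpecializes (hη P.1) := by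
      ext a
      exact hφ a
    rw [this, Scheme.SpecMap_stalkSpecializes_fromSpecStalk]
  have hmem : Q.1 ∈ Set.range (C.X.fromSpecStalk P.1) := by
    refine ⟨Spec.map (CommRingCat.ofHom φ) (IsLocalRing.closedPoint _), ?_⟩
    refine (Scheme.Hom.comp_apply _ _ _).symm.trans ?_
    rw [heq]
    exact Scheme.fromSpecStalk_closedPoint
  rw [Scheme.range_fromSpecStalk, Set.mem_ofPred_eq, specializes_iff_mem_closure,
    Q.2.closure_eq] at hmem
  exact Point.ext hmem

theorem isScalarTower_toK (U : C.X.Opens) [Nonempty U] : IsScalarTower k Γ(C.X, U) C.K :=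
  IsScalarTower.of_algebraMap_eq fun c => ((C.toK U).commutes c).symm

instance : Algebra.EssFiniteType k C.K := by
  obtain ⟨V, hV, hx, h⟩ := C.exists_isStandardSmooth (genericPoint C.X)
  have : Nonempty V := ⟨⟨_, hx⟩⟩
  have h1 : Algebra.IsStandardSmooth k Γ(C.X, V) :=
    Algebra.IsStandardSmoothOfRelativeDimension.isStandardSmooth 1
  have h2 := functionField_isFractionRing_of_isAffineOpen C.X V hV
  have h3 := isScalarTower_toK V
  have h4 : Algebra.EssFiniteType Γ(C.X, V) C.K :=
    Algebra.EssFiniteType.of_isLocalization C.K (nonZeroDivisors Γ(C.X, V))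
  exact Algebra.EssFiniteType.comp k Γ(C.X, V) C.K

theorem Point.exists_parameter (P : C.Point) : ∃ t : P.place.ring, (t : C.K) ≠ 0 ∧
    P.place.ord t = 1 ∧ ∀ a : P.place.ring, ∃ b : P.place.ring,
      KaehlerDifferential.D k _ a = b • KaehlerDifferential.D k _ t := by
  obtain ⟨-, t, ht, hspan, hD⟩ := C.exists_parameter P.2
  have ht0 : t ≠ 0 := by rintro rfl; exact ht IsNilpotent.zero
  let φ : C.X.presheaf.stalk P.1 →ₐ[k] P.place.ring :=
    (IsScalarTower.toAlgHom k (C.X.presheaf.stalk P.1) C.K).codRestrict P.place.ring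
      fun a => (P.mem_place_ring_iff _).2 ⟨a, rfl⟩
  have hφ : ∀ a, (φ a : C.K) = algebraMap (C.X.presheaf.stalk P.1) C.K a := fun a => rfl
  refine ⟨φ t, ?_, ?_, fun a => ?_⟩
  · rw [hφ]
    simpa using ht0
  · rw [hφ]
    change -((IsDiscreteValuationRing.maximalIdeal _).valuation C.K _).log = 1
    rw [IsDedekindDomain.HeightOneSpectrum.valuation_of_algebraMap,
      IsDedekindDomain.HeightOneSpectrum.intValuation_singleton _ ht0 hspan]
    simp
  · obtain ⟨a', ha'⟩ := (P.mem_place_ring_iff _).1 a.2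
    obtain rfl : φ a' = a := Subtype.ext ha'
    obtain ⟨b, hb⟩ := hD a'
    algebraize [φ.toRingHom]
    have : IsScalarTower k (C.X.presheaf.stalk P.1) P.place.ring :=
      IsScalarTower.of_algebraMap_eq fun c => (φ.commutes c).symm
    have h1 := congrArg (KaehlerDifferential.map k k (C.X.presheaf.stalk P.1) P.place.ring) hb
    rw [map_smul, KaehlerDifferential.map_D, KaehlerDifferential.map_D] at h1
    exact ⟨φ b, h1.trans (algebraMap_smul P.place.ring b _).symm⟩

variable (C) in
/-- The places of the function field. -/
noncomputable def complete : CompleteCurve k C.K C.Point where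
  place := Point.place
  separates P Q hPQ := by
    by_contra! h
    refine hPQ (eq_of_ring_le fun f hf hf0 => h f hf0 (hf hf0))
  exists_const f hf0 hf := exists_const_of_forall_mem_ring fun P _ => hf P
  finite f hf := by
    obtain ⟨P, -⟩ := Point.exists_mem (C := C) (U := ⊤) ⟨genericPoint C.X, trivial⟩
    obtain ⟨t, ht0, ht, hD⟩ := P.exists_parameter
    exact finiteDimensional_adjoin_of_D_span
      (RationalPlace.transcendental P.place ht0 (by rw [ht]; simp))
      (fun f => KaehlerDifferential.D_eq_smul_of_D_eq
        (RationalPlace.mem_ring_or_inv_mem_ring _) hD f) hf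

variable (C) in
/-- Local parameters in the closed points. -/
noncomputable def parameters : C.complete.Parameters where
  t P := P.exists_parameter.choose
  t_ne_zero P := P.exists_parameter.choose_spec.1
  ord_t P := P.exists_parameter.choose_spec.2.1
  exists_D_eq P := P.exists_parameter.choose_spec.2.2

end MarkedCurve

/-! ### Vector fields as rational functions -/

namespace MarkedCurve

variable {k : Type u} [Field k] [IsAlgClosed k] {r : ℕ} {C : MarkedCurve k r}

variable (C) in
/-- A trivialization of the differentials of the function field. -/
noncomputable def diffEquiv : Ω[C.K⁄k] ≃ₗ[C.K] C.K :=
  (C.formallySmooth_stalk (genericPoint C.X)).2.some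

variable (C) in
/-- A generator of the derivations of the function field. -/
noncomputable def vf : Derivation k C.K C.K :=
  C.diffEquiv.toLinearMap.compDer (KaehlerDifferential.D k C.K)

theorem vf_ne_zero : C.vf ≠ 0 := by
  intro h
  have h1 : (⊤ : Submodule C.K Ω[C.K⁄k]) ≤ LinearMap.ker C.diffEquiv.toLinearMap := by
    rw [← KaehlerDifferential.span_range_derivation, Submodule.span_le]
    rintro _ ⟨f, rfl⟩
    exact DFunLike.congr_fun h f
  have h2 : C.diffEquiv (C.diffEquiv.symm 1) = 0 := h1 (x := C.diffEquiv.symm 1) trivial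
  simp at h2

section VectorFields

variable {U : C.X.Opens} [Nonempty U]

theorem isFractionRing_toK (hU : IsAffineOpen U) : IsFractionRing Γ(C.X, U) C.K :=
  functionField_isFractionRing_of_isAffineOpen C.X U hU

theorem exists_vf_toK_ne_zero (hU : IsAffineOpen U) : ∃ f : Γ(C.X, U), C.vf (C.toK U f) ≠ 0 := by
  by_contra! h
  have := isFractionRing_toK hU
  apply vf_ne_zero (C := C)
  ext f
  obtain ⟨a, b, hb, rfl⟩ := IsFractionRing.div_surjective (A := Γ(C.X, U)) f
  have ha : C.vf (algebraMap Γ(C.X, U) C.K a) = 0 := h a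
  have hb : C.vf (algebraMap Γ(C.X, U) C.K b) = 0 := h b
  rw [Derivation.leibniz_div, ha, hb]
  simp

/-- A derivation of functions on an affine open subset extends to `K`, and the derivations of `K`
over `k` form a line spanned by `vf`. -/
theorem exists_theta (hU : IsAffineOpen U) (D : Derivation k Γ(C.X, U) Γ(C.X, U)) :
    ∃ θ : C.K, ∀ f, C.toK U (D f) = θ * C.vf (C.toK U f) := by
  have := isFractionRing_toK hU
  have := isScalarTower_toK U
  let l : Ω[Γ(C.X, U)⁄k] →ₗ[Γ(C.X, U)] C.K :=
    Algebra.linearMap Γ(C.X, U) C.K ∘ₗ D.liftKaehlerDifferential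
  have hloc := KaehlerDifferential.isLocalizedModule_map k Γ(C.X, U) C.K
    (nonZeroDivisors Γ(C.X, U))
  let L := IsLocalizedModule.lift (nonZeroDivisors Γ(C.X, U))
    (KaehlerDifferential.map k k Γ(C.X, U) C.K) l
    (fun s => IsLocalizedModule.map_units (Algebra.linearMap Γ(C.X, U) C.K) s)
  let L' : Ω[C.K⁄k] →ₗ[C.K] C.K :=
    LinearMap.extendScalarsOfIsLocalization (nonZeroDivisors Γ(C.X, U)) C.K L
  refine ⟨L' (C.diffEquiv.symm 1), fun f => ?_⟩
  have h1 : L (KaehlerDifferential.D k C.K (algebraMap Γ(C.X, U) C.K f)) = C.toK U (D f) := by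
    rw [← KaehlerDifferential.map_D k k]
    refine (IsLocalizedModule.lift_apply _ _ _ _ _).trans ?_
    simp only [l, LinearMap.comp_apply, Derivation.liftKaehlerDifferential_comp_D]
    rfl
  have h2 : ∀ w, L' w = L' (C.diffEquiv.symm 1) * C.diffEquiv w := by
    intro w
    rw [mul_comm, ← smul_eq_mul, ← map_smul]
    congr 1
    apply C.diffEquiv.injective
    simp
  rw [← h1]
  exact h2 _

/-- The coefficient of a vector field with respect to the generator `vf`. -/
noncomputable def theta (hU : IsAffineOpen U) (D : Derivation k Γ(C.X, U) Γ(C.X, U)) : C.K :=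
  (exists_theta hU D).choose

theorem toK_apply (hU : IsAffineOpen U) (D : Derivation k Γ(C.X, U) Γ(C.X, U)) (f : Γ(C.X, U)) :
    C.toK U (D f) = theta hU D * C.vf (C.toK U f) :=
  (exists_theta hU D).choose_spec f

theorem theta_eq_of_forall (hU : IsAffineOpen U) {D : Derivation k Γ(C.X, U) Γ(C.X, U)} {θ : C.K}
    (h : ∀ f, C.toK U (D f) = θ * C.vf (C.toK U f)) : theta hU D = θ := by
  obtain ⟨f, hf⟩ := exists_vf_toK_ne_zero hU
  exact mul_right_cancel₀ hf ((toK_apply hU D f).symm.trans (h f))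

theorem theta_injective (hU : IsAffineOpen U) :
    Function.Injective (theta (C := C) hU) := by
  intro D D' h
  ext f
  apply toK_injective U
  rw [toK_apply hU, toK_apply hU, h]

theorem theta_smul (hU : IsAffineOpen U) (f : Γ(C.X, U)) (D : Derivation k Γ(C.X, U) Γ(C.X, U)) :
    theta hU (f • D) = C.toK U f * theta hU D :=
  theta_eq_of_forall hU fun g => by
    rw [Derivation.smul_apply, smul_eq_mul, map_mul, toK_apply hU]; ring

theorem res_apply_of_theta_eq {V : C.X.Opens} [Nonempty V] (hU : IsAffineOpen U)
    (hV : IsAffineOpen V) (h : V ≤ U) {D : Derivation k Γ(C.X, U) Γ(C.X, U)}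
    {D' : Derivation k Γ(C.X, V) Γ(C.X, V)} (hD : theta hV D' = theta hU D) (f : Γ(C.X, U)) :
    D' (C.res h f) = C.res h (D f) := by
  apply toK_injective V
  rw [toK_apply hV, hD, toK_res, toK_res, toK_apply hU]

end VectorFields

theorem Point.mem_place_ge_one_iff (P : C.Point) (a : C.X.presheaf.stalk P.pt) :
    algebraMap (C.X.presheaf.stalk P.pt) C.K a ∈ P.place.ge 1 ↔
      a ∈ IsLocalRing.maximalIdeal (C.X.presheaf.stalk P.pt) := by
  by_cases ha : a = 0
  · subst ha
    rw [map_zero]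
    exact ⟨fun _ => zero_mem _, fun _ => zero_mem _⟩
  have h0 : algebraMap (C.X.presheaf.stalk P.pt) C.K a ≠ 0 := by simpa using ha
  constructor
  · intro h
    have h1 := h h0
    by_contra hu
    have hu : IsUnit a := by simpa using hu
    obtain ⟨b, hb⟩ := hu.exists_right_inv
    have hb0 : algebraMap (C.X.presheaf.stalk P.pt) C.K b ≠ 0 := by
      intro h
      have := congrArg (algebraMap (C.X.presheaf.stalk P.pt) C.K) hb
      rw [map_mul, h, mul_zero, map_one] at this
      exact zero_ne_one this
    have h2 : 0 ≤ P.place.ord (algebraMap (C.X.presheaf.stalk P.pt) C.K b) :=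
      (P.mem_place_ring_iff _).2 ⟨b, rfl⟩ hb0
    have h3 := P.place.ord_mul h0 hb0
    rw [← map_mul, hb, map_one, P.place.ord_one] at h3
    omega
  · intro h _
    have := IsDiscreteValuationRing.log_valuation_neg (K := C.K) ha h
    change 1 ≤ -_
    omega

theorem toK_mem_ring {U : C.X.Opens} [Nonempty U] {P : C.Point} (hP : P.pt ∈ U) (f : Γ(C.X, U)) :
    C.toK U f ∈ P.place.ring :=
  (P.mem_place_ring_iff _).2 ⟨_, (toK_eq_algebraMap_germ hP f).symm⟩

theorem evaluation_eq_zero_iff {U : C.X.Opens} [Nonempty U] {P : C.Point} (hP : P.pt ∈ U)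
    (f : Γ(C.X, U)) :
    (C.X.evaluation U P.pt hP).hom f = 0 ↔ C.toK U f ∈ P.place.ge 1 := by
  rw [toK_eq_algebraMap_germ hP, P.mem_place_ge_one_iff]
  exact IsLocalRing.residue_eq_zero_iff _

theorem exists_eq_div {U : C.X.Opens} [Nonempty U] (hU : IsAffineOpen U) {P : C.Point}
    (hP : P.pt ∈ U) {f : C.K} (hf : f ∈ P.place.ring) :
    ∃ a s : Γ(C.X, U), C.toK U s ≠ 0 ∧ P.place.ord (C.toK U s) = 0 ∧
      f = C.toK U a / C.toK U s := by
  obtain ⟨g, rfl⟩ := (P.mem_place_ring_iff f).1 hf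
  let x : U := ⟨P.pt, hP⟩
  let : Algebra Γ(C.X, U) (C.X.presheaf.stalk P.pt) := C.X.presheaf.algebra_section_stalk x
  have hloc : IsLocalization.AtPrime (C.X.presheaf.stalk P.pt) (hU.primeIdealOf x).asIdeal :=
    hU.isLocalization_stalk x
  obtain ⟨a, s, rfl⟩ := IsLocalization.exists_mk'_eq (hU.primeIdealOf x).asIdeal.primeCompl g
  have hs : IsUnit ((C.X.presheaf.germ U P.pt hP).hom s.1) := IsLocalization.map_units _ s
  have hs0 : C.toK U s.1 ≠ 0 := by
    rw [toK_eq_algebraMap_germ hP]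
    exact (hs.map _).ne_zero
  refine ⟨a, s.1, hs0, ?_, ?_⟩
  · have h1 : 0 ≤ P.place.ord (C.toK U s.1) := toK_mem_ring hP _ hs0
    have h2 : ¬ C.toK U s.1 ∈ P.place.ge 1 := by
      rw [toK_eq_algebraMap_germ hP, P.mem_place_ge_one_iff]
      simpa using hs
    have h3 : ¬ 1 ≤ P.place.ord (C.toK U s.1) := fun h => h2 fun _ => h
    omega
  · rw [eq_div_iff hs0, toK_eq_algebraMap_germ hP, toK_eq_algebraMap_germ hP, ← map_mul]
    exact congrArg _ (IsLocalization.mk'_spec _ a s)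

/-- The vector field `θ • vf` is defined at the closed point `P`, and vanishes there if `P` is
marked. -/
def IsLogAt (P : C.Point) (θ : C.K) : Prop :=
  ∀ f ∈ P.place.ring, θ * C.vf f ∈ P.place.ring ∧
    ∀ i, C.pt i = P.pt → θ * C.vf f ∈ P.place.ge 1

/-- Germs at `P` are quotients of functions on `U`, and the quotient rule preserves both regularity
and vanishing at `P`. -/
theorem isLogAt_theta {U : C.X.Opens} [Nonempty U] (hU : IsAffineOpen U) (D : C.logVF U)
    {P : C.Point} (hP : P.pt ∈ U) : IsLogAt P (theta hU D.1) := by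
  intro f hf
  obtain ⟨a, s, hs0, hs, rfl⟩ := exists_eq_div hU hP hf
  have hinv : (C.toK U s ^ 2)⁻¹ ∈ P.place.ge 0 := fun _ => by
    rw [P.place.ord_inv (pow_ne_zero _ hs0), P.place.ord_pow hs0, hs]; simp
  have h1 : theta hU D.1 * C.vf (C.toK U a / C.toK U s) =
      C.toK U (s * D.1 a - a * D.1 s) * (C.toK U s ^ 2)⁻¹ := by
    rw [Derivation.leibniz_div, map_sub, map_mul, map_mul, toK_apply hU, toK_apply hU]
    simp only [smul_eq_mul]
    field_simp
  rw [h1]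
  refine ⟨?_, fun i hi => ?_⟩
  · exact P.place.ring.mul_mem (toK_mem_ring hP _) hinv
  · have h2 : C.toK U (s * D.1 a - a * D.1 s) ∈ P.place.ge 1 := by
      rw [← evaluation_eq_zero_iff hP]
      have h3 : ∀ f, (C.X.evaluation U P.pt hP).hom (D.1 f) = 0 := by
        obtain ⟨p, hp⟩ := P
        subst hi
        exact D.2 i hP
      rw [map_sub, map_mul, map_mul, h3, h3]
      simp
    have := RationalPlace.mul_mem_ge h2 hinv
    rwa [add_zero] at this

/-- `θ * vf f` is regular at every closed point of `U`, so it is a function on `U`. -/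
theorem exists_logVF_theta_eq {U : C.X.Opens} [Nonempty U] (hU : IsAffineOpen U) {θ : C.K}
    (h : ∀ P : C.Point, P.pt ∈ U → IsLogAt P θ) : ∃ D : C.logVF U, theta hU D.1 = θ := by
  have hex : ∀ f : Γ(C.X, U), ∃ g, C.toK U g = θ * C.vf (C.toK U f) := fun f =>
    exists_toK_eq fun P hP => (P.mem_place_ring_iff _).1 (h P hP _ (toK_mem_ring hP f)).1
  choose d hd using hex
  let D : Derivation k Γ(C.X, U) Γ(C.X, U) := Derivation.mk'
    { toFun := d
      map_add' := fun f g => by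
        apply toK_injective U
        rw [map_add, hd, hd, hd, map_add, map_add, mul_add]
      map_smul' := fun c f => by
        apply toK_injective U
        rw [RingHom.id_apply, map_smul, hd, hd, map_smul, Derivation.map_smul, mul_smul_comm] }
    (fun f g => by
      apply toK_injective U
      change C.toK U (d _) = C.toK U (f • d g + g • d f)
      rw [map_add, smul_eq_mul, smul_eq_mul, map_mul, map_mul, hd, hd, hd, map_mul,
        Derivation.leibniz]
      simp only [smul_eq_mul]
      ring)
  refine ⟨⟨D, fun i hi f => ?_⟩, theta_eq_of_forall hU hd⟩
  exact (evaluation_eq_zero_iff (P := ⟨C.pt i, C.isClosed_pt i⟩) hi _).2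
    ((hd f) ▸ (h ⟨C.pt i, C.isClosed_pt i⟩ hi _ (toK_mem_ring hi f)).2 i rfl)

/-- Restriction of vector fields. -/
theorem exists_restrict_logVF {U V : C.X.Opens} [Nonempty U] [Nonempty V] (hU : IsAffineOpen U)
    (hV : IsAffineOpen V) (h : V ≤ U) (D : C.logVF U) :
    ∃ D' : C.logVF V, theta hV D'.1 = theta hU D.1 :=
  exists_logVF_theta_eq hV fun _ hP => isLogAt_theta hU D (h hP)

/-- The vector field is evaluated on the local parameter. -/
theorem IsLogAt.le_ord {P : C.Point} {θ : C.K} (h : IsLogAt P θ) (hθ : θ ≠ 0) :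
    -C.complete.ord P (C.vf (C.parameters.t P)) ≤ C.complete.ord P θ ∧ ∀ i, C.pt i = P.pt →
      -C.complete.ord P (C.vf (C.parameters.t P)) + 1 ≤ C.complete.ord P θ := by
  have h0 := C.parameters.derivation_t_ne_zero vf_ne_zero P
  have h1 := h _ (C.parameters.t P).2
  have h2 : P.place.ord (θ * C.vf (C.parameters.t P)) = P.place.ord θ + P.place.ord _ :=
    P.place.ord_mul hθ h0
  refine ⟨?_, fun i hi => ?_⟩
  · have := h1.1 (mul_ne_zero hθ h0)
    change -P.place.ord _ ≤ P.place.ord _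
    linarith
  · have := h1.2 i hi (mul_ne_zero hθ h0)
    change -P.place.ord _ + 1 ≤ P.place.ord _
    linarith

end MarkedCurve

/-! ### Restriction, gluing and frames for sheaves of modules -/

section Restriction

variable {X : Scheme.{u}} {M : X.Modules} {U V W : X.Opens}

theorem resSection_add (h : V ≤ U) (s t : Γ(M, U)) :
    resSection M h (s + t) = resSection M h s + resSection M h t :=
  map_add _ _ _

theorem resSection_smul (h : V ≤ U) (f : Γ(X, U)) (s : Γ(M, U)) :
    resSection M h (f • s) = (X.presheaf.map (homOfLE h).op).hom f • resSection M h s :=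
  Scheme.Modules.map_smul M (homOfLE h) f s

theorem resSection_sum {ι : Type*} (h : V ≤ U) (t : Finset ι) (s : ι → Γ(M, U)) :
    resSection M h (∑ i ∈ t, s i) = ∑ i ∈ t, resSection M h (s i) :=
  map_sum (M.presheaf.map (homOfLE h).op).hom s t

theorem resSection_resSection (h : V ≤ U) (h' : W ≤ V) (s : Γ(M, U)) :
    resSection M h' (resSection M h s) = resSection M (h'.trans h) s := by
  have := M.presheaf.map_comp (homOfLE h).op (homOfLE h').op
  exact congr($(this.symm) s)

theorem eq_of_resSection_eq {s t : Γ(M, U)}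
    (h : ∀ x ∈ U, ∃ (V : X.Opens) (hV : V ≤ U), x ∈ V ∧ resSection M hV s = resSection M hV t) :
    s = t := by
  choose V hV hx heq using h
  let 𝓜 : TopCat.Sheaf Ab X := ⟨M.presheaf, M.isSheaf⟩
  refine 𝓜.eq_of_locally_eq' (fun x : U => V x.1 x.2) U (fun x => homOfLE (hV x.1 x.2)) ?_ s t ?_
  · intro x hx'
    exact TopologicalSpace.Opens.mem_iSup.2 ⟨⟨x, hx'⟩, hx x hx'⟩
  · exact fun x => heq x.1 x.2

theorem exists_resSection_eq {ι : Type u} {V : ι → X.Opens} (hV : ∀ i, V i ≤ U)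
    (hU : U ≤ iSup V) (s : ∀ i, Γ(M, V i))
    (hs : ∀ i j, resSection M (inf_le_left : V i ⊓ V j ≤ V i) (s i) =
      resSection M inf_le_right (s j)) :
    ∃ t : Γ(M, U), ∀ i, resSection M (hV i) t = s i := by
  let 𝓜 : TopCat.Sheaf Ab X := ⟨M.presheaf, M.isSheaf⟩
  obtain ⟨t, ht, -⟩ := 𝓜.existsUnique_gluing' V U (fun i => homOfLE (hV i)) hU s hs
  exact ⟨t, ht⟩

/-- The basis of the sections given by a frame. -/
noncomputable def IsFrame.basis {n : ℕ} {b : Fin n → Γ(M, U)} (hb : IsFrame M U b) (h : V ≤ U) :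
    Module.Basis (Fin n) Γ(X, V) Γ(M, V) :=
  .mk (hb V h).1 (hb V h).2.ge

theorem IsFrame.basis_apply {n : ℕ} {b : Fin n → Γ(M, U)} (hb : IsFrame M U b) (h : V ≤ U)
    (j : Fin n) : hb.basis h j = resSection M h (b j) :=
  Module.Basis.mk_apply _ _ j

theorem IsFrame.eq_sum {n : ℕ} {b : Fin n → Γ(M, U)} (hb : IsFrame M U b) (h : V ≤ U)
    (s : Γ(M, V)) : s = ∑ j, (hb.basis h).repr s j • resSection M h (b j) := by
  conv_lhs => rw [← (hb.basis h).sum_repr s]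
  simp only [hb.basis_apply]

theorem IsFrame.repr_resSection {n : ℕ} {b : Fin n → Γ(M, U)} (hb : IsFrame M U b) (h : V ≤ U)
    (h' : W ≤ V) (s : Γ(M, V)) (j : Fin n) :
    (hb.basis (h'.trans h)).repr (resSection M h' s) j =
      (X.presheaf.map (homOfLE h').op).hom ((hb.basis h).repr s j) := by
  have h1 : resSection M h' s = ∑ i, (X.presheaf.map (homOfLE h').op).hom
      ((hb.basis h).repr s i) • hb.basis (h'.trans h) i := by
    conv_lhs => rw [hb.eq_sum h s]
    simp only [resSection_sum, resSection_smul, resSection_resSection, hb.basis_apply]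
  rw [h1, Module.Basis.repr_sum_self]

theorem subsingleton_sections_of_isEmpty (hU : ¬ Nonempty U) : Subsingleton Γ(M, U) :=
  ⟨fun _ _ => eq_of_resSection_eq fun x hx => (hU ⟨x, hx⟩).elim⟩

end Restriction

/-! ### The generic fibre of a vector bundle and its lattices -/

namespace MarkedCurve

variable {k : Type u} [Field k] {r : ℕ} {C : MarkedCurve k r}

theorem Point.nonempty {P : C.Point} {U : C.X.Opens} (hP : P.pt ∈ U) : Nonempty U := ⟨⟨_, hP⟩⟩

theorem exists_affine_le (U : C.X.Opens) {x : C.X} (hx : x ∈ U) :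
    ∃ V : C.X.Opens, IsAffineOpen V ∧ V ≤ U ∧ x ∈ V := by
  obtain ⟨V, hV, hxV, hVU⟩ := TopologicalSpace.Opens.isBasis_iff_nbhd.1 C.X.isBasis_affineOpens hx
  exact ⟨V, hV, hVU, hxV⟩

theorem subsingleton_functions_of_isEmpty {U : C.X.Opens} (hU : ¬ Nonempty U) :
    Subsingleton Γ(C.X, U) := by
  have : U = ⊥ := by
    ext x
    exact ⟨fun hx => (hU ⟨x, hx⟩).elim, fun hx => hx.elim⟩
  subst this
  exact CommRingCat.subsingleton_of_isTerminal C.X.sheaf.isTerminalOfEmpty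

variable [IsAlgClosed k]

theorem nonempty_inf (U V : C.X.Opens) [hU : Nonempty U] [hV : Nonempty V] :
    Nonempty (U ⊓ V : C.X.Opens) := by
  obtain ⟨x, hx⟩ := nonempty_preirreducible_inter U.2 V.2 ⟨_, hU.some.2⟩ ⟨_, hV.some.2⟩
  exact ⟨⟨x, hx⟩⟩

section Generic

variable {M : C.X.Modules} {n : ℕ}

/-- An open subset with a frame, which is used to identify the generic fibre with a
coordinate space. -/
noncomputable def genOpens (hM : IsVectorBundle M n) : C.X.Opens :=
  (hM (genericPoint C.X)).choose

theorem generic_mem_genOpens (hM : IsVectorBundle M n) : genericPoint C.X ∈ genOpens hM :=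
  (hM (genericPoint C.X)).choose_spec.1

instance (hM : IsVectorBundle M n) : Nonempty (genOpens hM) :=
  ⟨⟨_, generic_mem_genOpens hM⟩⟩

/-- The frame which is used to identify the generic fibre with a coordinate space. -/
noncomputable def genFrame (hM : IsVectorBundle M n) : Fin n → Γ(M, genOpens hM) :=
  (hM (genericPoint C.X)).choose_spec.2.choose

theorem isFrame_genFrame (hM : IsVectorBundle M n) : IsFrame M (genOpens hM) (genFrame hM) :=
  (hM (genericPoint C.X)).choose_spec.2.choose_spec

/-- The value of a section of a vector bundle in the generic fibre. -/
noncomputable def toGen (hM : IsVectorBundle M n) (U : C.X.Opens) [Nonempty U] (s : Γ(M, U)) :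
    Fin n → C.K :=
  have := nonempty_inf U (genOpens hM)
  fun j => C.toK (U ⊓ genOpens hM) (((isFrame_genFrame hM).basis inf_le_right).repr
    (resSection M inf_le_left s) j)

variable (hM : IsVectorBundle M n) {U V : C.X.Opens} [Nonempty U] [Nonempty V]

theorem toGen_res (h : V ≤ U) (s : Γ(M, U)) : toGen hM V (resSection M h s) = toGen hM U s := by
  have := nonempty_inf U (genOpens hM)
  have := nonempty_inf V (genOpens hM)
  funext j
  simp only [toGen, resSection_resSection]
  rw [← toK_res (inf_le_inf_right (genOpens hM) h : V ⊓ genOpens hM ≤ U ⊓ genOpens hM)]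
  congr 1
  rw [← resSection_resSection (inf_le_left : U ⊓ genOpens hM ≤ U)
    (inf_le_inf_right (genOpens hM) h : V ⊓ genOpens hM ≤ U ⊓ genOpens hM)]
  exact (isFrame_genFrame hM).repr_resSection _ _ _ _

theorem toGen_add (s t : Γ(M, U)) : toGen hM U (s + t) = toGen hM U s + toGen hM U t := by
  funext j
  simp only [toGen, resSection_add, map_add, Finsupp.add_apply, Pi.add_apply]

theorem toGen_smul (f : Γ(C.X, U)) (s : Γ(M, U)) :
    toGen hM U (f • s) = C.toK U f • toGen hM U s := by
  have := nonempty_inf U (genOpens hM)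
  funext j
  simp only [toGen, resSection_smul, map_smul, Finsupp.smul_apply, Pi.smul_apply, smul_eq_mul,
    map_mul]
  congr 1
  exact toK_res inf_le_left f

theorem toGen_sub (s t : Γ(M, U)) : toGen hM U (s - t) = toGen hM U s - toGen hM U t := by
  rw [eq_sub_iff_add_eq, ← toGen_add, sub_add_cancel]

theorem toGen_sum {ι : Type*} (t : Finset ι) (s : ι → Γ(M, U)) :
    toGen hM U (∑ i ∈ t, s i) = ∑ i ∈ t, toGen hM U (s i) :=
  map_sum (AddMonoidHom.mk' (toGen hM U) (toGen_add hM)) s t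

theorem toGen_zero : toGen hM U 0 = 0 :=
  map_zero (AddMonoidHom.mk' (toGen hM U) (toGen_add hM))

theorem toGen_genFrame (h : U ≤ genOpens hM) (j : Fin n) :
    toGen hM U (resSection M h (genFrame hM j)) = Pi.single j 1 := by
  have := nonempty_inf U (genOpens hM)
  funext i
  simp only [toGen, resSection_resSection]
  rw [← (isFrame_genFrame hM).basis_apply, Module.Basis.repr_self,
    Finsupp.single_apply, Pi.single_apply]
  by_cases hij : i = j
  · rw [if_pos hij, if_pos hij.symm, map_one]
  · rw [if_neg hij, if_neg (Ne.symm hij), map_zero]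

variable {hM}

theorem exists_eq_sum_toGen {b : Fin n → Γ(M, V)} (hb : IsFrame M V b) (h : U ≤ V) (s : Γ(M, U)) :
    ∃ a : Fin n → Γ(C.X, U), s = ∑ j, a j • resSection M h (b j) ∧
      toGen hM U s = ∑ j, C.toK U (a j) • toGen hM V (b j) := by
  refine ⟨_, hb.eq_sum h s, ?_⟩
  conv_lhs => rw [hb.eq_sum h s]
  simp only [toGen_sum, toGen_smul, toGen_res]

theorem linearIndependent_toGen {b : Fin n → Γ(M, V)} (hb : IsFrame M V b) :
    LinearIndependent C.K fun j => toGen hM V (b j) := by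
  refine linearIndependent_of_top_le_span_of_card_eq_finrank ?_ (by simp)
  rw [← (Pi.basisFun C.K (Fin n)).span_eq, Submodule.span_le]
  rintro _ ⟨j, rfl⟩
  have := nonempty_inf V (genOpens hM)
  have h := toGen_genFrame hM (inf_le_right : V ⊓ genOpens hM ≤ _) j
  obtain ⟨a, -, ha⟩ := exists_eq_sum_toGen (hM := hM) hb inf_le_left
    (resSection M (inf_le_right : V ⊓ genOpens hM ≤ _) (genFrame hM j))
  rw [h] at ha
  rw [Pi.basisFun_apply, ha]
  exact Submodule.sum_mem _ fun i _ => Submodule.smul_mem _ _ (Submodule.subset_span ⟨i, rfl⟩)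

theorem exists_eq_sum_smul_toGen {b : Fin n → Γ(M, V)} (hb : IsFrame M V b) (v : Fin n → C.K) :
    ∃ a : Fin n → C.K, v = ∑ j, a j • toGen hM V (b j) := by
  have h := (linearIndependent_toGen (hM := hM) hb).span_eq_top_of_card_eq_finrank' (by simp)
  obtain ⟨a, ha⟩ := (Submodule.mem_span_range_iff_exists_fun C.K).1
    (h ▸ Submodule.mem_top (x := v))
  exact ⟨a, ha.symm⟩

theorem toGen_injective : Function.Injective (toGen hM U) := by
  intro s t hst
  refine eq_of_resSection_eq fun x hx => ?_
  obtain ⟨V, hxV, b, hb⟩ := hM x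
  have : Nonempty V := ⟨⟨x, hxV⟩⟩
  have : Nonempty (U ⊓ V : C.X.Opens) := ⟨⟨x, hx, hxV⟩⟩
  refine ⟨U ⊓ V, inf_le_left, ⟨hx, hxV⟩, ?_⟩
  obtain ⟨a, ha, ha'⟩ := exists_eq_sum_toGen (hM := hM) hb inf_le_right
    (resSection M (inf_le_left : U ⊓ V ≤ U) s)
  obtain ⟨c, hc, hc'⟩ := exists_eq_sum_toGen (hM := hM) hb inf_le_right
    (resSection M (inf_le_left : U ⊓ V ≤ U) t)
  rw [toGen_res] at ha' hc'
  have h1 := Fintype.linearIndependent_iff.1 (linearIndependent_toGen (hM := hM) hb)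
    (fun j => C.toK _ (a j) - C.toK _ (c j)) (by
      simp only [sub_smul, Finset.sum_sub_distrib]
      rw [← ha', ← hc', hst, sub_self])
  have : a = c := funext fun j => toK_injective _ (sub_eq_zero.1 (h1 j))
  rw [ha, hc, this]

variable (hM) in
/-- The lattice of an `𝒪`-module at a closed point: the germs in the generic fibre of the sections
near the point. -/
def InLattice (P : C.Point) (v : Fin n → C.K) : Prop :=
  ∃ (W : C.X.Opens) (hP : P.pt ∈ W) (s : Γ(M, W)), haveI := Point.nonempty hP
    toGen hM W s = v

theorem inLattice_toGen {P : C.Point} (hP : P.pt ∈ U) (s : Γ(M, U)) :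
    InLattice hM P (toGen hM U s) := ⟨U, hP, s, rfl⟩

/-- Sections near the closed points with the same generic value agree on overlaps, and hence glue.
-/
theorem exists_toGen_eq {v : Fin n → C.K} (hv : ∀ P : C.Point, P.pt ∈ U → InLattice hM P v) :
    ∃ s, toGen hM U s = v := by
  let ι := {P : C.Point // P.pt ∈ U}
  have hloc : ∀ P : ι, ∃ (V : C.X.Opens) (_ : V ≤ U) (hP : P.1.pt ∈ V) (s : Γ(M, V)),
      haveI := Point.nonempty hP
      toGen hM V s = v := by
    rintro ⟨P, hP⟩
    obtain ⟨W, hW, s, hs⟩ := hv P hP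
    have := Point.nonempty hW
    have := Point.nonempty (U := W ⊓ U) ⟨hW, hP⟩
    exact ⟨W ⊓ U, inf_le_right, ⟨hW, hP⟩, resSection M inf_le_left s, (toGen_res hM _ _).trans hs⟩
  choose V hVU hPV s hs using hloc
  have hcov : U ≤ iSup V := by
    intro x hx
    by_contra hxV
    obtain ⟨y, ⟨hyU, hyV⟩, hy⟩ := C.exists_isClosed_mem (Z := (U : Set C.X) ∩ (iSup V : C.X.Opens)ᶜ)
      (U.2.isLocallyClosed.inter (iSup V).2.isClosed_compl.isLocallyClosed) ⟨x, hx, hxV⟩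
    exact hyV (TopologicalSpace.Opens.mem_iSup.2 ⟨⟨⟨y, hy⟩, hyU⟩, hPV _⟩)
  obtain ⟨t, ht⟩ := exists_resSection_eq hVU hcov s fun P Q => by
    have := Point.nonempty (hPV P)
    have := Point.nonempty (hPV Q)
    have := nonempty_inf (V P) (V Q)
    apply toGen_injective (hM := hM)
    rw [toGen_res, toGen_res, hs P, hs Q]
  obtain ⟨P, hP⟩ := Point.exists_mem (C := C) (U := U) ⟨_, (Classical.arbitrary U).2⟩
  have := Point.nonempty (hPV ⟨P, hP⟩)
  exact ⟨t, by rw [← toGen_res hM (hVU ⟨P, hP⟩), ht, hs]⟩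

theorem inLattice_iff {P : C.Point} {b : Fin n → Γ(M, V)} (hb : IsFrame M V b) (hP : P.pt ∈ V)
    {a : Fin n → C.K} :
    InLattice hM P (∑ j, a j • toGen hM V (b j)) ↔ ∀ j, a j ∈ P.place.ring := by
  constructor
  · rintro ⟨W, hW, s, hs⟩
    have := Point.nonempty hW
    have := Point.nonempty (U := W ⊓ V) ⟨hW, hP⟩
    obtain ⟨c, -, hc⟩ := exists_eq_sum_toGen (hM := hM) hb inf_le_right
      (resSection M (inf_le_left : W ⊓ V ≤ W) s)
    rw [toGen_res, hs] at hc
    have h1 := Fintype.linearIndependent_iff.1 (linearIndependent_toGen (hM := hM) hb)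
      (fun j => a j - C.toK _ (c j)) (by
        simp only [sub_smul, Finset.sum_sub_distrib]
        rw [hc, sub_self])
    intro j
    rw [sub_eq_zero.1 (h1 j)]
    exact toK_mem_ring (U := W ⊓ V) ⟨hW, hP⟩ _
  · intro ha
    have hex : ∀ j, ∃ (W : C.X.Opens) (hW : P.pt ∈ W) (f : Γ(C.X, W)),
        haveI := Point.nonempty hW
        C.toK W f = a j := by
      intro j
      obtain ⟨g, hg⟩ := (P.mem_place_ring_iff _).1 (ha j)
      obtain ⟨W, hW, f, rfl⟩ := C.X.presheaf.exists_germ_eq g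
      have := Point.nonempty hW
      exact ⟨W, hW, f, (toK_eq_algebraMap_germ hW f).trans hg⟩
    choose W hW f hf using hex
    let W' : C.X.Opens := V ⊓ Finset.univ.inf W
    have hW' : P.pt ∈ W' := by
      refine ⟨hP, ?_⟩
      have : ∀ s : Finset (Fin n), P.pt ∈ s.inf W := by
        intro s
        induction s using Finset.induction with
        | empty => trivial
        | insert j s _ ih => rw [Finset.inf_insert]; exact ⟨hW j, ih⟩
      exact this _
    have hle : ∀ j, W' ≤ W j := fun j => inf_le_right.trans (Finset.inf_le (Finset.mem_univ j))
    have := Point.nonempty hW'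
    refine ⟨W', hW', ∑ j, C.res (hle j) (f j) • resSection M inf_le_left (b j), ?_⟩
    simp only [toGen_sum, toGen_smul, toGen_res]
    refine Finset.sum_congr rfl fun j _ => ?_
    have := Point.nonempty (hW j)
    rw [toK_res, hf]

/-- Frames can be recognised on lattices at closed points: the coordinates of a section are rational
functions regular at every closed point, so they are functions. -/
theorem isFrame_of_toGen {b : Fin n → Γ(M, V)}
    (hli : LinearIndependent C.K fun j => toGen hM V (b j))
    (h : ∀ (P : C.Point), P.pt ∈ V → ∀ v, InLattice hM P v → ∃ a : Fin n → C.K,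
      (∀ j, a j ∈ P.place.ring) ∧ v = ∑ j, a j • toGen hM V (b j)) : IsFrame M V b := by
  intro W hWV
  by_cases hW : Nonempty W
  · constructor
    · rw [Fintype.linearIndependent_iff]
      intro g hg j
      apply toK_injective W
      rw [map_zero]
      refine Fintype.linearIndependent_iff.1 hli (fun j => C.toK W (g j)) ?_ j
      have := congrArg (toGen hM W) hg
      simpa only [toGen_sum, toGen_smul, toGen_res, toGen_zero] using this
    · rw [eq_top_iff]
      intro s _
      obtain ⟨P₀, hP₀⟩ := Point.exists_mem (C := C) (U := W) ⟨_, hW.some.2⟩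
      obtain ⟨a, -, ha⟩ := h P₀ (hWV hP₀) _ (inLattice_toGen (hM := hM) hP₀ s)
      have hex : ∀ j, ∃ f, C.toK W f = a j := by
        refine fun j => exists_toK_eq fun P hP => (P.mem_place_ring_iff _).1 ?_
        obtain ⟨a', ha', hs⟩ := h P (hWV hP) _ (inLattice_toGen (hM := hM) hP s)
        have h1 := Fintype.linearIndependent_iff.1 hli (fun j => a j - a' j) (by
          simp only [sub_smul, Finset.sum_sub_distrib]
          rw [← ha, ← hs, sub_self])
        rw [sub_eq_zero.1 (h1 j)]
        exact ha' j
      choose f hf using hex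
      have : s = ∑ j, f j • resSection M hWV (b j) := by
        apply toGen_injective (hM := hM)
        simp only [toGen_sum, toGen_smul, toGen_res, hf, ha]
      rw [this]
      exact Submodule.sum_mem _ fun j _ => Submodule.smul_mem _ _ (Submodule.subset_span ⟨j, rfl⟩)
  · have := subsingleton_functions_of_isEmpty hW
    have := subsingleton_sections_of_isEmpty (M := M) hW
    exact ⟨linearIndependent_of_subsingleton, Subsingleton.elim _ _⟩

theorem mem_basicOpen_iff {P : C.Point} (hP : P.pt ∈ U) (f : Γ(C.X, U)) :
    P.pt ∈ C.X.basicOpen f ↔ C.toK U f ∉ P.place.ge 1 := by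
  rw [Scheme.mem_basicOpen _ _ _ hP, toK_eq_algebraMap_germ hP, P.mem_place_ge_one_iff]
  simp

theorem ord_eq_zero_of_notMem {P : C.Point} (hP : P.pt ∈ U) {f : Γ(C.X, U)}
    (hf : C.toK U f ∉ P.place.ge 1) : C.toK U f ≠ 0 ∧ P.place.ord (C.toK U f) = 0 := by
  have h0 : C.toK U f ≠ 0 := fun h => hf (h ▸ zero_mem _)
  have h1 : 0 ≤ P.place.ord (C.toK U f) := toK_mem_ring hP f h0
  rw [P.place.mem_ge_of_ne h0] at hf
  exact ⟨h0, by omega⟩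

variable (C) in
theorem finite_setOf_ord_pos {f : C.K} (hf : f ≠ 0) : {P : C.Point | 0 < P.place.ord f}.Finite := by
  by_cases hc : ∀ c : k, algebraMap k C.K c ≠ f
  · have := C.complete.finite f hc
    exact C.complete.finite_zeros hf
  · push Not at hc
    obtain ⟨c, rfl⟩ := hc
    have hc : c ≠ 0 := fun h => hf (by rw [h, map_zero])
    convert Set.finite_empty
    ext P
    simp [P.place.ord_algebraMap c hc]

theorem InLattice.exists_pow_smul (P : C.Point) (v : Fin n → C.K) {f : C.K} (hf : f ≠ 0)
    (hfP : 0 < P.place.ord f) : ∃ N : ℕ, ∀ m ≥ N, InLattice hM P (f ^ m • v) := by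
  obtain ⟨V, hV, b, hb⟩ := hM P.pt
  have := Point.nonempty hV
  obtain ⟨a, rfl⟩ := exists_eq_sum_smul_toGen (hM := hM) hb v
  refine ⟨∑ j, (P.place.ord (a j)).natAbs, fun m hm => ?_⟩
  rw [Finset.smul_sum]
  simp only [smul_smul]
  rw [inLattice_iff hb hV]
  intro j h0
  have h1 : a j ≠ 0 := right_ne_zero_of_mul h0
  rw [P.place.ord_mul (pow_ne_zero _ hf) h1, P.place.ord_pow hf]
  have h2 : (P.place.ord (a j)).natAbs ≤ m :=
    (Finset.single_le_sum (f := fun j => (P.place.ord (a j)).natAbs) (fun _ _ => by simp)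
      (Finset.mem_univ j)).trans hm
  have h3 : (m : ℤ) * 1 ≤ m * P.place.ord f := by gcongr; omega
  omega

/-- The lattice at a point of an affine open subset is the localization of the sections. -/
theorem exists_toGen_eq_smul (hU : IsAffineOpen U) {P : C.Point} (hP : P.pt ∈ U)
    {v : Fin n → C.K} (hv : InLattice hM P v) :
    ∃ (f : Γ(C.X, U)) (s : Γ(M, U)), C.toK U f ≠ 0 ∧ P.place.ord (C.toK U f) = 0 ∧
      toGen hM U s = C.toK U f • v := by
  obtain ⟨W, hW, s, hs⟩ := hv
  have := Point.nonempty hW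
  obtain ⟨g, hgW, hg⟩ := hU.exists_basicOpen_le ⟨P.pt, hW⟩ hP
  obtain ⟨hg0, hgP⟩ := ord_eq_zero_of_notMem hP ((mem_basicOpen_iff hP g).1 hg)
  -- `v` comes from a section where `g` is invertible. Each of the finitely many zeros of `g`
  -- requires a finite power of `g`, and the sum of the exponents serves all of them.
  choose! N hN using fun Q hQ => InLattice.exists_pow_smul (hM := hM) Q v hg0 hQ
  let T := (C.finite_setOf_ord_pos hg0).toFinset
  have hex := exists_toGen_eq (hM := hM) (U := U) (v := C.toK U g ^ (∑ Q ∈ T, N Q) • v) ?_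
  · obtain ⟨t, ht⟩ := hex
    refine ⟨g ^ (∑ Q ∈ T, N Q), t, ?_, ?_, ?_⟩
    · rw [map_pow]; exact pow_ne_zero _ hg0
    · rw [map_pow, P.place.ord_pow hg0, hgP, mul_zero]
    · rw [map_pow, ht]
  · intro Q hQ
    by_cases h : 0 < Q.place.ord (C.toK U g)
    · refine hN Q h _ (Finset.single_le_sum (fun _ _ => Nat.zero_le _) ?_)
      simpa [T] using h
    · have h1 : Q.pt ∈ C.X.basicOpen g := by
        rw [mem_basicOpen_iff hQ, Q.place.mem_ge_of_ne hg0]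
        omega
      have hQW : Q.pt ∈ (W ⊓ U : C.X.Opens) := ⟨hgW h1, hQ⟩
      have := Point.nonempty hQW
      rw [← hs, ← toGen_res hM (inf_le_left : W ⊓ U ≤ W),
        ← toK_res (inf_le_right : W ⊓ U ≤ U), ← map_pow, ← toGen_smul]
      exact inLattice_toGen hQW _

end Generic

end MarkedCurve

/-! ### Determinants in the plane -/

/-- The determinant of a pair of vectors in the plane. -/
def wedge {K : Type*} [CommRing K] (v w : Fin 2 → K) : K := v 0 * w 1 - v 1 * w 0

section Wedge

variable {K : Type*} [Field K]

theorem wedge_add_right (v w w' : Fin 2 → K) : wedge v (w + w') = wedge v w + wedge v w' := by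
  simp only [wedge, Pi.add_apply]; ring

theorem wedge_sub_right (v w w' : Fin 2 → K) : wedge v (w - w') = wedge v w - wedge v w' := by
  simp only [wedge, Pi.sub_apply]; ring

theorem wedge_smul_right (a : K) (v w : Fin 2 → K) : wedge v (a • w) = a * wedge v w := by
  simp only [wedge, Pi.smul_apply, smul_eq_mul]; ring

theorem wedge_smul_left (a : K) (v w : Fin 2 → K) : wedge (a • v) w = a * wedge v w := by
  simp only [wedge, Pi.smul_apply, smul_eq_mul]; ring

theorem wedge_self (v : Fin 2 → K) : wedge v v = 0 := by
  simp only [wedge]; ring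

theorem wedge_comm (v w : Fin 2 → K) : wedge v w = -wedge w v := by
  simp only [wedge]; ring

theorem wedge_eq_zero_iff {v w : Fin 2 → K} (hv : v ≠ 0) : wedge v w = 0 ↔ ∃ a : K, w = a • v := by
  constructor
  · intro h
    simp only [wedge] at h
    by_cases h0 : v 0 = 0
    · have h1 : v 1 ≠ 0 := fun h1 => hv (by ext i; fin_cases i <;> simp [h0, h1])
      refine ⟨w 1 / v 1, ?_⟩
      have h2 : w 0 = 0 := by
        rw [h0, zero_mul, zero_sub, neg_eq_zero] at h
        exact (mul_eq_zero.1 h).resolve_left h1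
      ext i; fin_cases i
      · simp [h0, h2]
      · simp [h1]
    · refine ⟨w 0 / v 0, ?_⟩
      ext i; fin_cases i
      · simp [h0]
      · simp only [Fin.mk_one, Pi.smul_apply, smul_eq_mul]
        field_simp
        linear_combination h
  · rintro ⟨a, rfl⟩
    rw [wedge_smul_right, wedge_self, mul_zero]

/-- Cramer's rule. -/
theorem eq_wedge_smul_add {v w : Fin 2 → K} (h : wedge v w ≠ 0) (u : Fin 2 → K) :
    u = (wedge u w / wedge v w) • v + (wedge v u / wedge v w) • w := by
  ext i
  simp only [Pi.add_apply, Pi.smul_apply, smul_eq_mul]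
  rw [div_mul_eq_mul_div, div_mul_eq_mul_div, ← add_div, eq_div_iff h]
  fin_cases i <;> simp only [wedge, Fin.mk_one, Fin.zero_eta] <;> ring

theorem wedge_ne_zero_of_linearIndependent {b : Fin 2 → Fin 2 → K} (h : LinearIndependent K b) :
    wedge (b 0) (b 1) ≠ 0 := by
  intro h0
  obtain ⟨a, ha⟩ := (wedge_eq_zero_iff (h.ne_zero 0)).1 h0
  have := Fintype.linearIndependent_iff.1 h ![-a, 1] (by simp [Fin.sum_univ_two, ha]) 1
  simp at this

end Wedge

/-! ### The connection on the generic fibre -/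

namespace FlatBundle

variable {k : Type u} [Field k] {r : ℕ} {C : MarkedCurve k r} {n : ℕ}

theorem nabla_zero_left (E : FlatBundle C n) (U : C.X.affineOpens) (e : Γ(E.E, U.1)) :
    E.nabla U 0 e = 0 := by
  have := E.smul_left U 0 0 e
  rwa [zero_smul, zero_smul] at this

theorem nabla_sum (E : FlatBundle C n) (U : C.X.affineOpens) (D : C.logVF U.1) {ι : Type*}
    (t : Finset ι) (e : ι → Γ(E.E, U.1)) :
    E.nabla U D (∑ i ∈ t, e i) = ∑ i ∈ t, E.nabla U D (e i) :=
  map_sum (E.nablaEnd U D) e t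

variable [IsAlgClosed k]

/-- The value of a section in the generic fibre. -/
noncomputable abbrev gen (E : FlatBundle C n) (U : C.X.Opens) [Nonempty U] (s : Γ(E.E, U)) :
    Fin n → C.K :=
  toGen E.isVectorBundle U s

theorem gen_nabla_eq_of_theta_eq (E : FlatBundle C n) {U V : C.X.affineOpens} [Nonempty U.1]
    [Nonempty V.1] (h : V.1 ≤ U.1) {D : C.logVF U.1} {D' : C.logVF V.1}
    (hD : theta V.2 D'.1 = theta U.2 D.1) (e : Γ(E.E, U.1)) :
    E.gen V.1 (E.nabla V D' (resSection E.E h e)) = E.gen U.1 (E.nabla U D e) := by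
  rw [E.restrict U V h D D' (res_apply_of_theta_eq U.2 V.2 h hD), gen, gen, toGen_res]

/-- Vector fields have generic rank one, so `q • D = p • D'` for suitable functions, and `∇` is
linear in the vector field. Thus `∇(D)` divided by the coefficient of `D` does not depend on `D`. -/
theorem theta_smul_gen_nabla (E : FlatBundle C n) {U : C.X.affineOpens} [Nonempty U.1]
    (D D' : C.logVF U.1) (e : Γ(E.E, U.1)) :
    theta U.2 D'.1 • E.gen U.1 (E.nabla U D e) = theta U.2 D.1 • E.gen U.1 (E.nabla U D' e) := by
  by_cases h0 : theta U.2 D'.1 = 0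
  · have h1 : D' = 0 := by
      ext1
      apply theta_injective U.2
      rw [h0]
      exact (theta_eq_of_forall U.2 fun f => by simp).symm
    rw [h0, h1, nabla_zero_left, gen, gen, toGen_zero, zero_smul, smul_zero]
  have := isFractionRing_toK U.2
  obtain ⟨p, q, hq, hpq⟩ := IsFractionRing.div_surjective (A := Γ(C.X, U.1))
    (theta U.2 D.1 / theta U.2 D'.1)
  have hq0 : C.toK U.1 q ≠ 0 := by
    rw [Ne, map_eq_zero_iff _ (toK_injective U.1)]
    exact nonZeroDivisors.ne_zero hq
  change C.toK U.1 p / C.toK U.1 q = _ at hpq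
  rw [div_eq_div_iff hq0 h0] at hpq
  have h1 : q • D = p • D' := by
    ext1
    apply theta_injective U.2
    refine (theta_smul U.2 q D.1).trans (Eq.trans ?_ (theta_smul U.2 p D'.1).symm)
    rw [hpq, mul_comm]
  have h2 := congrArg (fun D => E.gen U.1 (E.nabla U D e)) h1
  simp only [E.smul_left, gen, toGen_smul] at h2
  have h3 := congrArg (fun v => (theta U.2 D'.1 / C.toK U.1 q) • v) h2
  simp only [smul_smul] at h3
  rw [div_mul_cancel₀ _ hq0] at h3
  rw [h3]
  congr 1
  rw [div_mul_eq_mul_div, mul_comm, hpq, mul_div_cancel_right₀ _ hq0]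

/-- Dividing `∇(D)` by the coefficient of `D` gives one operator, fixed by its values on a generic
frame and the Leibniz rule. -/
theorem exists_generic_nabla (E : FlatBundle C n) :
    ∃ N : (Fin n → C.K) → Fin n → C.K,
      (∀ f v, N (f • v) = f • N v + C.vf f • v) ∧
      ∀ (U : C.X.affineOpens) [Nonempty U.1] (D : C.logVF U.1) (e : Γ(E.E, U.1)),
        E.gen U.1 (E.nabla U D e) = theta U.2 D.1 • N (E.gen U.1 e) := by
  by_cases hex : ∃ (U : C.X.affineOpens) (_ : Nonempty U.1) (D : C.logVF U.1), theta U.2 D.1 ≠ 0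
  · obtain ⟨U₁, hU₁, D₁, hD₁⟩ := hex
    have := nonempty_inf U₁.1 (genOpens E.isVectorBundle)
    obtain ⟨W, hW, hWU, hxW⟩ := exists_affine_le (U₁.1 ⊓ genOpens E.isVectorBundle)
      (Classical.arbitrary (U₁.1 ⊓ genOpens E.isVectorBundle : C.X.Opens)).2
    have hWn : Nonempty W := ⟨⟨_, hxW⟩⟩
    obtain ⟨D₂, hD₂⟩ := exists_restrict_logVF U₁.2 hW (hWU.trans inf_le_left) D₁
    have hWg : W ≤ genOpens E.isVectorBundle := hWU.trans inf_le_right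
    let A (i : Fin n) : Fin n → C.K := (theta hW D₂.1)⁻¹ • E.gen W (E.nabla ⟨W, hW⟩ D₂
      (resSection E.E hWg (genFrame E.isVectorBundle i)))
    refine ⟨fun v => (fun j => C.vf (v j)) + ∑ i, v i • A i, ?_, ?_⟩
    · intro f v
      ext j
      simp only [Pi.add_apply, Pi.smul_apply, smul_eq_mul, Derivation.leibniz, smul_add,
        Finset.smul_sum, smul_smul]
      ring
    · intro U hU D e
      have := nonempty_inf U.1 W
      obtain ⟨V, hV, hVU, hxV⟩ := exists_affine_le (U.1 ⊓ W)
        (Classical.arbitrary (U.1 ⊓ W : C.X.Opens)).2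
      have hVn : Nonempty V := ⟨⟨_, hxV⟩⟩
      obtain ⟨D', hD'⟩ := exists_restrict_logVF U.2 hV (hVU.trans inf_le_left) D
      obtain ⟨D₃, hD₃⟩ := exists_restrict_logVF hW hV (hVU.trans inf_le_right) D₂
      have hVW := hVU.trans inf_le_right
      have hb : ∀ i, E.gen V (E.nabla ⟨V, hV⟩ D' (resSection E.E (hVW.trans hWg)
          (genFrame E.isVectorBundle i))) = theta U.2 D.1 • A i := by
        intro i
        have h1 := E.theta_smul_gen_nabla (U := ⟨V, hV⟩) D' D₃ (resSection E.E (hVW.trans hWg)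
          (genFrame E.isVectorBundle i))
        have h2 := E.gen_nabla_eq_of_theta_eq (U := ⟨W, hW⟩) (V := ⟨V, hV⟩) hVW hD₃
          (resSection E.E hWg (genFrame E.isVectorBundle i))
        rw [resSection_resSection] at h2
        rw [h2, hD₃, hD', hD₂] at h1
        simp only [A, hD₂]
        rw [smul_comm, ← h1, smul_smul, inv_mul_cancel₀ hD₁, one_smul]
      rw [← E.gen_nabla_eq_of_theta_eq (U := U) (V := ⟨V, hV⟩) (hVU.trans inf_le_left) hD' e]
      obtain ⟨a, ha, ha'⟩ := exists_eq_sum_toGen (hM := E.isVectorBundle)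
        (isFrame_genFrame E.isVectorBundle) (hVW.trans hWg)
        (resSection E.E (hVU.trans inf_le_left) e)
      have ha'' : E.gen U.1 e = fun j => C.toK V (a j) := by
        rw [gen, ← toGen_res E.isVectorBundle (hVU.trans inf_le_left), ha]
        simp only [toGen_sum, toGen_smul, toGen_genFrame]
        ext j
        simp [Finset.sum_apply, Pi.single_apply]
      rw [ha, nabla_sum, ha'', gen, toGen_sum]
      have hterm : ∀ i, toGen E.isVectorBundle V (E.nabla ⟨V, hV⟩ D'
          (a i • resSection E.E (hVW.trans hWg) (genFrame E.isVectorBundle i))) =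
          theta U.2 D.1 • (C.toK V (a i) • A i + Pi.single i (C.vf (C.toK V (a i)))) := by
        intro i
        rw [E.leibniz, toGen_add, toGen_smul, toGen_smul, toGen_genFrame, toK_apply hV, hD',
          smul_add]
        congr 1
        · rw [smul_comm, ← hb i]
        · rw [mul_smul]
          congr 1
          rw [← Pi.single_smul, smul_eq_mul, mul_one]
      refine (Finset.sum_congr rfl fun i _ => hterm i).trans ?_
      rw [← Finset.smul_sum, Finset.sum_add_distrib, add_comm]
      congr 2
      ext j
      simp [Finset.sum_apply, Pi.single_apply]
  -- If every logarithmic vector field is zero, the second property reads `0 = 0`, and any operator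
  -- with the Leibniz rule serves.
  · push Not at hex
    refine ⟨fun v j => C.vf (v j), ?_, ?_⟩
    · intro f v
      ext j
      simp [mul_comm]
    · intro U hU D e
      have h1 : D = 0 := by
        ext1
        apply theta_injective U.2
        rw [hex U hU D]
        exact (theta_eq_of_forall U.2 fun f => by simp).symm
      rw [hex U hU D, h1, nabla_zero_left, gen, toGen_zero, zero_smul]

/-- The covariant derivative along `vf` on the generic fibre. -/
noncomputable def genNabla (E : FlatBundle C n) : (Fin n → C.K) → Fin n → C.K :=
  E.exists_generic_nabla.choose

theorem genNabla_smul (E : FlatBundle C n) (f : C.K) (v : Fin n → C.K) :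
    E.genNabla (f • v) = f • E.genNabla v + C.vf f • v :=
  E.exists_generic_nabla.choose_spec.1 f v

theorem gen_nabla (E : FlatBundle C n) {U : C.X.affineOpens} [Nonempty U.1] (D : C.logVF U.1)
    (e : Γ(E.E, U.1)) :
    E.gen U.1 (E.nabla U D e) = theta U.2 D.1 • E.genNabla (E.gen U.1 e) :=
  E.exists_generic_nabla.choose_spec.2 U D e

end FlatBundle

variable {k : Type u} [Field k] [IsAlgClosed k] {r : ℕ} {C : MarkedCurve k r}

/-! ### Filtrations as lines in the generic fibre -/

section Filtration

variable {M : C.X.Modules} (hM : IsVectorBundle M 2)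

/-- Near every point there is a frame whose first vector spans the given generic line. -/
def IsLine (v : Fin 2 → C.K) : Prop :=
  ∀ x : C.X, ∃ (V : C.X.Opens) (hx : x ∈ V) (b : Fin 2 → Γ(M, V)), IsFrame M V b ∧
    haveI : Nonempty V := ⟨⟨x, hx⟩⟩
    ∃ a : C.K, toGen hM V (b 0) = a • v

variable {hM}

theorem IsFrame.wedge_ne_zero {V : C.X.Opens} [Nonempty V] {b : Fin 2 → Γ(M, V)}
    (hb : IsFrame M V b) : wedge (toGen hM V (b 0)) (toGen hM V (b 1)) ≠ 0 :=
  wedge_ne_zero_of_linearIndependent (linearIndependent_toGen (hM := hM) hb)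

theorem IsFrame.toGen_ne_zero {V : C.X.Opens} [Nonempty V] {b : Fin 2 → Γ(M, V)}
    (hb : IsFrame M V b) : toGen hM V (b 0) ≠ 0 :=
  (linearIndependent_toGen (hM := hM) hb).ne_zero 0

theorem wedge_div_mem_ring {P : C.Point} {V : C.X.Opens} [Nonempty V] {b : Fin 2 → Γ(M, V)}
    (hb : IsFrame M V b) (hP : P.pt ∈ V) {u : Fin 2 → C.K} (hu : InLattice hM P u) :
    wedge (toGen hM V (b 0)) u / wedge (toGen hM V (b 0)) (toGen hM V (b 1)) ∈ P.place.ring := by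
  have h0 := hb.wedge_ne_zero (hM := hM)
  have h1 := eq_wedge_smul_add h0 u
  rw [h1] at hu
  have h2 := inLattice_iff (hM := hM) hb hP (a := ![
    wedge u (toGen hM V (b 1)) / wedge (toGen hM V (b 0)) (toGen hM V (b 1)),
    wedge (toGen hM V (b 0)) u / wedge (toGen hM V (b 0)) (toGen hM V (b 1))])
  simp only [Fin.sum_univ_two, Matrix.cons_val_zero, Matrix.cons_val_one] at h2
  exact h2.1 hu 1

theorem IsFrame.wedge_eq {U V : C.X.Opens} [Nonempty U] [Nonempty V] {b : Fin 2 → Γ(M, V)}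
    (hb : IsFrame M V b) (h : U ≤ V) (s : Γ(M, U)) : ∃ f₀ f₁ : Γ(C.X, U),
      s = f₀ • resSection M h (b 0) + f₁ • resSection M h (b 1) ∧
      wedge (toGen hM V (b 0)) (toGen hM U s) =
        C.toK U f₁ * wedge (toGen hM V (b 0)) (toGen hM V (b 1)) := by
  obtain ⟨a, ha, ha'⟩ := exists_eq_sum_toGen (hM := hM) hb h s
  rw [Fin.sum_univ_two] at ha ha'
  refine ⟨a 0, a 1, ha, ?_⟩
  rw [ha', wedge_add_right, wedge_smul_right, wedge_smul_right, wedge_self, mul_zero, zero_add]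

variable (hM) in
-- Local generators of `F¹` are proportional over `K`, so they span one generic line. In an adapted
-- frame a section lies in `F¹` when its second coordinate vanishes, and up to a nonzero factor that
-- coordinate is the wedge with the line.
theorem Filtration.exists_line (F : Filtration M) : ∃ v : Fin 2 → C.K, v ≠ 0 ∧ IsLine hM v ∧
    ∀ (U : C.X.Opens) [Nonempty U] (s : Γ(M, U)), s ∈ F.F U ↔ wedge v (toGen hM U s) = 0 := by
  obtain ⟨V₀, hV₀, b₀, hb₀, hF₀⟩ := F.isSubbundle (genericPoint C.X)
  have : Nonempty V₀ := ⟨⟨_, hV₀⟩⟩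
  have hv0 : toGen hM V₀ (b₀ 0) ≠ 0 := hb₀.toGen_ne_zero
  have key : ∀ (V : C.X.Opens) [Nonempty V] (b : Fin 2 → Γ(M, V)), IsFrame M V b →
      (∀ (W : C.X.Opens) (h : W ≤ V), F.F W = Submodule.span Γ(C.X, W) {resSection M h (b 0)}) →
      ∃ a : C.K, a ≠ 0 ∧ toGen hM V (b 0) = a • toGen hM V₀ (b₀ 0) := by
    intro V _ b hb hF
    have := nonempty_inf V V₀
    have h1 : resSection M (inf_le_left : V ⊓ V₀ ≤ V) (b 0) ∈ F.F (V ⊓ V₀) := by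
      rw [hF _ inf_le_left]
      exact Submodule.mem_span_singleton_self _
    rw [hF₀ _ inf_le_right] at h1
    obtain ⟨f, hf⟩ := Submodule.mem_span_singleton.1 h1
    have h2 := congrArg (toGen hM (V ⊓ V₀)) hf
    rw [toGen_smul, toGen_res, toGen_res] at h2
    refine ⟨_, ?_, h2.symm⟩
    intro h0
    rw [h0, zero_smul] at h2
    exact hb.toGen_ne_zero (hM := hM) h2.symm
  refine ⟨_, hv0, ?_, ?_⟩
  · intro x
    obtain ⟨V, hxV, b, hb, hF⟩ := F.isSubbundle x
    have : Nonempty V := ⟨⟨_, hxV⟩⟩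
    obtain ⟨a, -, ha⟩ := key V b hb hF
    exact ⟨V, hxV, b, hb, a, ha⟩
  · intro U _ s
    constructor
    · intro hs
      obtain ⟨x, hxU⟩ : Nonempty U := inferInstance
      obtain ⟨V, hxV, b, hb, hF⟩ := F.isSubbundle x
      have : Nonempty V := ⟨⟨_, hxV⟩⟩
      have : Nonempty (U ⊓ V : C.X.Opens) := ⟨⟨x, hxU, hxV⟩⟩
      obtain ⟨a, -, ha⟩ := key V b hb hF
      have h1 := F.restrict _ _ (inf_le_left : U ⊓ V ≤ U) s hs
      rw [hF _ inf_le_right] at h1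
      obtain ⟨f, hf⟩ := Submodule.mem_span_singleton.1 h1
      have h2 := congrArg (toGen hM (U ⊓ V)) hf
      rw [toGen_smul, toGen_res, toGen_res] at h2
      rw [← h2, ha, smul_smul, wedge_smul_right, wedge_self, mul_zero]
    · intro hs
      refine F.isLocal U s fun x hxU => ?_
      obtain ⟨V, hxV, b, hb, hF⟩ := F.isSubbundle x
      have : Nonempty V := ⟨⟨_, hxV⟩⟩
      have : Nonempty (U ⊓ V : C.X.Opens) := ⟨⟨x, hxU, hxV⟩⟩
      obtain ⟨a, -, ha⟩ := key V b hb hF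
      refine ⟨U ⊓ V, inf_le_left, ⟨hxU, hxV⟩, ?_⟩
      obtain ⟨f₀, f₁, h1, h2⟩ := hb.wedge_eq (hM := hM) (inf_le_right : U ⊓ V ≤ V)
        (resSection M inf_le_left s)
      rw [toGen_res, ha, wedge_smul_left, hs, mul_zero, ← ha, eq_comm, mul_eq_zero] at h2
      have h3 : f₁ = 0 :=
        toK_injective _ ((h2.resolve_right hb.wedge_ne_zero).trans (map_zero _).symm)
      rw [hF _ inf_le_right, h1, h3, zero_smul, add_zero]
      exact Submodule.smul_mem _ _ (Submodule.mem_span_singleton_self _)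

/-- The filtration defined by a line in the generic fibre. -/
noncomputable def Filtration.ofLine {v : Fin 2 → C.K} (hv : IsLine hM v) : Filtration M where
  F U :=
    { carrier := {s | ∀ _ : Nonempty U, wedge v (toGen hM U s) = 0}
      add_mem' := fun ha hb h => by rw [toGen_add, wedge_add_right, ha h, hb h, add_zero]
      zero_mem' := fun h => by rw [toGen_zero]; simp [wedge]
      smul_mem' := fun f s hs h => by rw [toGen_smul, wedge_smul_right, hs h, mul_zero] }
  restrict U V h s hs hV := by
    have : Nonempty U := ⟨⟨hV.some.1, h hV.some.2⟩⟩
    rw [toGen_res]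
    exact hs this
  isLocal U s hs hU := by
    obtain ⟨V, hVU, hxV, h⟩ := hs hU.some.1 hU.some.2
    have : Nonempty V := ⟨⟨_, hxV⟩⟩
    rw [← toGen_res hM hVU]
    exact h this
  isSubbundle x := by
    obtain ⟨V, hxV, b, hb, a, ha⟩ := hv x
    have : Nonempty V := ⟨⟨_, hxV⟩⟩
    have ha0 : a ≠ 0 := fun h => hb.toGen_ne_zero (hM := hM) (by rw [ha, h, zero_smul])
    refine ⟨V, hxV, b, hb, fun W hW => ?_⟩
    by_cases hn : Nonempty W
    · apply le_antisymm
      · intro s hs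
        obtain ⟨f₀, f₁, h1, h2⟩ := hb.wedge_eq (hM := hM) hW s
        rw [ha, wedge_smul_left, hs hn, mul_zero, ← ha, eq_comm, mul_eq_zero] at h2
        have h3 : f₁ = 0 :=
          toK_injective _ ((h2.resolve_right hb.wedge_ne_zero).trans (map_zero _).symm)
        rw [h1, h3, zero_smul, add_zero]
        exact Submodule.smul_mem _ _ (Submodule.mem_span_singleton_self _)
      · rw [Submodule.span_singleton_le_iff_mem]
        intro _
        rw [toGen_res, ha, wedge_smul_right, wedge_self, mul_zero]
    · have := subsingleton_sections_of_isEmpty (M := M) hn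
      exact Subsingleton.elim _ _

theorem Filtration.mem_ofLine {v : Fin 2 → C.K} (hv : IsLine hM v) (U : C.X.Opens) [hU : Nonempty U]
    (s : Γ(M, U)) : s ∈ (Filtration.ofLine hv).F U ↔ wedge v (toGen hM U s) = 0 :=
  ⟨fun h => h hU, fun h _ => h⟩

end Filtration

/-! ### Hodge filtrations as a condition at closed points -/

namespace FlatBundle

variable (E : FlatBundle C 2)

/-- The generic second fundamental form of a line in the generic fibre. -/
noncomputable def kappa (v : Fin 2 → C.K) : C.K := wedge v (E.genNabla v)

/-- The derivative term of the Leibniz rule is a multiple of `v`, and dies in the wedge. -/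
theorem kappa_smul (f : C.K) (v : Fin 2 → C.K) : E.kappa (f • v) = f ^ 2 * E.kappa v := by
  rw [kappa, genNabla_smul, wedge_add_right, wedge_smul_right, wedge_smul_right, wedge_smul_left,
    wedge_smul_left, wedge_self, kappa]
  ring

/-- The line spanned by `v` satisfies the condition for a Hodge filtration at `P`. -/
def IsHodgeAt (v : Fin 2 → C.K) (P : C.Point) : Prop :=
  ∃ (V : C.X.Opens) (hP : P.pt ∈ V) (b : Fin 2 → Γ(E.E, V)), IsFrame E.E V b ∧
    haveI := Point.nonempty hP
    (∃ a : C.K, E.gen V (b 0) = a • v) ∧ E.kappa (E.gen V (b 0)) ≠ 0 ∧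
    ∀ θ, IsLogAt P θ ↔
      θ * (E.kappa (E.gen V (b 0)) / wedge (E.gen V (b 0)) (E.gen V (b 1))) ∈ P.place.ring

theorem _root_.MarkedCurve.IsLogAt.mul {P : C.Point} {θ f : C.K} (h : IsLogAt P θ)
    (hf : f ∈ P.place.ring) : IsLogAt P (f * θ) := by
  intro g hg
  rw [mul_assoc]
  refine ⟨P.place.ring.mul_mem hf (h g hg).1, fun i hi => ?_⟩
  have := RationalPlace.mul_mem_ge (P := P.place) hf ((h g hg).2 i hi)
  rwa [zero_add] at this

variable {E}

/-- Only finitely many poles of `q` have to be removed. -/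
theorem _root_.MarkedCurve.exists_affine_forall_mem_ring {P : C.Point} {U : C.X.Opens}
    (hP : P.pt ∈ U) {q : C.K} (hq : q ≠ 0) : ∃ V : C.X.Opens, IsAffineOpen V ∧ V ≤ U ∧ P.pt ∈ V ∧
      ∀ Q : C.Point, Q.pt ∈ V → Q ≠ P → q ∈ Q.place.ring := by
  let T := {Q : C.Point | 0 < Q.place.ord q⁻¹} \ {P}
  have hT : T.Finite := (C.finite_setOf_ord_pos (inv_ne_zero hq)).subset Set.sdiff_subset
  have hcl : IsClosed (Point.pt '' T) := by
    rw [← Set.biUnion_of_singleton (Point.pt '' T)]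
    refine (hT.image _).isClosed_biUnion ?_
    rintro _ ⟨Q, -, rfl⟩
    exact Q.isClosed
  let W : C.X.Opens := U ⊓ ⟨(Point.pt '' T)ᶜ, hcl.isOpen_compl⟩
  have hPW : P.pt ∈ W := by
    refine ⟨hP, ?_⟩
    rintro ⟨Q, hQ, h⟩
    exact hQ.2 (Point.ext h)
  obtain ⟨V, hV, hVW, hPV⟩ := exists_affine_le W hPW
  refine ⟨V, hV, hVW.trans inf_le_left, hPV, fun Q hQ hQP _ => ?_⟩
  by_contra! h
  refine (hVW hQ).2 ⟨Q, ⟨?_, hQP⟩, rfl⟩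
  change 0 < Q.place.ord q⁻¹
  rw [Q.place.ord_inv hq]
  omega

/-- Surjectivity of the Kodaira–Spencer map, applied to `b₀ ↦ b₁ mod F¹`, yields `D` with `∇(D) b₀ ≡
b₁`; wedging with `b₀` gives the identity. -/
theorem IsHodge.exists_logVF {F : Filtration E.E} (hF : E.IsHodge F) {v : Fin 2 → C.K}
    (hline : IsLine E.isVectorBundle v)
    (hv : ∀ (U : C.X.Opens) [Nonempty U] (s : Γ(E.E, U)), s ∈ F.F U ↔ wedge v (E.gen U s) = 0)
    (P : C.Point) : ∃ (V : C.X.Opens) (hP : P.pt ∈ V) (b : Fin 2 → Γ(E.E, V))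
      (U : C.X.Opens) (hU : IsAffineOpen U) (_ : U ≤ V) (hPU : P.pt ∈ U) (D : C.logVF U),
    haveI := Point.nonempty hP
    haveI := Point.nonempty hPU
    IsFrame E.E V b ∧ (∃ a : C.K, E.gen V (b 0) = a • v) ∧
      theta hU D.1 * E.kappa (E.gen V (b 0)) = wedge (E.gen V (b 0)) (E.gen V (b 1)) := by
  obtain ⟨V, hP, b, hb, a, ha⟩ := hline P.pt
  have := Point.nonempty hP
  obtain ⟨U, hU, hUV, hPU⟩ := exists_affine_le V hP
  have := Point.nonempty hPU
  have hs0 : resSection E.E hUV (b 0) ∈ F.F U := by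
    rw [hv, gen, toGen_res, ha, wedge_smul_right, wedge_self, mul_zero]
  let φ : F.F U →ₗ[Γ(C.X, U)] (Γ(E.E, U) ⧸ F.F U) :=
    (LinearMap.toSpanSingleton Γ(C.X, U) _ ((F.F U).mkQ (resSection E.E hUV (b 1)))) ∘ₗ
      ((hb.basis hUV).coord 0) ∘ₗ (F.F U).subtype
  obtain ⟨D₀, hD₀⟩ := (hF ⟨U, hU⟩).2 φ
  have h1 : (F.F U).mkQ (E.nabla ⟨U, hU⟩ D₀ (resSection E.E hUV (b 0))) =
      (F.F U).mkQ (resSection E.E hUV (b 1)) := by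
    refine (congr($hD₀ ⟨_, hs0⟩)).trans ?_
    change ((hb.basis hUV).repr (resSection E.E hUV (b 0)) 0) •
      (F.F U).mkQ (resSection E.E hUV (b 1)) = _
    rw [← hb.basis_apply hUV 0, Module.Basis.repr_self, Finsupp.single_eq_same, one_smul]
  have h2 := (Submodule.Quotient.eq _).1 h1
  rw [hv] at h2
  refine ⟨V, hP, b, U, hU, hUV, hPU, D₀, hb, ⟨a, ha⟩, ?_⟩
  have h4 := congrArg (a * ·) h2
  simp only [mul_zero] at h4
  rw [← wedge_smul_left, ← ha, gen, toGen_sub, wedge_sub_right, sub_eq_zero] at h4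
  have h5 := E.gen_nabla (U := ⟨U, hU⟩) D₀ (resSection E.E hUV (b 0))
  have h6 : toGen E.isVectorBundle U (resSection E.E hUV (b 0)) = E.gen V (b 0) := toGen_res _ _ _
  have h7 : toGen E.isVectorBundle U (resSection E.E hUV (b 1)) = E.gen V (b 1) := toGen_res _ _ _
  rw [gen, gen, h6] at h5
  rw [h5, h7, wedge_smul_right] at h4
  exact h4

/-- For the vector field `D₀` of `IsHodge.exists_logVF`, the factor κ(b₀)/(b₀ ∧ b₁) is the inverse
of the coefficient of `D₀`. So the claim is that `D₀` generates the logarithmic vector fields at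
`P`: for such a field, the ratio to `D₀` is the `b₁`-coordinate of the derivative of `b₀`, hence
regular. -/
theorem IsHodge.isHodgeAt {F : Filtration E.E} (hF : E.IsHodge F) {v : Fin 2 → C.K}
    (hline : IsLine E.isVectorBundle v)
    (hv : ∀ (U : C.X.Opens) [Nonempty U] (s : Γ(E.E, U)), s ∈ F.F U ↔ wedge v (E.gen U s) = 0)
    (P : C.Point) : E.IsHodgeAt v P := by
  obtain ⟨V, hP, b, U, hU, hUV, hPU, D₀, hb, ⟨a, ha⟩, h3⟩ := hF.exists_logVF hline hv P
  have := Point.nonempty hP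
  have := Point.nonempty hPU
  have hw : wedge (E.gen V (b 0)) (E.gen V (b 1)) ≠ 0 := hb.wedge_ne_zero
  have hκ : E.kappa (E.gen V (b 0)) ≠ 0 := fun h => hw (by rw [← h3, h, mul_zero])
  have hθ : theta hU D₀.1 ≠ 0 := fun h => hw (by rw [← h3, h, zero_mul])
  refine ⟨V, hP, b, hb, ⟨a, ha⟩, hκ, fun θ => ?_⟩
  rw [← h3, div_mul_cancel_right₀ hκ, ← div_eq_mul_inv]
  constructor
  · intro hlog
    by_cases h0 : θ = 0
    · rw [h0, zero_div]
      exact zero_mem _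
    -- After shrinking, `θ` is a regular multiple of the coefficient of `D₀` away from `P`. Together
    -- with the hypothesis at `P`, this makes `θ` a logarithmic vector field on `W`.
    obtain ⟨W, hW, hWU, hPW, hq⟩ := exists_affine_forall_mem_ring hPU (div_ne_zero h0 hθ)
    have := Point.nonempty hPW
    obtain ⟨D, hD⟩ := exists_logVF_theta_eq (U := W) hW (θ := θ) (by
      intro Q hQ
      by_cases hQP : Q = P
      · rwa [hQP]
      · rw [← div_mul_cancel₀ θ hθ]
        exact (isLogAt_theta hU D₀ (hWU hQ)).mul (hq Q hQ hQP))
    have h8 := E.gen_nabla (U := ⟨W, hW⟩) D (resSection E.E (hWU.trans hUV) (b 0))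
    have h9 : toGen E.isVectorBundle W (resSection E.E (hWU.trans hUV) (b 0)) = E.gen V (b 0) :=
      toGen_res _ _ _
    have h10 := wedge_div_mem_ring hb hP (inLattice_toGen (hM := E.isVectorBundle) hPW
      (E.nabla ⟨W, hW⟩ D (resSection E.E (hWU.trans hUV) (b 0))))
    rw [gen, gen, h9] at h8
    rw [h8, wedge_smul_right] at h10
    change theta hW D.1 * E.kappa (E.gen V (b 0)) / wedge (E.gen V (b 0)) (E.gen V (b 1)) ∈ _ at h10
    rwa [hD, ← h3, mul_div_mul_right _ _ hκ] at h10
  · intro hmem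
    rw [← div_mul_cancel₀ θ hθ]
    exact (isLogAt_theta hU D₀ hPU).mul hmem

/-- Injectivity holds because κ(v) ≠ 0. For surjectivity, a linear map out of the rank one `F¹` is
generically multiplication by one scalar, which determines the coefficient `θ` of the required
vector field; the local conditions say that this `θ` is logarithmic everywhere on `U`. -/
theorem IsHodge.of_forall_isHodgeAt {F : Filtration E.E} {v : Fin 2 → C.K} (hv0 : v ≠ 0)
    (hv : ∀ (U : C.X.Opens) [Nonempty U] (s : Γ(E.E, U)), s ∈ F.F U ↔ wedge v (E.gen U s) = 0)
    (h : ∀ P, E.IsHodgeAt v P) : E.IsHodge F := by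
  rintro ⟨U, hU⟩
  by_cases hn : Nonempty U
  swap
  · have := subsingleton_functions_of_isEmpty hn
    have := subsingleton_sections_of_isEmpty (M := E.E) hn
    have h1 : Subsingleton (Γ(E.E, U) ⧸ F.F U) := (F.F U).mkQ_surjective.subsingleton
    refine ⟨fun D D' _ => ?_, fun φ => ⟨0, ?_⟩⟩
    · ext f
      exact Subsingleton.elim _ _
    · ext e
      exact Subsingleton.elim (α := Γ(E.E, U) ⧸ F.F U) _ _
  -- Near each `P` the local generator of the line, multiplied by a function that is a unit at `P`,
  -- extends to a section of `F¹` over all of `U`.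
  have hex : ∀ P : C.Point, P.pt ∈ U → ∃ (V : C.X.Opens) (hP : P.pt ∈ V) (b : Fin 2 → Γ(E.E, V))
      (e : F.F U), haveI := Point.nonempty hP
      IsFrame E.E V b ∧ E.kappa (E.gen V (b 0)) ≠ 0 ∧ (∀ θ, IsLogAt P θ ↔
        θ * (E.kappa (E.gen V (b 0)) / wedge (E.gen V (b 0)) (E.gen V (b 1))) ∈ P.place.ring) ∧
      ∃ c d : C.K, c ≠ 0 ∧ d ≠ 0 ∧ P.place.ord c = 0 ∧ E.gen U e.1 = c • E.gen V (b 0) ∧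
        E.gen U e.1 = d • v := by
    intro P hPU
    obtain ⟨V, hP, b, hb, ⟨a, ha⟩, hκ, hlog⟩ := h P
    have := Point.nonempty hP
    obtain ⟨f, s, hf0, hf, hs⟩ := exists_toGen_eq_smul hU hPU
      (inLattice_toGen (hM := E.isVectorBundle) hP (b 0))
    have hs' : E.gen U s = (C.toK U f * a) • v := by
      rw [gen, hs, mul_smul, ← ha]
    refine ⟨V, hP, b, ⟨s, ?_⟩, hb, hκ, hlog, _, _, hf0, mul_ne_zero hf0 ?_, hf, hs, hs'⟩
    · rw [hv, hs', wedge_smul_right, wedge_self, mul_zero]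
    · rintro rfl
      rw [zero_smul] at ha
      exact hb.toGen_ne_zero (hM := E.isVectorBundle) ha
  obtain ⟨P₀, hP₀⟩ := Point.exists_mem (C := C) (U := U) ⟨_, hn.some.2⟩
  obtain ⟨V₀, hPV₀, b₀, e₀, hb₀, hκ₀, -, c₀, d₀, hc₀, hd₀, -, he₀, he₀'⟩ := hex P₀ hP₀
  have := Point.nonempty hPV₀
  have hκv : E.kappa v ≠ 0 := by
    have h1 := E.kappa_smul d₀ v
    rw [← he₀', he₀, kappa_smul] at h1
    intro h0
    rw [h0, mul_zero] at h1
    exact mul_ne_zero (pow_ne_zero 2 hc₀) hκ₀ h1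
  have hκe : E.kappa (E.gen U e₀.1) ≠ 0 := by
    rw [he₀', kappa_smul]
    exact mul_ne_zero (pow_ne_zero 2 hd₀) hκv
  constructor
  · rw [injective_iff_map_eq_zero]
    intro D hD
    have h1 : (F.F U).mkQ (E.nabla ⟨U, hU⟩ D e₀.1) = 0 := congr($hD e₀)
    rw [Submodule.mkQ_apply, Submodule.Quotient.mk_eq_zero, hv] at h1
    have h2 := E.gen_nabla (U := ⟨U, hU⟩) D e₀.1
    rw [h2, wedge_smul_right] at h1
    have h3 : theta hU D.1 * E.kappa (E.gen U e₀.1) = 0 := by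
      have h4 : E.kappa (E.gen U e₀.1) = d₀ * wedge v (E.genNabla (E.gen U e₀.1)) := by
        rw [← wedge_smul_left, ← he₀', kappa]
      rw [h4, mul_left_comm]
      exact (congrArg (d₀ * ·) h1).trans (mul_zero _)
    ext1
    apply theta_injective hU
    rw [(mul_eq_zero.1 h3).resolve_right hκe]
    exact (theta_eq_of_forall hU fun f => by simp).symm
  · intro φ
    choose y hy using fun e => (F.F U).mkQ_surjective (φ e)
    -- Any two elements of `F¹` are proportional over the functions on `U`, so linearity of `φ`
    -- determines it from its value at `e₀`.
    have hprop : ∀ (e : F.F U) (c : C.K), E.gen U e.1 = c • v → ∀ c₀ : C.K,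
        c₀ ≠ 0 → E.gen U e₀.1 = c₀ • v →
        c₀ * wedge v (E.gen U (y e)) = c * wedge v (E.gen U (y e₀)) := by
      intro e c he c₀ hc₀ he₀
      have := isFractionRing_toK hU
      obtain ⟨p, q, hq, hpq⟩ := IsFractionRing.div_surjective (A := Γ(C.X, U)) (c / c₀)
      have hq0 : C.toK U q ≠ 0 := by
        rw [Ne, map_eq_zero_iff _ (toK_injective U)]
        exact nonZeroDivisors.ne_zero hq
      change C.toK U p / C.toK U q = _ at hpq
      rw [div_eq_div_iff hq0 hc₀] at hpq
      have h1 : q • e = p • e₀ := by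
        ext1
        apply toGen_injective (hM := E.isVectorBundle)
        change E.gen U (q • e.1) = E.gen U (p • e₀.1)
        rw [gen, toGen_smul, gen, toGen_smul]
        change C.toK U q • E.gen U e.1 = C.toK U p • E.gen U e₀.1
        rw [he, he₀, smul_smul, smul_smul, hpq, mul_comm]
      have h2 : (F.F U).mkQ (q • y e) = (F.F U).mkQ (p • y e₀) := by
        rw [map_smul, map_smul, hy, hy, ← map_smul, ← map_smul, h1]
      have h3 := (Submodule.Quotient.eq _).1 h2
      rw [hv, gen, toGen_sub, toGen_smul, toGen_smul, wedge_sub_right, wedge_smul_right,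
        wedge_smul_right, sub_eq_zero] at h3
      apply mul_left_cancel₀ hq0
      linear_combination c₀ * h3 + wedge v (E.gen U (y e₀)) * hpq
    let θ := wedge v (E.gen U (y e₀)) / (d₀ * E.kappa v)
    have hθ : ∀ (e : F.F U) (c : C.K), E.gen U e.1 = c • v →
        θ * (c * E.kappa v) = wedge v (E.gen U (y e)) := by
      intro e c he
      have h1 := hprop e c he d₀ hd₀ he₀'
      simp only [θ]
      field_simp
      linear_combination -h1
    obtain ⟨D, hD⟩ := exists_logVF_theta_eq (U := U) hU (θ := θ) (by
      intro P hP
      obtain ⟨V, hPV, b, e, hb, hκ, hlog, c, d, hc, hd, hcP, he, he'⟩ := hex P hP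
      have := Point.nonempty hPV
      rw [hlog]
      have h1 := wedge_div_mem_ring hb hPV (inLattice_toGen (hM := E.isVectorBundle) hP (y e))
      have h2 := hθ e d he'
      have h3 : (d / c) • v = E.gen V (b 0) := by
        rw [div_eq_inv_mul, mul_smul, ← he', he, smul_smul, inv_mul_cancel₀ hc, one_smul]
      have h4 : θ * E.kappa (E.gen V (b 0)) =
          c⁻¹ * wedge (E.gen V (b 0)) (E.gen U (y e)) := by
        rw [← h3, kappa_smul, wedge_smul_left, ← h2]
        field_simp
      rw [← mul_div_assoc, h4, mul_div_assoc]
      refine P.place.ring.mul_mem ?_ h1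
      intro _
      rw [P.place.ord_inv hc, hcP, neg_zero])
    refine ⟨D, ?_⟩
    ext e
    change (F.F U).mkQ (E.nabla ⟨U, hU⟩ D e.1) = φ e
    rw [← hy]
    refine (Submodule.Quotient.eq _).2 ?_
    have he : ∃ c : C.K, E.gen U e.1 = c • v := (wedge_eq_zero_iff hv0).1 ((hv U e.1).1 e.2)
    obtain ⟨c, hc⟩ := he
    have h1 := E.gen_nabla (U := ⟨U, hU⟩) D e.1
    rw [hv, gen, toGen_sub, wedge_sub_right, sub_eq_zero]
    refine (congrArg (wedge v) h1).trans ?_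
    rw [wedge_smul_right, hc, genNabla_smul, wedge_add_right, wedge_smul_right, wedge_smul_right,
      wedge_self, mul_zero, add_zero]
    exact (congrArg (· * _) hD).trans (hθ e c hc)

end FlatBundle

/-! ### Monodromy at the marked points -/

namespace FlatBundle

variable {k : Type u} [Field k] [IsAlgClosed k] {r : ℕ} {C : MarkedCurve k r} {E : FlatBundle C 2}

/-- A marked point as a closed point. -/
def _root_.MarkedCurve.markedPoint (C : MarkedCurve k r) (i : Fin r) : C.Point :=
  ⟨C.pt i, C.isClosed_pt i⟩

theorem wedge_div_mem_of_mem_fiberKer {U : C.X.affineOpens} {P : C.Point} (hPU : P.pt ∈ U.1)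
    {V : C.X.Opens} [Nonempty U.1] [Nonempty V] {b : Fin 2 → Γ(E.E, V)} (hb : IsFrame E.E V b)
    (hPV : P.pt ∈ V) {s : Γ(E.E, U.1)} (hs : s ∈ E.fiberKer U P.pt hPU) :
    wedge (E.gen V (b 0)) (E.gen U.1 s) / wedge (E.gen V (b 0)) (E.gen V (b 1)) ∈ P.place.ge 1 := by
  rw [fiberKer, Submodule.restrictScalars_mem] at hs
  refine Submodule.smul_induction_on hs ?_ ?_
  · intro f hf s _
    rw [gen, gen, gen, toGen_smul, wedge_smul_right, mul_div_assoc]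
    exact RationalPlace.mul_mem_ge (m := 1) (n := 0) ((evaluation_eq_zero_iff hPU f).1 hf)
      (wedge_div_mem_ring hb hPV (inLattice_toGen hPU s))
  · intro s t hs ht
    rw [gen, gen, gen, toGen_add, wedge_add_right, add_div]
    exact add_mem hs ht

theorem _root_.MarkedCurve.LogCoordinate.toK_t_mem {i : Fin r} (z : C.LogCoordinate i)
    [Nonempty z.U.1] : C.toK z.U.1 z.t ∈ (C.markedPoint i).place.ge 1 ∧
      C.toK z.U.1 z.t ∉ (C.markedPoint i).place.ge 2 := by
  have hmem : (C.markedPoint i).pt ∈ z.U.1 := z.mem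
  rw [toK_eq_algebraMap_germ hmem]
  constructor
  · rw [Point.mem_place_ge_one_iff]
    change _ ∈ IsLocalRing.maximalIdeal (C.X.presheaf.stalk (C.pt i))
    rw [← z.isParameter]
    exact Ideal.mem_span_singleton_self _
  · intro h2
    obtain ⟨t, ht0, ht⟩ := (C.markedPoint i).place.exists_ord_eq_one
    obtain ⟨g, rfl⟩ := ((C.markedPoint i).mem_place_ring_iff t).1 (fun _ => by omega)
    have hg := ((C.markedPoint i).mem_place_ge_one_iff g).1 (fun _ => ht.ge)
    change g ∈ IsLocalRing.maximalIdeal (C.X.presheaf.stalk (C.pt i)) at hg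
    rw [← z.isParameter] at hg
    obtain ⟨a, rfl⟩ := Ideal.mem_span_singleton'.1 hg
    have h3 : algebraMap _ C.K a ∈ (C.markedPoint i).place.ge 0 :=
      ((C.markedPoint i).mem_place_ring_iff _).2 ⟨a, rfl⟩
    have h4 := RationalPlace.mul_mem_ge h3 h2
    rw [← map_mul] at h4
    have h5 := (h4 ht0).trans_eq ht
    omega

/-- Let `κ` be the Kodaira–Spencer factor at the marked point and `θ` the coefficient of `t ∂/∂t`.
If the monodromy were a scalar, it would preserve `F¹` in the fibre, so `θ * κ` would vanish there.
But `κ⁻¹` is the coefficient of a logarithmic vector field, so `κ⁻¹ * vf t` vanishes as well. The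
product of the two is `t`, which would vanish doubly. -/
theorem IsHodge.monodromy_ne {F : Filtration E.E} (hF : E.IsHodge F) {i : Fin r}
    (z : C.LogCoordinate i) (c : k) : E.monodromy z ≠ algebraMap k _ c := by
  intro hμ
  let P := C.markedPoint i
  have hPU : P.pt ∈ z.U.1 := z.mem
  have hUn := Point.nonempty hPU
  obtain ⟨v, -, hline, hv⟩ := F.exists_line E.isVectorBundle
  obtain ⟨V, hPV, b, hb, -, hκ, hlog⟩ := hF.isHodgeAt hline hv P
  have := Point.nonempty hPV
  obtain ⟨f, e, hf0, hf, he⟩ := exists_toGen_eq_smul z.U.2 hPU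
    (inLattice_toGen (hM := E.isVectorBundle) hPV (b 0))
  have hw : wedge (E.gen V (b 0)) (E.gen V (b 1)) ≠ 0 := hb.wedge_ne_zero
  set κ := E.kappa (E.gen V (b 0)) / wedge (E.gen V (b 0)) (E.gen V (b 1)) with hκdef
  have hκ0 : κ ≠ 0 := div_ne_zero hκ hw
  set θ := theta z.U.2 z.D.1
  have h1 : E.nabla z.U z.D e - algebraMap k Γ(C.X, z.U.1) c • e ∈
      E.fiberKer z.U (C.pt i) z.mem := by
    have h2 := congr($hμ (Submodule.Quotient.mk e))
    exact (Submodule.Quotient.eq _).1 h2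
  have h2 := wedge_div_mem_of_mem_fiberKer (P := P) hPU hb hPV h1
  have h3 : E.gen z.U.1 (E.nabla z.U z.D e - algebraMap k Γ(C.X, z.U.1) c • e) =
      θ • E.genNabla (C.toK z.U.1 f • E.gen V (b 0)) -
        C.toK z.U.1 (algebraMap k Γ(C.X, z.U.1) c) • C.toK z.U.1 f • E.gen V (b 0) := by
    have h4 := E.gen_nabla z.D e
    rw [gen, gen] at h4
    rw [gen, toGen_sub, toGen_smul, h4, he]
  -- Wedging with `b₀` removes both the scalar term and the derivative of the factor `f`, leaving `f
  -- * θ * κ`.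
  rw [h3, genNabla_smul, wedge_sub_right] at h2
  simp only [wedge_smul_right, wedge_add_right, wedge_self, mul_zero, add_zero, sub_zero] at h2
  have h4 : θ * κ ∈ P.place.ge 1 := by
    have hinv : (C.toK z.U.1 f)⁻¹ ∈ P.place.ge 0 := fun _ => by
      rw [P.place.ord_inv hf0, hf, neg_zero]
    have h5 := RationalPlace.mul_mem_ge hinv h2
    rw [zero_add] at h5
    convert h5 using 1
    rw [hκdef, kappa]
    field_simp
  have h5 : IsLogAt P κ⁻¹ := by
    rw [hlog, inv_mul_cancel₀ hκ0]
    exact P.place.ring.one_mem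
  have h6 := (h5 _ (toK_mem_ring hPU z.t)).2 i rfl
  have h7 := RationalPlace.mul_mem_ge h4 h6
  have h8 := toK_apply z.U.2 z.D.1 z.t
  rw [z.D_t] at h8
  rw [mul_assoc, mul_inv_cancel_left₀ hκ0] at h7
  exact z.toK_t_mem.2 (h8 ▸ h7)

/-- With equal exponents, Cayley–Hamilton makes the operator minus the scalar nilpotent. It is also
semisimple, hence zero, and the monodromy would be a scalar. -/
theorem IsHodge.ne_of_hasExponents {F : Filtration E.E} (hF : E.IsHodge F) {i : Fin r}
    {z : C.LogCoordinate i} (hz : E.IsToric z) {α β : k} (h : E.HasExponents z α β) : α ≠ β := by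
  rintro rfl
  obtain ⟨b, hb⟩ := h
  refine hF.monodromy_ne z α (sub_eq_zero.1 ?_)
  refine Module.End.eq_zero_of_isNilpotent_isSemisimple ⟨2, ?_⟩
    ((Module.End.isSemisimple_sub_algebraMap_iff).2 hz)
  have := Module.Finite.of_basis b
  have := Module.Free.of_basis b
  rw [LinearMap.charpoly_toMatrix] at hb
  have h1 := LinearMap.aeval_self_charpoly (E.monodromy z)
  rw [hb] at h1
  simpa [pow_two] using h1

end FlatBundle

/-! ### Twisting by a flat line bundle -/

theorem wedge_map {K : Type*} [Field K] (A : (Fin 2 → K) →ₗ[K] Fin 2 → K) (v w : Fin 2 → K) :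
    wedge (A v) (A w) = wedge (A (Pi.single 0 1)) (A (Pi.single 1 1)) * wedge v w := by
  have h : ∀ v : Fin 2 → K, A v = v 0 • A (Pi.single 0 1) + v 1 • A (Pi.single 1 1) := by
    intro v
    rw [← map_smul, ← map_smul, ← map_add]
    congr 1
    ext i
    fin_cases i <;> simp
  rw [h v, h w]
  simp only [wedge, Pi.add_apply, Pi.smul_apply, smul_eq_mul]
  ring

namespace FlatBundle

variable {k : Type u} [Field k] [IsAlgClosed k] {r : ℕ} {C : MarkedCurve k r}

namespace HorizontalTensorIso

variable {n : ℕ} {E E' : FlatBundle C n} {L : FlatBundle C 1} (T : HorizontalTensorIso E L E')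

-- Bilinearity and compatibility with restriction determine the isomorphism from its values on
-- generic frames. The coordinate of `l` in the one-dimensional generic fibre of `L` splits off as a
-- scalar.
include T in
theorem exists_linearMap : ∃ A : (Fin n → C.K) →ₗ[C.K] Fin n → C.K,
    ∀ (U : C.X.affineOpens) [Nonempty U.1] (e : Γ(E.E, U.1)) (l : Γ(L.E, U.1)),
      E'.gen U.1 (T.iso U (e ⊗ₜ l)) = L.gen U.1 l 0 • A (E.gen U.1 e) := by
  have := nonempty_inf (genOpens E.isVectorBundle) (genOpens L.isVectorBundle)
  obtain ⟨W, hW, hWle, hxW⟩ := exists_affine_le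
    (genOpens E.isVectorBundle ⊓ genOpens L.isVectorBundle)
    (Classical.arbitrary (genOpens E.isVectorBundle ⊓ genOpens L.isVectorBundle : C.X.Opens)).2
  have hWn : Nonempty W := ⟨⟨_, hxW⟩⟩
  have hWE := hWle.trans inf_le_left
  have hWL := hWle.trans inf_le_right
  let c (j : Fin n) : Fin n → C.K := E'.gen W (T.iso ⟨W, hW⟩
    (resSection E.E hWE (genFrame E.isVectorBundle j) ⊗ₜ
      resSection L.E hWL (genFrame L.isVectorBundle 0)))
  refine ⟨Fintype.linearCombination C.K c, fun U _ e l => ?_⟩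
  have := nonempty_inf U.1 W
  obtain ⟨V, hV, hVle, hxV⟩ := exists_affine_le (U.1 ⊓ W)
    (Classical.arbitrary (U.1 ⊓ W : C.X.Opens)).2
  have hVn : Nonempty V := ⟨⟨_, hxV⟩⟩
  have hVU := hVle.trans inf_le_left
  have hVW := hVle.trans inf_le_right
  obtain ⟨a, ha, -⟩ := exists_eq_sum_toGen (hM := E.isVectorBundle)
    (isFrame_genFrame E.isVectorBundle) (hVW.trans hWE) (resSection E.E hVU e)
  have hae : E.gen U.1 e = fun j => C.toK V (a j) := by
    rw [gen, ← toGen_res E.isVectorBundle hVU, ha]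
    simp only [toGen_sum, toGen_smul, toGen_genFrame]
    ext j
    simp [Finset.sum_apply, Pi.single_apply]
  obtain ⟨d, hd, -⟩ := exists_eq_sum_toGen (hM := L.isVectorBundle)
    (isFrame_genFrame L.isVectorBundle) (hVW.trans hWL) (resSection L.E hVU l)
  rw [Fin.sum_univ_one] at hd
  have hdl : L.gen U.1 l 0 = C.toK V (d 0) := by
    rw [gen, ← toGen_res L.isVectorBundle hVU, hd, toGen_smul, toGen_genFrame]
    simp
  have h1 : E'.gen U.1 (T.iso U (e ⊗ₜ l)) =
      E'.gen V (T.iso ⟨V, hV⟩ (resSection E.E hVU e ⊗ₜ resSection L.E hVU l)) := by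
    rw [T.restrict U ⟨V, hV⟩ hVU e l]
    exact (toGen_res _ _ _).symm
  have h2 : ∀ j, E'.gen V (T.iso ⟨V, hV⟩
      (resSection E.E (hVW.trans hWE) (genFrame E.isVectorBundle j) ⊗ₜ
        resSection L.E (hVW.trans hWL) (genFrame L.isVectorBundle 0))) = c j := by
    intro j
    have h3 := T.restrict ⟨W, hW⟩ ⟨V, hV⟩ hVW
      (resSection E.E hWE (genFrame E.isVectorBundle j))
      (resSection L.E hWL (genFrame L.isVectorBundle 0))
    rw [resSection_resSection, resSection_resSection] at h3
    rw [h3]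
    exact toGen_res _ _ _
  have h4 : T.iso ⟨V, hV⟩ (resSection E.E hVU e ⊗ₜ resSection L.E hVU l) =
      ∑ j, (d 0 * a j) • T.iso ⟨V, hV⟩
        (resSection E.E (hVW.trans hWE) (genFrame E.isVectorBundle j) ⊗ₜ
        resSection L.E (hVW.trans hWL) (genFrame L.isVectorBundle 0)) := by
    rw [ha, hd, TensorProduct.sum_tmul, map_sum]
    refine Finset.sum_congr rfl fun j _ => ?_
    rw [TensorProduct.smul_tmul_smul, map_smul, mul_comm]
  rw [h1, h4, gen, toGen_sum, hae, hdl, Fintype.linearCombination_apply, Finset.smul_sum]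
  refine Finset.sum_congr rfl fun j _ => ?_
  rw [toGen_smul, map_mul, mul_smul, ← h2 j]

/-- The action of the isomorphism on the generic fibres. -/
noncomputable def genMap : (Fin n → C.K) →ₗ[C.K] Fin n → C.K := T.exists_linearMap.choose

theorem gen_iso (U : C.X.affineOpens) [Nonempty U.1] (e : Γ(E.E, U.1)) (l : Γ(L.E, U.1)) :
    E'.gen U.1 (T.iso U (e ⊗ₜ l)) = L.gen U.1 l 0 • T.genMap (E.gen U.1 e) :=
  T.exists_linearMap.choose_spec U e l

/-- The frame is tensored with a local generator of `L`. The isomorphism is onto over every affine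
open subset, so the lattices of `E'` are spanned by the images; the factor `c` is the generic
coordinate of the generator. -/
theorem exists_isFrame {P : C.Point} {V : C.X.Opens} (hP : P.pt ∈ V) {b : Fin n → Γ(E.E, V)}
    (hb : IsFrame E.E V b) : ∃ (W : C.X.Opens) (hPW : P.pt ∈ W) (b' : Fin n → Γ(E'.E, W)),
      haveI := Point.nonempty hP
      haveI := Point.nonempty hPW
      IsFrame E'.E W b' ∧ ∃ c : C.K, c ≠ 0 ∧
        ∀ j, E'.gen W (b' j) = c • T.genMap (E.gen V (b j)) := by
  have := Point.nonempty hP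
  obtain ⟨V', hPV', l, hl⟩ := L.isVectorBundle P.pt
  have := Point.nonempty hPV'
  obtain ⟨W, hW, hWle, hPW⟩ := exists_affine_le (V ⊓ V') ⟨hP, hPV'⟩
  have := Point.nonempty hPW
  have hWV := hWle.trans inf_le_left
  have hWV' := hWle.trans inf_le_right
  let b' (j : Fin n) : Γ(E'.E, W) :=
    T.iso ⟨W, hW⟩ (resSection E.E hWV (b j) ⊗ₜ resSection L.E hWV' (l 0))
  have hc : L.gen V' (l 0) 0 ≠ 0 := by
    intro h
    refine (linearIndependent_toGen (hM := L.isVectorBundle) hl).ne_zero 0 ?_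
    ext i
    rw [Subsingleton.elim i 0]
    exact h
  have hgen : ∀ j, E'.gen W (b' j) = L.gen V' (l 0) 0 • T.genMap (E.gen V (b j)) := by
    intro j
    refine (T.gen_iso ⟨W, hW⟩ _ _).trans ?_
    rw [gen, toGen_res, gen, toGen_res]
  have hlat : ∀ Q : C.Point, Q.pt ∈ W → ∀ v, InLattice E'.isVectorBundle Q v →
      ∃ a : Fin n → C.K, (∀ j, a j ∈ Q.place.ring) ∧ v = ∑ j, a j • E'.gen W (b' j) := by
    rintro Q hQ v ⟨U, hQU, s, hs⟩
    have := Point.nonempty hQU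
    obtain ⟨U', hU', hUle, hQU'⟩ := exists_affine_le (U ⊓ W) ⟨hQU, hQ⟩
    have := Point.nonempty hQU'
    have hUU := hUle.trans inf_le_left
    have hUW := hUle.trans inf_le_right
    obtain ⟨τ, hτ⟩ := (T.iso ⟨U', hU'⟩).surjective (resSection E'.E hUU s)
    have hv : v = E'.gen U' (T.iso ⟨U', hU'⟩ τ) := by
      rw [hτ, gen, toGen_res, hs]
    rw [hv]
    clear hv hτ hs
    induction τ with
    | zero =>
      refine ⟨0, fun _ => zero_mem _, ?_⟩
      rw [map_zero, gen, toGen_zero]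
      simp
    | add x y hx hy =>
      obtain ⟨a, ha, hx⟩ := hx
      obtain ⟨a', ha', hy⟩ := hy
      refine ⟨a + a', fun j => add_mem (ha j) (ha' j), ?_⟩
      rw [map_add, gen, toGen_add]
      simp only [Pi.add_apply, add_smul, Finset.sum_add_distrib]
      exact congrArg₂ _ hx hy
    | tmul e m =>
      obtain ⟨a, -, ha⟩ := exists_eq_sum_toGen (hM := E.isVectorBundle) hb (hUW.trans hWV) e
      obtain ⟨d, -, hd⟩ := exists_eq_sum_toGen (hM := L.isVectorBundle) hl (hUW.trans hWV') m
      refine ⟨fun j => C.toK U' (d 0) * C.toK U' (a j), fun j =>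
        mul_mem (toK_mem_ring hQU' _) (toK_mem_ring hQU' _), ?_⟩
      refine (T.gen_iso ⟨U', hU'⟩ e m).trans ?_
      rw [gen, gen, ha, hd, Fin.sum_univ_one, map_sum, Finset.smul_sum]
      refine Finset.sum_congr rfl fun j _ => ?_
      rw [hgen, map_smul, Pi.smul_apply, smul_eq_mul, smul_smul, smul_smul]
      congr 1
      ring
  refine ⟨W, hPW, b', isFrame_of_toGen (hM := E'.isVectorBundle) ?_ hlat, _, hc, hgen⟩
  refine linearIndependent_of_top_le_span_of_card_eq_finrank ?_ (by simp)
  obtain ⟨U, hPU, b₂, hb₂⟩ := E'.isVectorBundle P.pt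
  have := Point.nonempty hPU
  rw [← (linearIndependent_toGen (hM := E'.isVectorBundle) hb₂).span_eq_top_of_card_eq_finrank'
    (by simp), Submodule.span_le]
  rintro _ ⟨j, rfl⟩
  obtain ⟨a, -, ha⟩ := hlat P hPW _ (inLattice_toGen hPU (b₂ j))
  change toGen E'.isVectorBundle U (b₂ j) ∈ _
  rw [ha]
  exact Submodule.sum_mem _ fun i _ => Submodule.smul_mem _ _ (Submodule.subset_span ⟨i, rfl⟩)

end HorizontalTensorIso

namespace HorizontalTensorIso

variable {E E' : FlatBundle C 2} {L : FlatBundle C 1} (T : HorizontalTensorIso E L E')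

/-- The derivatives of the generator of `L` and of its coordinate only contribute multiples of the
image of `v`, which die in the wedge; what remains is the determinant of `T.genMap`. A nonzero
vector field is needed because otherwise horizontality says nothing about the generic operators. -/
theorem kappa_genMap {U : C.X.affineOpens} [Nonempty U.1] {D : C.logVF U.1}
    (hD : theta U.2 D.1 ≠ 0) {V : C.X.Opens} [Nonempty V] (s : Γ(E.E, V)) :
    E'.kappa (T.genMap (E.gen V s)) =
      wedge (T.genMap (Pi.single 0 1)) (T.genMap (Pi.single 1 1)) * E.kappa (E.gen V s) := by
  obtain ⟨V', hV', l, hl⟩ := L.isVectorBundle (genericPoint C.X)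
  have : Nonempty V' := ⟨⟨_, hV'⟩⟩
  have := nonempty_inf U.1 V
  have := nonempty_inf (U.1 ⊓ V) V'
  obtain ⟨W, hW, hWle, hxW⟩ := exists_affine_le (U.1 ⊓ V ⊓ V')
    (Classical.arbitrary (U.1 ⊓ V ⊓ V' : C.X.Opens)).2
  have : Nonempty W := ⟨⟨_, hxW⟩⟩
  have hWU : W ≤ U.1 := hWle.trans (inf_le_left.trans inf_le_left)
  have hWV : W ≤ V := hWle.trans (inf_le_left.trans inf_le_right)
  have hWV' : W ≤ V' := hWle.trans inf_le_right
  obtain ⟨D', hD'⟩ := exists_restrict_logVF U.2 hW hWU D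
  rw [← hD'] at hD
  have hc : L.gen V' (l 0) 0 ≠ 0 := by
    intro h
    refine (linearIndependent_toGen (hM := L.isVectorBundle) hl).ne_zero 0 ?_
    ext i
    rw [Subsingleton.elim i 0]
    exact h
  set c := L.gen V' (l 0) 0
  set v := E.gen V s
  have hs : E.gen W (resSection E.E hWV s) = v := toGen_res _ _ _
  have hl' : L.gen W (resSection L.E hWV' (l 0)) 0 = c := congrFun (toGen_res _ _ _) 0
  have h1 := congrArg (E'.gen W) (T.horizontal ⟨W, hW⟩ D' (resSection E.E hWV s)
    (resSection L.E hWV' (l 0)))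
  have h2 := E'.gen_nabla (U := ⟨W, hW⟩) D' (T.iso ⟨W, hW⟩ (resSection E.E hWV s ⊗ₜ
    resSection L.E hWV' (l 0)))
  have h3 := T.gen_iso ⟨W, hW⟩ (resSection E.E hWV s) (resSection L.E hWV' (l 0))
  have h4 := T.gen_iso ⟨W, hW⟩ (E.nabla ⟨W, hW⟩ D' (resSection E.E hWV s))
    (resSection L.E hWV' (l 0))
  have h5 := T.gen_iso ⟨W, hW⟩ (resSection E.E hWV s)
    (L.nabla ⟨W, hW⟩ D' (resSection L.E hWV' (l 0)))
  have h6 := E.gen_nabla (U := ⟨W, hW⟩) D' (resSection E.E hWV s)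
  set μ := L.gen W (L.nabla ⟨W, hW⟩ D' (resSection L.E hWV' (l 0))) 0
  have h7 : theta hW D'.1 • E'.genNabla (c • T.genMap v) =
      c • T.genMap (theta hW D'.1 • E.genNabla v) + μ • T.genMap v := by
    rw [← hs, ← hl']
    refine Eq.trans ?_ ((h2.symm.trans (h1.trans (toGen_add _ _ _))).trans ?_)
    · exact congrArg (fun x => theta hW D'.1 • E'.genNabla x) h3.symm
    · refine congrArg₂ _ (h4.trans ?_) h5
      exact congrArg (fun x => _ • T.genMap x) h6
  have h8 := congrArg (wedge (T.genMap v)) h7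
  rw [map_smul, wedge_smul_right, wedge_add_right, wedge_smul_right, wedge_smul_right,
    wedge_smul_right, wedge_self, wedge_map, genNabla_smul, wedge_add_right, wedge_smul_right,
    wedge_smul_right, wedge_self] at h8
  rw [kappa, kappa]
  apply mul_left_cancel₀ (mul_ne_zero hD hc)
  linear_combination h8

-- κ(b₀) and b₀ ∧ b₁ are both multiplied by `c ^ 2 * δ`, so the quotient in the Hodge condition at a
-- closed point is unchanged.
include T in
theorem isIndigenous (hE : E.IsIndigenous) : E'.IsIndigenous := by
  obtain ⟨F, hF⟩ := hE.exists_hodge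
  obtain ⟨v, hv0, hline, hv⟩ := F.exists_line E.isVectorBundle
  set δ := wedge (T.genMap (Pi.single 0 1)) (T.genMap (Pi.single 1 1)) with hδ
  have hloc : ∀ P : C.Point, E'.IsHodgeAt (T.genMap v) P := by
    intro P
    obtain ⟨V₀, hP₀, b₀, U, hU, -, hPU, D, hb₀, -, hD⟩ := hF.exists_logVF hline hv P
    obtain ⟨V, hP, b, hb, ⟨a, ha⟩, hκ, hlog⟩ := hF.isHodgeAt hline hv P
    have := Point.nonempty hP₀
    have := Point.nonempty hPU
    have := Point.nonempty hP
    have hθ : theta hU D.1 ≠ 0 := by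
      intro h
      rw [h, zero_mul] at hD
      exact hb₀.wedge_ne_zero (hM := E.isVectorBundle) hD.symm
    obtain ⟨W, hPW, b', hb', c, hc, hgen⟩ := T.exists_isFrame hP hb
    have := Point.nonempty hPW
    have hw : wedge (E'.gen W (b' 0)) (E'.gen W (b' 1)) =
        c ^ 2 * δ * wedge (E.gen V (b 0)) (E.gen V (b 1)) := by
      rw [hgen, hgen, wedge_smul_left, wedge_smul_right, wedge_map]
      ring
    have hcδ : c ^ 2 * δ ≠ 0 := by
      intro h
      rw [h, zero_mul] at hw
      exact hb'.wedge_ne_zero (hM := E'.isVectorBundle) hw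
    have hκ' : E'.kappa (E'.gen W (b' 0)) = c ^ 2 * δ * E.kappa (E.gen V (b 0)) := by
      rw [hgen, kappa_smul, T.kappa_genMap (U := ⟨U, hU⟩) hθ, mul_assoc]
    refine ⟨W, hPW, b', hb', ⟨c * a, ?_⟩, ?_, ?_⟩
    · rw [hgen, ha, map_smul, mul_smul]
    · rw [hκ']
      exact mul_ne_zero hcδ hκ
    · rw [hw, hκ', mul_div_mul_left _ _ hcδ]
      exact hlog
  -- Every point specializes to a closed point, and a neighbourhood of the closed point contains it.
  have hline' : IsLine E'.isVectorBundle (T.genMap v) := by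
    intro x
    obtain ⟨p, hp, hcl⟩ := C.exists_isClosed_mem (Z := closure {x}) isClosed_closure.isLocallyClosed
      ⟨x, subset_closure rfl⟩
    obtain ⟨V, hV, b, hb, ⟨a, ha⟩, -⟩ := hloc ⟨p, hcl⟩
    obtain ⟨_, hx, rfl⟩ := mem_closure_iff.1 hp V V.2 hV
    exact ⟨V, hx, b, hb, a, ha⟩
  have hv0' : T.genMap v ≠ 0 := by
    intro h
    obtain ⟨V, hV, b, hb, a, ha⟩ := hline' (genericPoint C.X)
    have : Nonempty V := ⟨⟨_, hV⟩⟩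
    rw [h, smul_zero] at ha
    exact hb.toGen_ne_zero (hM := E'.isVectorBundle) ha
  have hF' : E'.IsHodge (Filtration.ofLine hline') :=
    IsHodge.of_forall_isHodgeAt hv0' (fun U _ s => Filtration.mem_ofLine hline' U s) hloc
  -- A Hodge filtration forces the monodromy to be non-scalar, in particular nonzero.
  exact ⟨⟨_, hF'⟩, fun i z h => hF'.monodromy_ne z 0 (by rw [h, map_zero])⟩

end HorizontalTensorIso

end FlatBundle

/-! ### Global differential forms and the genus -/

theorem KaehlerDifferential.induction_smul_D {R S : Type*} [CommRing R] [CommRing S] [Algebra R S]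
    {p : Ω[S⁄R] → Prop} (hD : ∀ f g : S, p (f • KaehlerDifferential.D R S g))
    (hadd : ∀ x y, p x → p y → p (x + y)) (ω : Ω[S⁄R]) : p ω := by
  have h : ω ∈ Submodule.span S (Set.range (KaehlerDifferential.D R S)) := by
    rw [KaehlerDifferential.span_range_derivation]; trivial
  suffices ∀ a : S, p (a • ω) by simpa using this 1
  induction h using Submodule.span_induction with
  | mem x hx => obtain ⟨g, rfl⟩ := hx; exact fun a => hD a g
  | zero => exact fun _ => by simpa using hD 0 0
  | add x y _ _ hx hy => exact fun a => by rw [smul_add]; exact hadd _ _ (hx a) (hy a)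
  | smul c x _ hx => exact fun a => by rw [smul_smul]; exact hx _

namespace MarkedCurve

variable {k : Type u} [Field k] {r : ℕ} {C : MarkedCurve k r}

theorem formallySmooth_sections {U : C.X.Opens} (hU : IsAffineOpen U) :
    Algebra.FormallySmooth k Γ(C.X, U) := by
  have h1 := C.str.smooth_appLE (isAffineOpen_top _) hU le_top
  have h2 : ((Scheme.ΓSpecIso (CommRingCat.of k)).inv.hom).FormallySmooth :=
    (RingHom.Smooth.of_bijective
      (ConcreteCategory.bijective_of_isIso (Scheme.ΓSpecIso (CommRingCat.of k)).inv)).formallySmooth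
  exact h2.comp h1.formallySmooth

variable [IsAlgClosed k]

section Forms

variable (U : C.X.Opens) [Nonempty U]

/-- The coefficient of a differential form with respect to the dual of `vf`. -/
noncomputable def formToK : Ω[Γ(C.X, U)⁄k] →+ C.K :=
  haveI := isScalarTower_toK U
  (C.diffEquiv.toLinearMap.toAddMonoidHom).comp
    (KaehlerDifferential.map k k Γ(C.X, U) C.K).toAddMonoidHom

theorem formToK_smul_D (f g : Γ(C.X, U)) :
    formToK U (f • KaehlerDifferential.D k _ g) = C.toK U f * C.vf (C.toK U g) := by
  have := isScalarTower_toK U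
  change C.diffEquiv (KaehlerDifferential.map k k Γ(C.X, U) C.K
    (f • KaehlerDifferential.D k Γ(C.X, U) g)) = _
  rw [map_smul, KaehlerDifferential.map_D, ← algebraMap_smul C.K f, map_smul]
  rfl

variable {U}

theorem formToK_resForm {V : C.X.Opens} [Nonempty V] (h : V ≤ U) (ω : Ω[Γ(C.X, U)⁄k]) :
    formToK V (C.resForm h ω) = formToK U ω := by
  induction ω using KaehlerDifferential.induction_smul_D with
  | hD f g =>
    have : C.resForm h (f • KaehlerDifferential.D k _ g) =
        C.res h f • KaehlerDifferential.D k _ (C.res h g) := by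
      let : Algebra Γ(C.X, U) Γ(C.X, V) := (C.res h).toAlgebra
      have : IsScalarTower k Γ(C.X, U) Γ(C.X, V) :=
        IsScalarTower.of_algebraMap_eq fun c => (C.res_algebraMap h c).symm
      refine (map_smul (KaehlerDifferential.map k k Γ(C.X, U) Γ(C.X, V)) f _).trans ?_
      rw [KaehlerDifferential.map_D]
      rfl
    rw [this, formToK_smul_D, formToK_smul_D, toK_res, toK_res]
  | hadd x y hx hy => rw [map_add, map_add, map_add, hx, hy]

/-- In the local ring every `dg` is a regular multiple of the differential of the local parameter.
-/
theorem formToK_mem_ge {P : C.Point} (hP : P.pt ∈ U) (ω : Ω[Γ(C.X, U)⁄k]) :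
    formToK U ω ∈ P.place.ge (C.complete.ord P (C.vf (C.parameters.t P))) := by
  induction ω using KaehlerDifferential.induction_smul_D with
  | hD f g =>
    rw [formToK_smul_D]
    obtain ⟨b, hb⟩ := C.parameters.exists_D_eq P ⟨C.toK U g, toK_mem_ring hP g⟩
    have h1 := congrArg (KaehlerDifferential.map k k (C.complete.place P).ring C.K) hb
    rw [map_smul, KaehlerDifferential.map_D, KaehlerDifferential.map_D,
      ← algebraMap_smul C.K b] at h1
    have h2 := congrArg C.diffEquiv h1
    rw [map_smul] at h2
    change C.vf (C.toK U g) = (b : C.K) * C.vf (C.parameters.t P) at h2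
    rw [h2, ← mul_assoc]
    have h3 := RationalPlace.mul_mem_ge (P := P.place)
      (RationalPlace.mul_mem_ge (P := P.place) (toK_mem_ring hP f) b.2)
      (g := C.vf (C.parameters.t P)) (n := C.complete.ord P (C.vf (C.parameters.t P)))
      (fun _ => le_rfl)
    simpa using h3
  | hadd x y hx hy => rw [map_add]; exact add_mem hx hy

/-- The differentials of a smooth affine curve are torsion free, so they embed in their
localization. -/
theorem formToK_injective (hU : IsAffineOpen U) : Function.Injective (formToK U) := by
  have := isScalarTower_toK U
  have := isFractionRing_toK hU
  have := formallySmooth_sections hU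
  have := KaehlerDifferential.isLocalizedModule_map k Γ(C.X, U) C.K (nonZeroDivisors Γ(C.X, U))
  refine C.diffEquiv.injective.comp ?_
  have := (IsLocalizedModule.injective_iff_isRegular (nonZeroDivisors Γ(C.X, U))
    (KaehlerDifferential.map k k Γ(C.X, U) C.K)).2 ?_
  · exact this
  · rintro ⟨c, hc⟩ x y hxy
    exact smul_right_injective _ (nonZeroDivisors.ne_zero hc) hxy

end Forms

variable (C) in
theorem exists_affineOpens_nonempty : ∃ U : C.X.affineOpens, Nonempty U.1 := by
  obtain ⟨U, hU, -, hx⟩ := exists_affine_le (⊤ : C.X.Opens) (x := genericPoint C.X) trivial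
  exact ⟨⟨U, hU⟩, ⟨⟨_, hx⟩⟩⟩

variable (C) in
/-- Global differential forms as rational functions. -/
theorem exists_globalForms_toK : ∃ a : C.globalForms →ₗ[k] C.K, Function.Injective a ∧
    ∀ ω (P : C.Point), a ω ∈ P.place.ge (C.complete.ord P (C.vf (C.parameters.t P))) := by
  obtain ⟨U₀, hU₀⟩ := C.exists_affineOpens_nonempty
  have hcompat : ∀ (ω : C.globalForms) (U : C.X.affineOpens) [Nonempty U.1],
      formToK U₀.1 (ω.1 U₀) = formToK U.1 (ω.1 U) := by
    intro ω U _
    have := nonempty_inf U₀.1 U.1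
    obtain ⟨V, hV, hVle, hxV⟩ := exists_affine_le (U₀.1 ⊓ U.1)
      (Classical.arbitrary (U₀.1 ⊓ U.1 : C.X.Opens)).2
    have hVn : Nonempty V := ⟨⟨_, hxV⟩⟩
    rw [← formToK_resForm (hVle.trans inf_le_left) (ω.1 U₀),
      ← formToK_resForm (hVle.trans inf_le_right) (ω.1 U),
      ω.2 U₀ ⟨V, hV⟩ (hVle.trans inf_le_left), ω.2 U ⟨V, hV⟩ (hVle.trans inf_le_right)]
  let a : C.globalForms →+ C.K :=
    { toFun := fun ω => formToK U₀.1 (ω.1 U₀)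
      map_zero' := map_zero (formToK U₀.1)
      map_add' := fun _ _ => map_add (formToK U₀.1) _ _ }
  refine ⟨{ a with map_smul' := fun c ω => ?_ }, ?_, ?_⟩
  · have := isScalarTower_toK U₀.1
    change C.diffEquiv (KaehlerDifferential.map k k Γ(C.X, U₀.1) C.K (c • ω.1 U₀)) =
      c • C.diffEquiv (KaehlerDifferential.map k k Γ(C.X, U₀.1) C.K (ω.1 U₀))
    rw [← algebraMap_smul Γ(C.X, U₀.1) c (ω.1 U₀), map_smul, algebraMap_smul,
      ← algebraMap_smul C.K c, map_smul, algebraMap_smul]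
  · rw [injective_iff_map_eq_zero]
    intro ω hω
    ext1
    funext U
    by_cases hn : Nonempty U.1
    · apply formToK_injective U.2
      rw [← hcompat]
      exact hω.trans (map_zero _).symm
    · have := subsingleton_functions_of_isEmpty hn
      have := Module.subsingleton Γ(C.X, U.1) Ω[Γ(C.X, U.1)⁄k]
      exact Subsingleton.elim _ _
  · intro ω P
    obtain ⟨V, hV, -, hP⟩ := exists_affine_le (⊤ : C.X.Opens) (x := P.pt) trivial
    have := Point.nonempty hP
    change formToK U₀.1 (ω.1 U₀) ∈ _
    rw [hcompat ω ⟨V, hV⟩]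
    exact formToK_mem_ge hP _

/-- On a hyperbolic curve the square of the sheaf of logarithmic vector fields has no global
sections. -/
theorem eq_zero_of_ord_ge (hC : 0 < 2 * (C.genus : ℤ) - 2 + r) {h : C.K}
    (hh : ∀ P : C.Point, h ∈ P.place.ge (-2 * C.complete.ord P (C.vf (C.parameters.t P))))
    (hm : ∀ i, h ∈ (C.markedPoint i).place.ge
      (-2 * C.complete.ord (C.markedPoint i) (C.vf (C.parameters.t (C.markedPoint i))) + 2)) :
    h = 0 := by
  classical
  by_contra h0
  obtain ⟨a, ha, hord⟩ := C.exists_globalForms_toK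
  -- `h` times the square of a form is regular everywhere, since the orders of the two factors
  -- compensate.
  have hconst : ∀ ω, ∃ c : k, algebraMap k C.K c = h * a ω ^ 2 := by
    refine fun ω => exists_const_of_forall_mem_ring fun P => ?_
    have h1 := RationalPlace.mul_mem_ge (hh P)
      (RationalPlace.mul_mem_ge (hord ω P) (hord ω P))
    rw [← pow_two] at h1
    rw [RationalPlace.mem_ring]
    convert h1 using 2
    ring
  obtain hg | hg | hg : C.genus = 0 ∨ C.genus = 1 ∨ 1 < C.genus := by omega
  -- Genus zero enters only through `r ≥ 3`. So it does not matter that `genus` would also be zero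
  -- for an infinite-dimensional space of forms.
  · have hr : 3 ≤ r := by omega
    have hinj : Function.Injective (C.markedPoint) := fun i j hij =>
      C.pt_injective (congrArg Point.pt hij)
    refine h0 (CompleteCurve.Parameters.eq_zero_of_ord_ge C.parameters vf_ne_zero
      (B := (Finset.univ : Finset (Fin 3)).image fun i => C.markedPoint (Fin.castLE hr i)) ?_
      (fun P => hh P h0) ?_)
    · rw [Finset.card_image_of_injective (f := fun i => C.markedPoint (Fin.castLE hr i)) _
        (hinj.comp (Fin.castLE_injective hr))]
      simp
    · intro P hP
      obtain ⟨i, -, rfl⟩ := Finset.mem_image.1 hP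
      exact hm _ h0
  -- Genus one: the constant `h * a ω ^ 2` vanishes to order two at a marked point.
  · have hr : 0 < r := by omega
    have : Nontrivial C.globalForms := Module.nontrivial_of_finrank_pos (R := k)
      (by rw [genus] at hg; omega)
    obtain ⟨ω, hω⟩ := exists_ne (0 : C.globalForms)
    have haω : a ω ≠ 0 := fun h => hω (ha (h.trans (map_zero a).symm))
    obtain ⟨c, hc⟩ := hconst ω
    have hne : h * a ω ^ 2 ≠ 0 := mul_ne_zero h0 (pow_ne_zero 2 haω)
    have hc0 : c ≠ 0 := fun hz => hne (by rw [← hc, hz, map_zero])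
    let P := C.markedPoint ⟨0, hr⟩
    have h1 := RationalPlace.mul_mem_ge (hm ⟨0, hr⟩)
      (RationalPlace.mul_mem_ge (hord ω P) (hord ω P))
    rw [← pow_two] at h1
    have h2 : -2 * C.complete.ord P (C.vf (C.parameters.t P)) + 2 +
        (C.complete.ord P (C.vf (C.parameters.t P)) + C.complete.ord P (C.vf (C.parameters.t P))) ≤
        P.place.ord (h * a ω ^ 2) := h1 hne
    rw [← hc, P.place.ord_algebraMap c hc0] at h2
    omega
  · rw [genus] at hg
    have hfin := Module.finite_of_finrank_pos (R := k) (M := C.globalForms) (by omega)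
    obtain ⟨ω, hω⟩ : ∃ ω : C.globalForms, ω ≠ 0 := by
      have : Nontrivial C.globalForms := Module.nontrivial_of_finrank_pos (R := k) (by omega)
      exact exists_ne _
    obtain ⟨η, hη⟩ := exists_linearIndependent_pair_of_one_lt_finrank hg hω
    have haω : a ω ≠ 0 := fun h => hω (ha (h.trans (map_zero a).symm))
    obtain ⟨c, hc⟩ := hconst ω
    obtain ⟨c', hc'⟩ := hconst η
    have hne : h * a ω ^ 2 ≠ 0 := mul_ne_zero h0 (pow_ne_zero 2 haω)
    have hc0 : c ≠ 0 := fun hz => hne (by rw [← hc, hz, map_zero])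
    -- The squares of `a ω` and `a η` differ by a constant. Its square root `d` gives `a η = ± d • a
    -- ω`, against independence.
    obtain ⟨d, hd⟩ := IsAlgClosed.exists_pow_nat_eq (c' / c) (n := 2) (by norm_num)
    have h1 : a η ^ 2 = algebraMap k C.K d ^ 2 * a ω ^ 2 := by
      apply mul_left_cancel₀ h0
      rw [← hc', mul_left_comm, ← hc, ← map_pow, hd, ← map_mul, div_mul_cancel₀ _ hc0]
    rw [← mul_pow, sq_eq_sq_iff_eq_or_eq_neg, ← Algebra.smul_def, ← map_smul, ← map_neg] at h1
    rw [LinearIndependent.pair_iff] at hη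
    rcases h1 with h1 | h1
    · have := (hη d (-1) (by rw [ha h1]; simp)).2
      simp at this
    · have := (hη d 1 (by rw [ha h1]; simp)).2
      simp at this

end MarkedCurve

/-! ### Uniqueness of the Hodge filtration -/

namespace FlatBundle

variable {k : Type u} [Field k] [IsAlgClosed k] {r : ℕ} {C : MarkedCurve k r} {E : FlatBundle C 2}

/-- The local contribution of a Hodge filtration to the bound of the second fundamental form. -/
theorem IsHodgeAt.exists_log {v : Fin 2 → C.K} {P : C.Point} (h : E.IsHodgeAt v P) :
    ∃ (u : Fin 2 → C.K) (a θ : C.K), InLattice E.isVectorBundle P u ∧ u = a • v ∧ a ≠ 0 ∧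
      θ ≠ 0 ∧ IsLogAt P θ ∧
      ∀ u', InLattice E.isVectorBundle P u' → wedge u u' / E.kappa u / θ ∈ P.place.ring := by
  obtain ⟨V, hP, b, hb, ⟨a, ha⟩, hκ, hlog⟩ := h
  have := Point.nonempty hP
  have hw : wedge (E.gen V (b 0)) (E.gen V (b 1)) ≠ 0 := hb.wedge_ne_zero
  have ha0 : a ≠ 0 := fun h => hb.toGen_ne_zero (hM := E.isVectorBundle) (by
    rw [h, zero_smul] at ha; exact ha)
  refine ⟨_, a, wedge (E.gen V (b 0)) (E.gen V (b 1)) / E.kappa (E.gen V (b 0)),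
    inLattice_toGen hP (b 0), ha, ha0, div_ne_zero hw hκ, ?_, fun u' hu' => ?_⟩
  · rw [hlog, div_mul_div_cancel₀ hκ, div_self hw]
    exact P.place.ring.one_mem
  · rw [div_div_div_cancel_right₀ hκ]
    exact wedge_div_mem_ring hb hP hu'

theorem IsHodgeAt.kappa_ne_zero {v : Fin 2 → C.K} {P : C.Point} (h : E.IsHodgeAt v P) :
    E.kappa v ≠ 0 := by
  obtain ⟨V, hP, b, -, ⟨a, ha⟩, hκ, -⟩ := h
  intro h0
  rw [ha, kappa_smul, h0, mul_zero] at hκ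
  exact hκ rfl

/-- The square of `wedge v w` divided by `E.kappa v * E.kappa w` is unchanged when `v` and `w` are
rescaled. At each point it is a regular multiple of a product of two logarithmic vector fields, so
it is a global section of the square of τ^log and vanishes. -/
theorem wedge_eq_zero_of_isHodgeAt (hC : 0 < 2 * (C.genus : ℤ) - 2 + r) {v w : Fin 2 → C.K}
    (hv : ∀ P, E.IsHodgeAt v P) (hw : ∀ P, E.IsHodgeAt w P) : wedge v w = 0 := by
  by_contra hvw
  obtain ⟨P₀, -⟩ := Point.exists_mem (C := C) (U := ⊤) ⟨genericPoint C.X, trivial⟩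
  have hκv := (hv P₀).kappa_ne_zero
  have hκw := (hw P₀).kappa_ne_zero
  have hne : wedge v w ^ 2 / (E.kappa v * E.kappa w) ≠ 0 :=
    div_ne_zero (pow_ne_zero 2 hvw) (mul_ne_zero hκv hκw)
  refine hne (eq_zero_of_ord_ge hC ?_ ?_)
  all_goals
    -- Local generators `u`, `u'` of the two lines lie in the lattice, so each may serve as the test
    -- vector for the other. Up to sign, the product of the two regular quotients is the global
    -- function divided by `θ * θ'`.
    have key : ∀ P : C.Point, ∃ θ θ' : C.K, θ ≠ 0 ∧ θ' ≠ 0 ∧ IsLogAt P θ ∧ IsLogAt P θ' ∧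
        P.place.ord θ + P.place.ord θ' ≤
          P.place.ord (wedge v w ^ 2 / (E.kappa v * E.kappa w)) := by
      intro P
      obtain ⟨u, a, θ, hu, rfl, ha, hθ, hlog, h⟩ := (hv P).exists_log
      obtain ⟨u', a', θ', hu', rfl, ha', hθ', hlog', h'⟩ := (hw P).exists_log
      refine ⟨θ, θ', hθ, hθ', hlog, hlog', ?_⟩
      have h1 := P.place.ring.neg_mem (P.place.ring.mul_mem (h _ hu') (h' _ hu))
      have h2 : -(wedge (a • v) (a' • w) / E.kappa (a • v) / θ *
          (wedge (a' • w) (a • v) / E.kappa (a' • w) / θ')) =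
          wedge v w ^ 2 / (E.kappa v * E.kappa w) * (θ * θ')⁻¹ := by
        rw [wedge_comm (a' • w)]
        simp only [wedge_smul_left, wedge_smul_right, kappa_smul]
        field_simp
      rw [h2] at h1
      have h3 : 0 ≤ P.place.ord _ := h1 (mul_ne_zero hne (inv_ne_zero (mul_ne_zero hθ hθ')))
      rw [P.place.ord_mul hne (inv_ne_zero (mul_ne_zero hθ hθ')),
        P.place.ord_inv (mul_ne_zero hθ hθ'), P.place.ord_mul hθ hθ'] at h3
      omega
  · intro P _
    obtain ⟨θ, θ', hθ, hθ', hlog, hlog', hord⟩ := key P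
    have h1 : _ ≤ P.place.ord θ := (hlog.le_ord hθ).1
    have h2 : _ ≤ P.place.ord θ' := (hlog'.le_ord hθ').1
    omega
  · intro i _
    obtain ⟨θ, θ', hθ, hθ', hlog, hlog', hord⟩ := key (C.markedPoint i)
    have h1 : _ ≤ (C.markedPoint i).place.ord θ := (hlog.le_ord hθ).2 i rfl
    have h2 : _ ≤ (C.markedPoint i).place.ord θ' := (hlog'.le_ord hθ').2 i rfl
    omega

theorem IsHodge.unique (hC : 0 < 2 * (C.genus : ℤ) - 2 + r) {F F' : Filtration E.E}
    (hF : E.IsHodge F) (hF' : E.IsHodge F') : F = F' := by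
  obtain ⟨v, hv0, hline, hv⟩ := F.exists_line E.isVectorBundle
  obtain ⟨w, hw0, hline', hw⟩ := F'.exists_line E.isVectorBundle
  have h := wedge_eq_zero_of_isHodgeAt hC (hF.isHodgeAt hline hv) (hF'.isHodgeAt hline' hw)
  obtain ⟨a, rfl⟩ := (wedge_eq_zero_iff hv0).1 h
  have ha : a ≠ 0 := fun h => hw0 (by rw [h, zero_smul])
  have hFF' : F.F = F'.F := by
    funext U
    by_cases hn : Nonempty U
    · ext s
      rw [hv, hw, wedge_smul_left, mul_eq_zero, or_iff_right ha]
    · have := subsingleton_sections_of_isEmpty (M := E.E) hn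
      exact Subsingleton.elim _ _
  obtain ⟨f, _, _, _⟩ := F
  obtain ⟨f', _, _, _⟩ := F'
  obtain rfl : f = f' := hFF'
  rfl

end FlatBundle

theorem proposition2p3 {k : Type u} [Field k] [IsAlgClosed k] {r : ℕ} (C : MarkedCurve k r)
    (hC : 0 < 2 * (C.genus : ℤ) - 2 + r) (E : FlatBundle C 2) (hE : E.IsIndigenous) :
    (∃! F : Filtration E.E, E.IsHodge F) ∧
    (∀ (i : Fin r) (z : C.LogCoordinate i), E.IsToric z →
      ∀ α β : k, E.HasExponents z α β → α ≠ β) ∧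
    (∀ E' : FlatBundle C 2, E.Equivalent E' → E'.IsIndigenous) := by
  obtain ⟨F, hF⟩ := hE.exists_hodge
  exact ⟨⟨F, hF, fun F' hF' => FlatBundle.IsHodge.unique hC hF' hF⟩,
    fun _ _ hz _ _ h => hF.ne_of_hasExponents hz h, fun _ ⟨_, ⟨T⟩⟩ => T.isIndigenous hE⟩
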